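/- Let $\mathcal G$ be a Hausdorff locally compact étale groupoid (not necessarily second countable or amenable) with unit space $\mathcal G^{(0)}$, source and range maps $s,r$, and put $\mathcal G_x=s^{-1}(x)$, $\mathcal G^x=r^{-1}(x)$, $\mathcal G^x_x=\mathcal G_x\cap\mathcal G^x$, $\mathrm{Iso}(\mathcal G)=\bigcup_x\mathcal G^x_x$. Let $C^*(\mathcal G)$ be the full groupoid C$^*$-algebra, i.e. the completion of the convolution $*$-algebra $C_c(\mathcal G)$ in the norm $\|f\|=\sup_\rho\|\rho(f)\|$, the supremum being over all $*$-representations $\rho$ of $C_c(\mathcal G)$ by bounded operators on Hilbert spaces. Let $\operatorname{Prim}C^*(\mathcal G)$ be the space of kernels of irreducible representations of $C^*(\mathcal G)$ with the Jacobson topology. Let $\operatorname{Char}(\mathcal G)$ be the set of pairs $(x,\chi)$ with $x\in\mathcal G^{(0)}$ and $\chi\colon\mathcal G^x_x\to\mathbb T$ a character (group homomorphism), with the topology generated by the sets $$\mathcal O(U,K,V)=\{(x,\chi): x\in U,\ \chi(K\cap\mathcal G^x_x)\subset V\},$$ where $U\subset\mathcal G^{(0)}$ is open, $K\subset\mathrm{Iso}(\mathcal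 G)$ is compact and $V\subset\mathbb T$ is open. The groupoid acts on $\operatorname{Char}(\mathcal G)$ by $g(x,\chi)=(r(g),\chi(g^{-1}\cdot g))$ for $g\in\mathcal G_x$. Let $\operatorname{Char}_a(\mathcal G)\subset\operatorname{Char}(\mathcal G)$ be the subspace of the pairs $(x,\chi)$ such that the discrete group $\mathcal G^x_x$ is amenable. For $(x,\chi)\in\operatorname{Char}(\mathcal G)$, let $\operatorname{Ind}(x,\chi)\in\operatorname{Prim}C^*(\mathcal G)$ be the kernel of the induced (irreducible) representation $\pi$ of $C^*(\mathcal G)$ on the Hilbert space of functions $\xi\colon\mathcal G_x\to\mathbb C$ such that $\xi(gh)=\overline{\chi(h)}\,\xi(g)$ for all $g\in\mathcal G_x$, $h\in\mathcal G^x_x$, and $\sum_{g\in\mathcal G_x/\mathcal G^x_x}|\xi(g)|^2<\infty$, given by $$(\pi(f)\xi)(g)=\sum_{h\in\mathcal G^{r(g)}}f(h)\,\xi(h^{-1}g),\qquad f\in C_c(\mathcal G).$$ For a topological space $Y$, denote by $Y^\sim$ its $T_0$-ization, i.e. the quotient of $Y$ by the relation that identifies two points when they have the same closure. Then, for every $\mathcal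 G$-invariant subset $A\subset\operatorname{Char}_a(\mathcal G)$ (with the relative topology): 1. the map $\operatorname{Ind}$ defines a homeomorphism of the quasi-orbit space $(\mathcal G\backslash A)^\sim$ onto $\operatorname{Ind}A\subset\operatorname{Prim}C^*(\mathcal G)$, the latter being considered with the relative topology; 2. the map $\operatorname{Ind}|_A\colon A\to\operatorname{Ind}A$ is open; 3. for all $(x,\chi),(y,\eta)\in A$, we have $\operatorname{Ind}(x,\chi)=\operatorname{Ind}(y,\eta)$ if and only if the $\mathcal G$-orbits of $(x,\chi)$ and $(y,\eta)$ have the same closure in $A$, equivalently, if and only if they have the same closure in $\operatorname{Char}(\mathcal G)$. -/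

import Mathlib

open Set Filter Topology
open scoped ComplexConjugate InnerProductSpace

universe u v

set_option linter.unusedSectionVars false
set_option linter.unusedVariables false

/-- A (topological) étale groupoid with space of arrows `G` and unit space `X`, embedded in `G` by
`unit`.  The product of `g` and `h` is defined when `src g = rng h`; `mul` is a total function, and
its values on pairs that are not composable are never used. -/
structure EtaleGroupoid (X : Type u) (G : Type v) [TopologicalSpace X] [TopologicalSpace G] where
  src : G → X
  rng : G → X
  unit : X → G
  inv : G → G
  mul : G → G → G
  src_unit : ∀ x, src (unit x) = x
  rng_unit : ∀ x, rng (unit x) = x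
  src_inv : ∀ g, src (inv g) = rng g
  rng_inv : ∀ g, rng (inv g) = src g
  src_mul : ∀ g h, src g = rng h → src (mul g h) = src h
  rng_mul : ∀ g h, src g = rng h → rng (mul g h) = rng g
  mul_assoc : ∀ g h k, src g = rng h → src h = rng k → mul (mul g h) k = mul g (mul h k)
  mul_unit : ∀ g, mul g (unit (src g)) = g
  unit_mul : ∀ g, mul (unit (rng g)) g = g
  inv_mul : ∀ g, mul (inv g) g = unit (src g)
  mul_inv : ∀ g, mul g (inv g) = unit (rng g)
  continuousOn_mul : ContinuousOn (fun p : G × G => mul p.1 p.2) {p | src p.1 = rng p.2}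
  continuous_inv : Continuous inv
  continuous_unit : Continuous unit
  isLocalHomeomorph_src : IsLocalHomeomorph src
  isLocalHomeomorph_rng : IsLocalHomeomorph rng

namespace EtaleGroupoid

variable {X : Type u} {G : Type v} [TopologicalSpace X] [TopologicalSpace G]

section Algebra

variable (𝒢 : EtaleGroupoid X G)

theorem inv_mul_cancel_left (g h : G) (e : 𝒢.src g = 𝒢.rng h) :
    𝒢.mul (𝒢.inv g) (𝒢.mul g h) = h := by
  rw [← 𝒢.mul_assoc _ _ _ (𝒢.src_inv g) e, 𝒢.inv_mul, e, 𝒢.unit_mul]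

theorem mul_inv_cancel_left (g h : G) (e : 𝒢.rng g = 𝒢.rng h) :
    𝒢.mul g (𝒢.mul (𝒢.inv g) h) = h := by
  rw [← 𝒢.mul_assoc _ _ _ (𝒢.rng_inv g).symm (by rw [𝒢.src_inv, e]), 𝒢.mul_inv, e, 𝒢.unit_mul]

theorem mul_left_cancel (g h k : G) (e : 𝒢.src g = 𝒢.rng h) (e' : 𝒢.src g = 𝒢.rng k)
    (H : 𝒢.mul g h = 𝒢.mul g k) : h = k := by
  rw [← 𝒢.inv_mul_cancel_left g h e, H, 𝒢.inv_mul_cancel_left g k e']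

theorem inv_inv (g : G) : 𝒢.inv (𝒢.inv g) = g := by
  refine 𝒢.mul_left_cancel (𝒢.inv g) _ _ ?_ (𝒢.src_inv g) ?_
  · rw [𝒢.rng_inv]
  · rw [𝒢.mul_inv, 𝒢.inv_mul, 𝒢.rng_inv]

theorem inv_unit (x : X) : 𝒢.inv (𝒢.unit x) = 𝒢.unit x := by
  refine 𝒢.mul_left_cancel (𝒢.unit x) _ _ ?_ ?_ ?_
  · rw [𝒢.rng_inv]
  · rw [𝒢.src_unit, 𝒢.rng_unit]
  · have h1 := 𝒢.mul_unit (𝒢.unit x)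
    rw [𝒢.src_unit] at h1
    rw [𝒢.mul_inv, 𝒢.rng_unit, h1]

theorem inv_mul_rev (g h : G) (e : 𝒢.src g = 𝒢.rng h) :
    𝒢.inv (𝒢.mul g h) = 𝒢.mul (𝒢.inv h) (𝒢.inv g) := by
  have e2 : 𝒢.src (𝒢.inv h) = 𝒢.rng (𝒢.inv g) := by rw [𝒢.src_inv, 𝒢.rng_inv, e]
  refine 𝒢.mul_left_cancel (𝒢.mul g h) _ _ (𝒢.rng_inv _).symm ?_ ?_
  · rw [𝒢.src_mul _ _ e, 𝒢.rng_mul _ _ e2, 𝒢.rng_inv]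
  · rw [𝒢.mul_inv, 𝒢.rng_mul _ _ e, 𝒢.mul_assoc _ _ _ e (by rw [𝒢.rng_mul _ _ e2, 𝒢.rng_inv]),
      𝒢.mul_inv_cancel_left _ _ (by rw [𝒢.rng_inv, e]), 𝒢.mul_inv]

theorem unit_injective : Function.Injective 𝒢.unit := fun x y h => by
  rw [← 𝒢.src_unit x, h, 𝒢.src_unit]

theorem continuous_src : Continuous 𝒢.src := 𝒢.isLocalHomeomorph_src.continuous

theorem continuous_rng : Continuous 𝒢.rng := 𝒢.isLocalHomeomorph_rng.continuous

theorem t2Space_unitSpace [T2Space G] (𝒢 : EtaleGroupoid X G) : T2Space X :=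
  T2Space.of_injective_continuous 𝒢.unit_injective 𝒢.continuous_unit

/-- The isotropy group at `x`. -/
def Isotropy (x : X) : Type v := {g : G // 𝒢.src g = x ∧ 𝒢.rng g = x}

instance (x : X) : Group (𝒢.Isotropy x) where
  mul g h := ⟨𝒢.mul g.1 h.1, by
    have e : 𝒢.src g.1 = 𝒢.rng h.1 := by rw [g.2.1, h.2.2]
    rw [𝒢.src_mul _ _ e, 𝒢.rng_mul _ _ e]; exact ⟨h.2.1, g.2.2⟩⟩
  one := ⟨𝒢.unit x, 𝒢.src_unit x, 𝒢.rng_unit x⟩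
  inv g := ⟨𝒢.inv g.1, by rw [𝒢.src_inv, 𝒢.rng_inv]; exact ⟨g.2.2, g.2.1⟩⟩
  mul_assoc g h k := Subtype.ext
    (𝒢.mul_assoc _ _ _ (by rw [g.2.1, h.2.2]) (by rw [h.2.1, k.2.2]))
  one_mul g := Subtype.ext (by
    have := 𝒢.unit_mul g.1
    rw [g.2.2] at this; exact this)
  mul_one g := Subtype.ext (by
    have := 𝒢.mul_unit g.1
    rw [g.2.1] at this; exact this)
  inv_mul_cancel g := Subtype.ext (by
    have := 𝒢.inv_mul g.1
    rw [g.2.1] at this; exact this)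

theorem isotropy_mul_val {x : X} (g h : 𝒢.Isotropy x) : (g * h).1 = 𝒢.mul g.1 h.1 := rfl

theorem isotropy_one_val (x : X) : (1 : 𝒢.Isotropy x).1 = 𝒢.unit x := rfl

/-- A bisection is a subset of `G` on which `src` and `rng` are injective. -/
def IsBisection (W : Set G) : Prop := InjOn 𝒢.src W ∧ InjOn 𝒢.rng W

theorem exists_bisection (g : G) : ∃ W : Set G, IsOpen W ∧ g ∈ W ∧ 𝒢.IsBisection W := by
  obtain ⟨e, he, hs⟩ := 𝒢.isLocalHomeomorph_src g
  obtain ⟨e', he', hr⟩ := 𝒢.isLocalHomeomorph_rng g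
  refine ⟨e.source ∩ e'.source, e.open_source.inter e'.open_source, ⟨he, he'⟩, ?_, ?_⟩
  · rw [hs]; exact e.injOn.mono inter_subset_left
  · rw [hr]; exact e'.injOn.mono inter_subset_right

end Algebra

/-- The space `C_c(G)` of continuous compactly supported functions on the groupoid, to be equipped
with the convolution product. -/
def Cc (_ : EtaleGroupoid X G) : Type v := CompactlySupportedContinuousMap G ℂ

variable {𝒢 : EtaleGroupoid X G}

namespace Cc

noncomputable instance : AddCommGroup 𝒢.Cc :=
  inferInstanceAs (AddCommGroup (CompactlySupportedContinuousMap G ℂ))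

noncomputable instance : Module ℂ 𝒢.Cc :=
  inferInstanceAs (Module ℂ (CompactlySupportedContinuousMap G ℂ))

instance : FunLike 𝒢.Cc G ℂ :=
  inferInstanceAs (FunLike (CompactlySupportedContinuousMap G ℂ) G ℂ)

/-- Build an element of `C_c(G)`. -/
def mk (f : G → ℂ) (hf : Continuous f) (hs : HasCompactSupport f) : 𝒢.Cc :=
  (⟨⟨f, hf⟩, hs⟩ : CompactlySupportedContinuousMap G ℂ)

@[simp] theorem mk_apply (f : G → ℂ) (hf : Continuous f) (hs : HasCompactSupport f) (g : G) :
    (mk f hf hs : 𝒢.Cc) g = f g := rfl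

@[ext] theorem ext {f g : 𝒢.Cc} (h : ∀ x, f x = g x) : f = g := DFunLike.ext f g h

@[simp] theorem add_apply (f g : 𝒢.Cc) (x : G) : (f + g) x = f x + g x := rfl
@[simp] theorem sub_apply (f g : 𝒢.Cc) (x : G) : (f - g) x = f x - g x := rfl
@[simp] theorem zero_apply (x : G) : (0 : 𝒢.Cc) x = 0 := rfl
@[simp] theorem smul_apply (c : ℂ) (f : 𝒢.Cc) (x : G) : (c • f) x = c * f x := rfl

theorem continuous (f : 𝒢.Cc) : Continuous f :=
  (show CompactlySupportedContinuousMap G ℂ from f).toContinuousMap.continuous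

theorem hasCompactSupport (f : 𝒢.Cc) : HasCompactSupport f :=
  (show CompactlySupportedContinuousMap G ℂ from f).hasCompactSupport'

theorem exists_bound (f : 𝒢.Cc) : ∃ C : ℝ, 0 ≤ C ∧ ∀ g, ‖f g‖ ≤ C := by
  obtain ⟨C, hC⟩ := f.hasCompactSupport.exists_bound_of_continuous f.continuous
  exact ⟨max C 0, le_max_right _ _, fun g => (hC g).trans (le_max_left _ _)⟩

/-- Functions supported in an open bisection. -/
def OnBisection (f : 𝒢.Cc) : Prop :=
  ∃ W : Set G, IsOpen W ∧ 𝒢.IsBisection W ∧ tsupport f ⊆ W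

theorem induction [T2Space G] [LocallyCompactSpace G] {P : 𝒢.Cc → Prop}
    (hzero : P 0) (hadd : ∀ f g, P f → P g → P (f + g)) (hb : ∀ f : 𝒢.Cc, f.OnBisection → P f)
    (f : 𝒢.Cc) : P f := by
  choose W hWo hgW hWb using 𝒢.exists_bisection
  obtain ⟨t, ht⟩ := f.hasCompactSupport.isCompact.elim_finite_subcover W hWo
    (fun g _ => mem_iUnion.2 ⟨g, hgW g⟩)
  set e := t.equivFin.symm
  obtain ⟨φ, hφs, hφ1, -, -⟩ := exists_continuous_sum_one_of_isOpen_isCompact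
    (s := fun i : Fin t.card => W (e i)) (fun i => hWo _) f.hasCompactSupport.isCompact (by
      intro g hg
      obtain ⟨k, hk, hgk⟩ := mem_iUnion₂.1 (ht hg)
      exact mem_iUnion.2 ⟨e.symm ⟨k, hk⟩, by simpa using hgk⟩)
  let F : Fin t.card → 𝒢.Cc := fun i => mk (fun g => (φ i g : ℂ) * f g)
    ((Complex.continuous_ofReal.comp (φ i).continuous).mul f.continuous)
    f.hasCompactSupport.mul_left
  have hF : ∀ i, (F i).OnBisection := fun i => ⟨W (e i), hWo _, hWb _, by
    refine (closure_mono ?_).trans (hφs i)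
    intro g hg hg0
    exact hg (by simp [F, hg0])⟩
  have hsum : f = ∑ i, F i := by
    ext g
    have hs : (∑ i, F i) g = ∑ i, F i g := by
      have : ∀ s : Finset (Fin t.card), (∑ i ∈ s, F i) g = ∑ i ∈ s, F i g := by
        intro s
        induction s using Finset.induction_on with
        | empty => simp
        | insert a s ha ih => rw [Finset.sum_insert ha, Finset.sum_insert ha, add_apply, ih]
      exact this _
    rw [hs]
    simp only [F, mk_apply, ← Finset.sum_mul]
    by_cases hg : g ∈ tsupport f
    · have := hφ1 hg
      simp only [Finset.sum_apply, Pi.one_apply] at this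
      rw [← Complex.ofReal_sum, this]; simp
    · rw [image_eq_zero_of_notMem_tsupport hg]; simp
  rw [hsum]
  exact Finset.sum_induction F P hadd hzero fun i _ => hb _ (hF i)

end Cc

section Conv

variable (𝒢) in
/-- Convolution `(f * F)(g) = ∑ f(h) F(h⁻¹ g)`, the sum being over all `h` with `r(h) = r(g)`;
for `f ∈ C_c(G)` it has only finitely many nonzero terms. -/
noncomputable def conv (f F : G → ℂ) (g : G) : ℂ :=
  ∑ᶠ h ∈ 𝒢.rng ⁻¹' {𝒢.rng g}, f h * F (𝒢.mul (𝒢.inv h) g)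

theorem finite_rng_support (f : 𝒢.Cc) (x : X) :
    (𝒢.rng ⁻¹' {x} ∩ Function.support f).Finite := by
  choose W hWo hgW hWb using 𝒢.exists_bisection
  obtain ⟨t, ht⟩ := f.hasCompactSupport.isCompact.elim_finite_subcover W hWo
    (fun g _ => mem_iUnion.2 ⟨g, hgW g⟩)
  refine (t.finite_toSet.biUnion (t := fun i => 𝒢.rng ⁻¹' {x} ∩ W i) fun i _ => ?_).subset ?_
  · refine Set.Subsingleton.finite fun a ha b hb => (hWb i).2 ha.2 hb.2 ?_
    rw [ha.1, hb.1]
  · rintro g ⟨h1, h2⟩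
    obtain ⟨k, hk, hgk⟩ := mem_iUnion₂.1 (ht (subset_tsupport f h2))
    exact mem_biUnion hk ⟨h1, hgk⟩

theorem finite_conv_support (f : 𝒢.Cc) (F : G → ℂ) (g : G) :
    (𝒢.rng ⁻¹' {𝒢.rng g} ∩ Function.support fun h => f h * F (𝒢.mul (𝒢.inv h) g)).Finite :=
  (finite_rng_support f (𝒢.rng g)).subset
    (inter_subset_inter_right _ fun _ h h0 => h (by simp [h0]))

theorem conv_add_left (f f' : 𝒢.Cc) (F : G → ℂ) :
    𝒢.conv (f + f' : 𝒢.Cc) F = 𝒢.conv f F + 𝒢.conv f' F := by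
  ext g
  simp only [conv, Pi.add_apply, Cc.add_apply, add_mul]
  exact finsum_mem_add_distrib' (finite_conv_support f F g) (finite_conv_support f' F g)

theorem conv_zero_left (F : G → ℂ) : 𝒢.conv (0 : 𝒢.Cc) F = 0 := by
  ext g; simp [conv]

theorem conv_smul_left (c : ℂ) (f : 𝒢.Cc) (F : G → ℂ) :
    𝒢.conv (c • f : 𝒢.Cc) F = c • 𝒢.conv f F := by
  ext g
  simp only [conv, Pi.smul_apply, Cc.smul_apply, ← smul_eq_mul, smul_finsum, smul_assoc]

theorem conv_add_right (f : 𝒢.Cc) (F F' : G → ℂ) :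
    𝒢.conv f (F + F') = 𝒢.conv f F + 𝒢.conv f F' := by
  ext g
  simp only [conv, Pi.add_apply, mul_add]
  exact finsum_mem_add_distrib' (finite_conv_support f F g) (finite_conv_support f F' g)

theorem conv_smul_right (c : ℂ) (f : 𝒢.Cc) (F : G → ℂ) :
    𝒢.conv f (c • F) = c • 𝒢.conv f F := by
  ext g
  simp only [conv, Pi.smul_apply, ← smul_eq_mul, smul_finsum, smul_comm _ c]

/-- Evaluation of a convolution by a function supported in a bisection. -/
theorem conv_eq_of_mem {f : G → ℂ} {W : Set G} (hW : InjOn 𝒢.rng W) (hf : Function.support f ⊆ W)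
    (F : G → ℂ) {g w : G} (hw : w ∈ W) (hwg : 𝒢.rng w = 𝒢.rng g) :
    𝒢.conv f F g = f w * F (𝒢.mul (𝒢.inv w) g) := by
  have : 𝒢.conv f F g = ∑ᶠ h ∈ ({w} : Set G), f h * F (𝒢.mul (𝒢.inv h) g) := by
    refine finsum_mem_inter_support_eq' _ _ _ fun h hh => ?_
    have hhW : h ∈ W := hf fun h0 => hh (by simp [h0])
    exact ⟨fun e => hW hhW hw (e.trans hwg.symm), fun e => by rw [e]; exact hwg⟩
  rw [this, finsum_mem_singleton]

theorem conv_eq_zero {f : G → ℂ} {F : G → ℂ} {g : G} (h : ∀ k, 𝒢.rng k = 𝒢.rng g → f k = 0) :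
    𝒢.conv f F g = 0 :=
  finsum_mem_eq_zero_of_forall_eq_zero fun k hk => by rw [h k hk, zero_mul]

end Conv

section Conv

variable [T2Space G] [LocallyCompactSpace G]

theorem continuous_conv (f F : 𝒢.Cc) : Continuous (𝒢.conv f F) := by
  induction f using Cc.induction with
  | hzero => rw [conv_zero_left]; exact continuous_zero
  | hadd f g hf hg => rw [conv_add_left]; exact hf.add hg
  | hb f hf =>
    have := t2Space_unitSpace 𝒢
    obtain ⟨W, hWo, hWb, hfW⟩ := hf
    have hsW : Function.support f ⊆ W := (subset_tsupport f).trans hfW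
    rw [continuous_iff_continuousAt]
    intro g₀
    by_cases hg : ∃ w ∈ W, 𝒢.rng w = 𝒢.rng g₀
    · obtain ⟨w, hwW, hwg⟩ := hg
      obtain ⟨e, he, hr⟩ := 𝒢.isLocalHomeomorph_rng w
      have hr' : ∀ x, 𝒢.rng x = e x := fun x => by rw [hr]
      have htar : 𝒢.rng g₀ ∈ e.target := by rw [← hwg, hr']; exact e.map_source he
      have hsym : e.symm (𝒢.rng g₀) = w := by rw [← hwg, hr']; exact e.left_inv he
      have hσ : ContinuousAt (fun g => e.symm (𝒢.rng g)) g₀ :=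
        (e.continuousAt_symm htar).comp 𝒢.continuous_rng.continuousAt
      have hev1 : ∀ᶠ g in 𝓝 g₀, 𝒢.rng g ∈ e.target :=
        𝒢.continuous_rng.continuousAt.eventually (e.open_target.mem_nhds htar)
      have hev2 : ∀ᶠ g in 𝓝 g₀, e.symm (𝒢.rng g) ∈ W :=
        hσ.eventually (hWo.mem_nhds (by simpa only [hsym] using hwW))
      have hrs : ∀ g, 𝒢.rng g ∈ e.target → 𝒢.rng (e.symm (𝒢.rng g)) = 𝒢.rng g := fun g hg => by
        rw [hr' (e.symm _), e.right_inv hg]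
      have hev : 𝒢.conv f F =ᶠ[𝓝 g₀] fun g => f (e.symm (𝒢.rng g)) *
          F (𝒢.mul (𝒢.inv (e.symm (𝒢.rng g))) g) := by
        filter_upwards [hev1, hev2] with g h1 h2
        exact conv_eq_of_mem hWb.2 hsW F h2 (hrs g h1)
      refine ContinuousAt.congr ?_ hev.symm
      refine (f.continuous.continuousAt.comp hσ).mul (F.continuous.continuousAt.comp ?_)
      have hm := 𝒢.continuousOn_mul (𝒢.inv (e.symm (𝒢.rng g₀)), g₀)
        (by simp only [mem_ofPred_eq, 𝒢.src_inv]; exact hrs _ htar)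
      have ht : Tendsto (fun g => (𝒢.inv (e.symm (𝒢.rng g)), g)) (𝓝 g₀)
          (𝓝[{p : G × G | 𝒢.src p.1 = 𝒢.rng p.2}] (𝒢.inv (e.symm (𝒢.rng g₀)), g₀)) := by
        refine tendsto_nhdsWithin_iff.2 ⟨?_, ?_⟩
        · exact (𝒢.continuous_inv.continuousAt.comp hσ).prodMk_nhds tendsto_id
        · filter_upwards [hev1] with g h1
          simp only [𝒢.src_inv]; exact hrs _ h1
      exact hm.tendsto.comp ht
    · have hcl : IsClosed (𝒢.rng '' tsupport f) :=
        (f.hasCompactSupport.isCompact.image 𝒢.continuous_rng).isClosed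
      have hn : 𝒢.rng g₀ ∉ 𝒢.rng '' tsupport f := by
        rintro ⟨w, hw, hwg⟩; exact hg ⟨w, hfW hw, hwg⟩
      have hev : 𝒢.conv f F =ᶠ[𝓝 g₀] fun _ => 0 := by
        filter_upwards [𝒢.continuous_rng.continuousAt.eventually
          (hcl.isOpen_compl.mem_nhds hn)] with g hg'
        refine conv_eq_zero fun k hk => image_eq_zero_of_notMem_tsupport fun hk' => hg' ?_
        exact ⟨k, hk', hk⟩
      exact continuousAt_const.congr hev.symm

theorem hasCompactSupport_conv (f F : 𝒢.Cc) : HasCompactSupport (𝒢.conv f F) := by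
  have := t2Space_unitSpace 𝒢
  have hc : IsClosed {p : G × G | 𝒢.src p.1 = 𝒢.rng p.2} :=
    isClosed_eq (𝒢.continuous_src.comp continuous_fst) (𝒢.continuous_rng.comp continuous_snd)
  have hK := ((f.hasCompactSupport.isCompact.prod F.hasCompactSupport.isCompact).inter_right
    hc).image_of_continuousOn (𝒢.continuousOn_mul.mono inter_subset_right)
  refine HasCompactSupport.intro hK fun g hg => ?_
  refine finsum_mem_eq_zero_of_forall_eq_zero fun h hh => ?_
  have hh' : 𝒢.rng h = 𝒢.rng g := hh
  by_contra hne
  refine hg ⟨(h, 𝒢.mul (𝒢.inv h) g), ⟨⟨?_, ?_⟩, ?_⟩, 𝒢.mul_inv_cancel_left h g hh⟩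
  · exact subset_tsupport _ (left_ne_zero_of_mul hne)
  · exact subset_tsupport _ (right_ne_zero_of_mul hne)
  · simp only [mem_ofPred_eq]
    rw [𝒢.rng_mul _ _ (by rw [𝒢.src_inv, hh']), 𝒢.rng_inv]

noncomputable instance : Mul 𝒢.Cc :=
  ⟨fun f F => Cc.mk (𝒢.conv f F) (continuous_conv f F) (hasCompactSupport_conv f F)⟩

theorem Cc.coe_mul (f F : 𝒢.Cc) : ⇑(f * F) = 𝒢.conv f F := rfl

theorem Cc.mul_apply (f F : 𝒢.Cc) (g : G) : (f * F) g =
    ∑ᶠ h ∈ 𝒢.rng ⁻¹' {𝒢.rng g}, f h * F (𝒢.mul (𝒢.inv h) g) := rfl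

theorem Cc.coe_add (f F : 𝒢.Cc) : ⇑(f + F) = ⇑f + ⇑F := rfl

theorem Cc.coe_smul (c : ℂ) (F : 𝒢.Cc) : ⇑(c • F) = c • ⇑F := rfl

/-- Involution `f*(g) = conj (f(g⁻¹))`. -/
noncomputable instance : Star 𝒢.Cc :=
  ⟨fun f => Cc.mk (fun g => conj (f (𝒢.inv g)))
    (Complex.continuous_conj.comp (f.continuous.comp 𝒢.continuous_inv)) (by
      have hK := f.hasCompactSupport.isCompact.image 𝒢.continuous_inv
      refine HasCompactSupport.intro hK fun g hg => ?_
      by_contra hne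
      refine hg ⟨𝒢.inv g, subset_tsupport _ fun h0 => hne (by rw [h0, map_zero]), 𝒢.inv_inv g⟩)⟩

theorem Cc.star_apply (f : 𝒢.Cc) (g : G) : (star f) g = conj (f (𝒢.inv g)) := rfl

/-- Associativity, for convolution with an arbitrary function on the right. -/
theorem conv_assoc (f f' : 𝒢.Cc) (F : G → ℂ) :
    𝒢.conv (f * f' : 𝒢.Cc) F = 𝒢.conv f (𝒢.conv f' F) := by
  induction f using Cc.induction with
  | hzero =>
    have : (0 : 𝒢.Cc) * f' = 0 := Cc.ext fun g => by
      rw [Cc.coe_mul, conv_zero_left]; rfl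
    rw [this, conv_zero_left, conv_zero_left]
  | hadd f g hf hg =>
    have : (f + g) * f' = f * f' + g * f' := Cc.ext fun x => by
      rw [Cc.coe_mul, conv_add_left]; rfl
    rw [this, conv_add_left, conv_add_left, hf, hg]
  | hb f hf =>
    obtain ⟨W, hWo, hWb, hfW⟩ := hf
    have hsW : Function.support f ⊆ W := (subset_tsupport f).trans hfW
    ext g
    by_cases hg : ∃ w ∈ W, 𝒢.rng w = 𝒢.rng g
    · obtain ⟨w, hwW, hwg⟩ := hg
      have hsw : 𝒢.src (𝒢.inv w) = 𝒢.rng g := by rw [𝒢.src_inv, hwg]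
      rw [conv_eq_of_mem hWb.2 hsW _ hwW hwg]
      rw [conv, conv, ← smul_eq_mul (f w), smul_finsum]
      simp_rw [smul_finsum]
      rw [𝒢.rng_mul _ _ hsw, 𝒢.rng_inv]
      symm
      refine finsum_mem_eq_of_bijOn (𝒢.mul w) ⟨?_, ?_, ?_⟩ ?_
      · intro l hl
        have hl' : 𝒢.rng l = 𝒢.src w := hl
        simp only [mem_preimage, mem_singleton_iff]
        rw [𝒢.rng_mul _ _ hl'.symm, hwg]
      · intro l hl l' hl' h
        exact 𝒢.mul_left_cancel w l l' (Eq.symm hl) (Eq.symm hl') h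
      · intro k hk
        have hk' : 𝒢.rng k = 𝒢.rng g := hk
        refine ⟨𝒢.mul (𝒢.inv w) k, ?_, 𝒢.mul_inv_cancel_left w k (hwg.trans hk'.symm)⟩
        simp only [mem_preimage, mem_singleton_iff]
        rw [𝒢.rng_mul _ _ (by rw [𝒢.src_inv, hwg, hk']), 𝒢.rng_inv]
      · intro l hl
        have hl' : 𝒢.src w = 𝒢.rng l := Eq.symm hl
        rw [Cc.coe_mul, conv_eq_of_mem hWb.2 hsW _ hwW (by rw [𝒢.rng_mul _ _ hl']),
          𝒢.inv_mul_cancel_left _ _ hl', 𝒢.inv_mul_rev _ _ hl',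
          𝒢.mul_assoc _ _ _ (by rw [𝒢.src_inv, 𝒢.rng_inv, hl']) hsw, smul_eq_mul, _root_.mul_assoc]
    · push Not at hg
      have h0 : ∀ k, 𝒢.rng k = 𝒢.rng g → f k = 0 := fun k hk => by
        by_contra h; exact hg k (hsW h) hk
      rw [conv_eq_zero h0]
      refine conv_eq_zero fun k hk => ?_
      rw [Cc.coe_mul]
      exact conv_eq_zero fun k' hk' => h0 k' (hk'.trans hk)

noncomputable instance : NonUnitalRing 𝒢.Cc where
  left_distrib f F F' := Cc.ext fun g => congrFun (conv_add_right f F F') g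
  right_distrib f f' F := Cc.ext fun g => congrFun (conv_add_left f f' F) g
  zero_mul F := Cc.ext fun g => congrFun (conv_zero_left F) g
  mul_zero f := Cc.ext fun g => finsum_mem_eq_zero_of_forall_eq_zero fun k _ => mul_zero _
  mul_assoc f f' F := Cc.ext fun g => congrFun (conv_assoc f f' F) g

instance : IsScalarTower ℂ 𝒢.Cc 𝒢.Cc :=
  ⟨fun c f F => Cc.ext fun g => congrFun (conv_smul_left c f F) g⟩

instance : SMulCommClass ℂ 𝒢.Cc 𝒢.Cc :=
  ⟨fun c f F => Cc.ext fun g => (congrFun (conv_smul_right c f F) g).symm⟩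

noncomputable instance : StarRing 𝒢.Cc where
  star_involutive f := Cc.ext fun g => by simp [Cc.star_apply, 𝒢.inv_inv]
  star_add f F := Cc.ext fun g => by simp [Cc.star_apply]
  star_mul f F := Cc.ext fun g => by
    rw [Cc.star_apply, Cc.mul_apply, Cc.mul_apply]
    have hfin := finite_conv_support f F (𝒢.inv g)
    have := (starRingEnd ℂ).toAddMonoidHom.map_finsum_mem' hfin
    refine this.trans ?_
    rw [𝒢.rng_inv]
    refine finsum_mem_eq_of_bijOn (𝒢.mul g) ⟨?_, ?_, ?_⟩ ?_
    · intro l hl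
      exact 𝒢.rng_mul _ _ (Eq.symm hl)
    · intro l hl l' hl' h
      exact 𝒢.mul_left_cancel g l l' (Eq.symm hl) (Eq.symm hl') h
    · intro k hk
      have hk' : 𝒢.rng k = 𝒢.rng g := hk
      refine ⟨𝒢.mul (𝒢.inv g) k, ?_, 𝒢.mul_inv_cancel_left g k hk'.symm⟩
      simp only [mem_preimage, mem_singleton_iff]
      rw [𝒢.rng_mul _ _ (by rw [𝒢.src_inv, hk']), 𝒢.rng_inv]
    · intro l hl
      have hl' : 𝒢.src g = 𝒢.rng l := Eq.symm hl
      have hs : 𝒢.src (𝒢.inv l) = 𝒢.rng (𝒢.inv g) := by rw [𝒢.src_inv, 𝒢.rng_inv, hl']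
      rw [Cc.star_apply, Cc.star_apply, 𝒢.inv_mul_rev _ _ hl',
        𝒢.mul_assoc _ _ _ hs (by rw [𝒢.src_inv]), 𝒢.inv_mul, 𝒢.inv_mul_rev (𝒢.inv l) _
        (by rw [𝒢.src_inv, 𝒢.rng_unit, hl']), 𝒢.inv_unit, 𝒢.inv_inv, hl', 𝒢.unit_mul, _root_.mul_comm]
      exact map_mul (starRingEnd ℂ) _ _

instance : StarModule ℂ 𝒢.Cc :=
  ⟨fun c f => Cc.ext fun g => by simp [Cc.star_apply]⟩

end Conv

section Norm

variable [T2Space G] [LocallyCompactSpace G]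

/-- Square-root trick: if `f` is supported in a bisection and `‖f‖_∞ ≤ C`, then `f* * f` is of the
form `2Cq - q²` with `q = q*`. -/
theorem Cc.exists_sqrt {f : 𝒢.Cc} (hf : f.OnBisection) {C : ℝ} (hC : 0 ≤ C)
    (hfC : ∀ g, ‖f g‖ ≤ C) :
    ∃ q : 𝒢.Cc, star q = q ∧ star f * f = (2 * C : ℂ) • q - q * q := by
  obtain ⟨W, hWo, hWb, hfW⟩ := hf
  have hsW : ∀ g, f g ≠ 0 → g ∈ W := fun g hg => hfW (subset_tsupport f hg)
  set h := star f * f with hh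
  -- values of `h`
  have hstar : ∀ k, (star f) k ≠ 0 → 𝒢.inv k ∈ W := fun k hk => hsW _ fun h0 => hk (by
    rw [Cc.star_apply, h0, map_zero])
  have hinj : InjOn 𝒢.rng (𝒢.inv ⁻¹' W) := fun a ha b hb hab => by
    have := hWb.1 ha hb (by rw [𝒢.src_inv, 𝒢.src_inv, hab])
    rw [← 𝒢.inv_inv a, this, 𝒢.inv_inv]
  have hunit : ∀ g, h g ≠ 0 → g = 𝒢.unit (𝒢.rng g) := by
    intro g hg
    by_contra hne
    refine hg (finsum_mem_eq_zero_of_forall_eq_zero fun k hk => ?_)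
    have hk' : 𝒢.rng k = 𝒢.rng g := hk
    by_contra hk0
    have h1 := hstar k (left_ne_zero_of_mul hk0)
    have h2 := hsW _ (right_ne_zero_of_mul hk0)
    have e : 𝒢.src (𝒢.inv k) = 𝒢.rng g := by rw [𝒢.src_inv, hk']
    have h3 : 𝒢.mul (𝒢.inv k) g = 𝒢.inv k := hWb.2 h2 h1 (𝒢.rng_mul _ _ e)
    refine hne (𝒢.mul_left_cancel (𝒢.inv k) _ _ e (by rw [𝒢.rng_unit, e]) ?_)
    rw [h3, ← e, 𝒢.mul_unit]
  have hval : ∀ x, ∃ r : ℝ, 0 ≤ r ∧ r ≤ C ^ 2 ∧ h (𝒢.unit x) = r := by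
    intro x
    by_cases hx : ∃ w, 𝒢.inv w ∈ W ∧ 𝒢.rng w = x
    · obtain ⟨w, hwW, hwx⟩ := hx
      refine ⟨‖f (𝒢.inv w)‖ ^ 2, by positivity, pow_le_pow_left₀ (norm_nonneg _) (hfC _) 2, ?_⟩
      rw [hh, Cc.coe_mul, conv_eq_of_mem hinj (fun k hk => hstar k hk) _ hwW
        (by rw [𝒢.rng_unit, hwx]), Cc.star_apply]
      have e : 𝒢.mul (𝒢.inv w) (𝒢.unit x) = 𝒢.inv w := by
        rw [← hwx, ← 𝒢.src_inv, 𝒢.mul_unit]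
      rw [e, _root_.mul_comm, Complex.mul_conj, Complex.normSq_eq_norm_sq]
    · push Not at hx
      refine ⟨0, le_rfl, by positivity, ?_⟩
      rw [hh, Cc.coe_mul, Complex.ofReal_zero]
      refine conv_eq_zero fun k hk => ?_
      by_contra hk0
      exact hx k (hstar k hk0) (by rw [hk, 𝒢.rng_unit])
  have hval' : ∀ g, 0 ≤ (h g).re ∧ (h g).re ≤ C ^ 2 ∧ h g = ((h g).re : ℂ) := by
    intro g
    by_cases hg : h g = 0
    · rw [hg]; simp; positivity
    · obtain ⟨r, h0, h1, h2⟩ := hval (𝒢.rng g)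
      rw [← hunit g hg] at h2
      rw [h2]; simpa using ⟨h0, h1⟩
  set Q : G → ℝ := fun g => C - √(C ^ 2 - (h g).re) with hQ
  have hQ0 : ∀ g, h g = 0 → Q g = 0 := fun g hg => by
    simp only [hQ, hg, Complex.zero_re, sub_zero, Real.sqrt_sq hC, sub_self]
  have hQc : Continuous Q := continuous_const.sub
    (continuous_const.sub (Complex.continuous_re.comp h.continuous)).sqrt
  let q : 𝒢.Cc := Cc.mk (fun g => (Q g : ℂ)) (Complex.continuous_ofReal.comp hQc) (by
    refine HasCompactSupport.intro h.hasCompactSupport.isCompact fun g hg => ?_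
    rw [hQ0 g (image_eq_zero_of_notMem_tsupport hg), Complex.ofReal_zero])
  have hqu : ∀ g, q g ≠ 0 → g = 𝒢.unit (𝒢.rng g) := fun g hg => hunit g fun h0 => hg (by
    simp [q, hQ0 g h0])
  refine ⟨q, ?_, ?_⟩
  · ext g
    rw [Cc.star_apply]
    by_cases hg : g = 𝒢.unit (𝒢.rng g)
    · rw [hg, 𝒢.inv_unit]; simp [q]
    · have h1 : q g = 0 := by by_contra h0; exact hg (hqu g h0)
      have h2 : q (𝒢.inv g) = 0 := by
        by_contra h0
        refine hg ?_
        have := hqu _ h0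
        have h3 := congrArg 𝒢.inv this
        rw [𝒢.inv_inv, 𝒢.inv_unit] at h3
        have h4 := congrArg 𝒢.rng h3
        rw [𝒢.rng_unit] at h4
        rw [h4]; exact h3
      rw [h1, h2, map_zero]
  · ext g
    have hqq : (q * q) g = q g * q g := by
      have := conv_eq_of_mem (𝒢 := 𝒢) (f := q) (W := range 𝒢.unit) (F := q) (g := g)
        (w := 𝒢.unit (𝒢.rng g)) (by
          rintro _ ⟨x, rfl⟩ _ ⟨y, rfl⟩ hxy
          rw [𝒢.rng_unit, 𝒢.rng_unit] at hxy; rw [hxy])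
        (fun k hk => ⟨_, (hqu k hk).symm⟩) ⟨_, rfl⟩ (𝒢.rng_unit _)
      rw [Cc.coe_mul, this, 𝒢.inv_unit, 𝒢.unit_mul]
      by_cases hg : g = 𝒢.unit (𝒢.rng g)
      · rw [← hg]
      · have h1 : q g = 0 := by by_contra h0; exact hg (hqu g h0)
        rw [h1, mul_zero, mul_zero]
    rw [Cc.sub_apply, hqq, Cc.smul_apply, (hval' g).2.2]
    simp only [q, Cc.mk_apply]
    norm_cast
    have := Real.sq_sqrt (sub_nonneg.2 (hval' g).2.1)
    simp only [hQ]
    nlinarith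

theorem norm_rep_le {f : 𝒢.Cc} (hf : f.OnBisection) {C : ℝ} (hC : 0 ≤ C) (hfC : ∀ g, ‖f g‖ ≤ C)
    {H : Type*} [NormedAddCommGroup H] [InnerProductSpace ℂ H] [CompleteSpace H]
    (π : 𝒢.Cc →⋆ₙₐ[ℂ] (H →L[ℂ] H)) : ‖π f‖ ≤ C := by
  obtain ⟨q, hq, hfq⟩ := Cc.exists_sqrt hf hC hfC
  refine ContinuousLinearMap.opNorm_le_bound _ hC fun ξ => ?_
  have hsa : ∀ (a : 𝒢.Cc) (x y : H), ⟪π (star a) x, y⟫_ℂ = ⟪x, π a y⟫_ℂ := fun a x y => by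
    rw [map_star, ContinuousLinearMap.star_eq_adjoint, ContinuousLinearMap.adjoint_inner_left]
  have h1 : ‖π f ξ‖ ^ 2 = 2 * C * (⟪ξ, π q ξ⟫_ℂ).re - ‖π q ξ‖ ^ 2 := by
    rw [← inner_self_eq_norm_sq (𝕜 := ℂ) (π f ξ), ← inner_self_eq_norm_sq (𝕜 := ℂ) (π q ξ),
      ← hsa f, ← hsa q, hq, ← mul_apply_eq_comp, ← map_mul, hfq, map_sub, map_smul,
      map_mul]
    simp only [sub_apply, smul_apply,
      mul_apply_eq_comp, inner_sub_left, inner_smul_left, map_sub]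
    congr 1
    · rw [← inner_conj_symm (π q ξ) ξ]
      simp
    · nth_rewrite 1 [← hq]
      rw [hsa]
  have h2 : ‖(C : ℂ) • ξ - π q ξ‖ ^ 2 = C ^ 2 * ‖ξ‖ ^ 2 - 2 * C * (⟪ξ, π q ξ⟫_ℂ).re + ‖π q ξ‖ ^ 2 := by
    rw [norm_sub_sq (𝕜 := ℂ), inner_smul_left, norm_smul]
    simp [mul_pow, _root_.mul_assoc]
  have h3 : ‖π f ξ‖ ^ 2 ≤ (C * ‖ξ‖) ^ 2 := by
    rw [mul_pow]; nlinarith [sq_nonneg ‖(C : ℂ) • ξ - π q ξ‖]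
  exact le_of_sq_le_sq h3 (by positivity)

/-- The set of all numbers `‖π(f)‖`, where `π` is a `*`-representation of `C_c(G)` by bounded
operators on a Hilbert space. -/
def repNorms (f : 𝒢.Cc) : Set ℝ :=
  {r | ∃ (H : Type v) (_ : NormedAddCommGroup H) (_ : InnerProductSpace ℂ H) (_ : CompleteSpace H)
    (π : 𝒢.Cc →⋆ₙₐ[ℂ] (H →L[ℂ] H)), ‖π f‖ = r}

theorem bddAbove_repNorms (f : 𝒢.Cc) : BddAbove (repNorms f) := by
  induction f using Cc.induction with
  | hzero =>
    refine ⟨0, ?_⟩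
    rintro _ ⟨H, _, _, _, π, rfl⟩
    rw [map_zero, norm_zero]
  | hadd f g hf hg =>
    obtain ⟨a, ha⟩ := hf
    obtain ⟨b, hb⟩ := hg
    refine ⟨a + b, ?_⟩
    rintro _ ⟨H, i1, i2, i3, π, rfl⟩
    rw [map_add]
    exact (norm_add_le _ _).trans
      (add_le_add (ha ⟨H, i1, i2, i3, π, rfl⟩) (hb ⟨H, i1, i2, i3, π, rfl⟩))
  | hb f hf =>
    obtain ⟨C, hC, hfC⟩ := f.exists_bound
    refine ⟨C, ?_⟩
    rintro _ ⟨H, i1, i2, i3, π, rfl⟩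
    exact norm_rep_le hf hC hfC π

theorem repNorms_nonempty (f : 𝒢.Cc) : (repNorms f).Nonempty :=
  ⟨_, PUnit, inferInstance, inferInstance, inferInstance, 0, rfl⟩

/-- The norm `‖f‖ = sup ‖π(f)‖` on `C_c(G)`, the supremum being over all representations. -/
noncomputable instance : Norm 𝒢.Cc := ⟨fun f => sSup (repNorms f)⟩

theorem Cc.norm_def (f : 𝒢.Cc) : ‖f‖ = sSup (repNorms f) := rfl

theorem norm_rep_le_norm {H : Type v} [NormedAddCommGroup H] [InnerProductSpace ℂ H]
    [CompleteSpace H] (π : 𝒢.Cc →⋆ₙₐ[ℂ] (H →L[ℂ] H)) (f : 𝒢.Cc) : ‖π f‖ ≤ ‖f‖ :=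
  le_csSup (bddAbove_repNorms f) ⟨H, _, _, _, π, rfl⟩

theorem Cc.norm_le {f : 𝒢.Cc} {C : ℝ} (h : ∀ (H : Type v) [NormedAddCommGroup H]
    [InnerProductSpace ℂ H] [CompleteSpace H] (π : 𝒢.Cc →⋆ₙₐ[ℂ] (H →L[ℂ] H)), ‖π f‖ ≤ C) :
    ‖f‖ ≤ C := by
  refine csSup_le (repNorms_nonempty f) ?_
  rintro _ ⟨H, i1, i2, i3, π, rfl⟩
  exact h H π

theorem Cc.norm_nonneg' (f : 𝒢.Cc) : 0 ≤ ‖f‖ :=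
  (norm_nonneg _).trans (norm_rep_le_norm (0 : 𝒢.Cc →⋆ₙₐ[ℂ] (PUnit.{v + 1} →L[ℂ] PUnit.{v + 1})) f)

noncomputable instance : SeminormedAddCommGroup 𝒢.Cc :=
  AddGroupSeminorm.toSeminormedAddCommGroup
    { toFun := fun f => ‖f‖
      map_zero' := le_antisymm (Cc.norm_le fun H _ _ _ π => by rw [map_zero, norm_zero])
        (Cc.norm_nonneg' _)
      add_le' := fun f g => Cc.norm_le fun H _ _ _ π => by
        rw [map_add]
        exact (norm_add_le _ _).trans (add_le_add (norm_rep_le_norm π f) (norm_rep_le_norm π g))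
      neg' := fun f => by
        refine le_antisymm (Cc.norm_le fun H _ _ _ π => ?_) (Cc.norm_le fun H _ _ _ π => ?_)
        · rw [map_neg, norm_neg]; exact norm_rep_le_norm π f
        · rw [← norm_neg, ← map_neg]; exact norm_rep_le_norm π (-f) }

noncomputable instance : NonUnitalSeminormedRing 𝒢.Cc where
  __ : SeminormedAddCommGroup 𝒢.Cc := inferInstance
  __ : NonUnitalRing 𝒢.Cc := inferInstance
  norm_mul_le f g := Cc.norm_le fun H _ _ _ π => by
    rw [map_mul]
    exact (norm_mul_le _ _).trans (mul_le_mul (norm_rep_le_norm π f) (norm_rep_le_norm π g)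
      (norm_nonneg _) (Cc.norm_nonneg' _))

noncomputable instance : NormedSpace ℂ 𝒢.Cc where
  norm_smul_le c f := Cc.norm_le fun H _ _ _ π => by
    rw [map_smul, norm_smul]
    exact mul_le_mul_of_nonneg_left (norm_rep_le_norm π f) (norm_nonneg _)

instance : NormedStarGroup 𝒢.Cc where
  norm_star_le f := Cc.norm_le fun H _ _ _ π => by
    rw [map_star, norm_star]; exact norm_rep_le_norm π f

theorem Cc.norm_star_mul_self (f : 𝒢.Cc) : ‖f‖ * ‖f‖ ≤ ‖star f * f‖ := by
  have h : ‖f‖ ≤ √‖star f * f‖ := Cc.norm_le fun H _ _ _ π => by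
    refine Real.le_sqrt_of_sq_le ?_
    rw [sq, ← CStarRing.norm_star_mul_self, ← map_star, ← map_mul]
    exact norm_rep_le_norm π _
  calc ‖f‖ * ‖f‖ ≤ √‖star f * f‖ * √‖star f * f‖ :=
        mul_self_le_mul_self (Cc.norm_nonneg' f) h
    _ = _ := Real.mul_self_sqrt (Cc.norm_nonneg' _)

end Norm

section CStar

open UniformSpace

variable [T2Space G] [LocallyCompactSpace G]

variable (𝒢) in
/-- The full groupoid C*-algebra `C*(G)`, the completion of `C_c(G)`. -/
def CStar : Type v := Completion 𝒢.Cc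

namespace CStar

noncomputable instance : NormedAddCommGroup 𝒢.CStar :=
  inferInstanceAs (NormedAddCommGroup (Completion 𝒢.Cc))

noncomputable instance : NormedSpace ℂ 𝒢.CStar :=
  inferInstanceAs (NormedSpace ℂ (Completion 𝒢.Cc))

instance : CompleteSpace 𝒢.CStar := inferInstanceAs (CompleteSpace (Completion 𝒢.Cc))

/-- The canonical map `C_c(G) → C*(G)`. -/
noncomputable def ofCc (f : 𝒢.Cc) : 𝒢.CStar := (f : Completion 𝒢.Cc)

theorem isDenseInducing_ofCc : IsDenseInducing (ofCc : 𝒢.Cc → 𝒢.CStar) :=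
  Completion.isDenseInducing_coe

theorem continuous_ofCc : Continuous (ofCc : 𝒢.Cc → 𝒢.CStar) := Completion.continuous_coe _

theorem norm_ofCc (f : 𝒢.Cc) : ‖(ofCc f : 𝒢.CStar)‖ = ‖f‖ := Completion.norm_coe f

theorem ofCc_add (f g : 𝒢.Cc) : ofCc (f + g) = ofCc f + ofCc g := Completion.coe_add f g

theorem ofCc_zero : ofCc (0 : 𝒢.Cc) = 0 := rfl

theorem ofCc_smul (c : ℂ) (f : 𝒢.Cc) : ofCc (c • f) = c • ofCc f := Completion.coe_smul c f

@[elab_as_elim]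
theorem induction_on {p : 𝒢.CStar → Prop} (a : 𝒢.CStar) (hp : IsClosed {a | p a})
    (ih : ∀ f, p (ofCc f)) : p a := Completion.induction_on a hp ih

@[elab_as_elim]
theorem induction_on₂ {p : 𝒢.CStar → 𝒢.CStar → Prop} (a b : 𝒢.CStar)
    (hp : IsClosed {x : 𝒢.CStar × 𝒢.CStar | p x.1 x.2})
    (ih : ∀ f g, p (ofCc f) (ofCc g)) : p a b := Completion.induction_on₂ a b hp ih

@[elab_as_elim]
theorem induction_on₃ {p : 𝒢.CStar → 𝒢.CStar → 𝒢.CStar → Prop} (a b c : 𝒢.CStar)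
    (hp : IsClosed {x : 𝒢.CStar × 𝒢.CStar × 𝒢.CStar | p x.1 x.2.1 x.2.2})
    (ih : ∀ f g h, p (ofCc f) (ofCc g) (ofCc h)) : p a b c := Completion.induction_on₃ a b c hp ih

/-- The multiplication extending the convolution by continuity. -/
noncomputable instance : Mul 𝒢.CStar :=
  ⟨Function.curry <| (isDenseInducing_ofCc.prodMap isDenseInducing_ofCc).extend
    (ofCc ∘ Function.uncurry (· * ·))⟩

theorem ofCc_mul (f g : 𝒢.Cc) : ofCc (f * g) = ofCc f * ofCc g :=
  ((isDenseInducing_ofCc.prodMap isDenseInducing_ofCc).extend_eq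
    (continuous_ofCc.comp continuous_mul) (f, g)).symm

instance : ContinuousMul 𝒢.CStar where
  continuous_mul := by
    let m := (AddMonoidHom.mul : 𝒢.Cc →+ 𝒢.Cc →+ 𝒢.Cc).compr₂ Completion.toCompl
    have h : Continuous fun p : 𝒢.Cc × 𝒢.Cc => m p.1 p.2 := continuous_ofCc.comp continuous_mul
    have di : IsDenseInducing (Completion.toCompl : 𝒢.Cc → Completion 𝒢.Cc) :=
      Completion.isDenseInducing_coe
    exact (di.extend_Z_bilin di h :)

/-- The involution extending the one on `C_c(G)` by continuity. -/
noncomputable instance : Star 𝒢.CStar := ⟨Completion.map (star : 𝒢.Cc → 𝒢.Cc)⟩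

theorem ofCc_star (f : 𝒢.Cc) : ofCc (star f) = star (ofCc f) :=
  (Completion.map_coe star_isometry.uniformContinuous f).symm

instance : ContinuousStar 𝒢.CStar := ⟨Completion.continuous_map⟩

noncomputable instance : NonUnitalCStarAlgebra 𝒢.CStar where
  __ : NormedAddCommGroup 𝒢.CStar := inferInstance
  __ : NormedSpace ℂ 𝒢.CStar := inferInstance
  __ : CompleteSpace 𝒢.CStar := inferInstance
  __ : Mul 𝒢.CStar := inferInstance
  __ : Star 𝒢.CStar := inferInstance
  left_distrib a b c := by
    refine induction_on₃ a b c ?_ fun f g h => ?_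
    · exact isClosed_eq (by fun_prop) (by fun_prop)
    rw [← ofCc_add, ← ofCc_mul, ← ofCc_mul, ← ofCc_mul, ← ofCc_add, mul_add]
  right_distrib a b c := by
    refine induction_on₃ a b c ?_ fun f g h => ?_
    · exact isClosed_eq (by fun_prop) (by fun_prop)
    rw [← ofCc_add, ← ofCc_mul, ← ofCc_mul, ← ofCc_mul, ← ofCc_add, add_mul]
  zero_mul a := by
    refine induction_on a ?_ fun f => ?_
    · exact isClosed_eq (by fun_prop) (by fun_prop)
    rw [← ofCc_zero, ← ofCc_mul, zero_mul]
  mul_zero a := by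
    refine induction_on a ?_ fun f => ?_
    · exact isClosed_eq (by fun_prop) (by fun_prop)
    rw [← ofCc_zero, ← ofCc_mul, mul_zero]
  mul_assoc a b c := by
    refine induction_on₃ a b c ?_ fun f g h => ?_
    · exact isClosed_eq (by fun_prop) (by fun_prop)
    rw [← ofCc_mul, ← ofCc_mul, ← ofCc_mul, ← ofCc_mul, _root_.mul_assoc]
  norm_mul_le a b := by
    refine induction_on₂ a b ?_ fun f g => ?_
    · exact isClosed_le (by fun_prop) (by fun_prop)
    rw [← ofCc_mul, norm_ofCc, norm_ofCc, norm_ofCc]; exact _root_.norm_mul_le f g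
  star_involutive a := by
    refine induction_on a ?_ fun f => ?_
    · exact isClosed_eq (by fun_prop) (by fun_prop)
    rw [← ofCc_star, ← ofCc_star, star_star]
  star_mul a b := by
    refine induction_on₂ a b ?_ fun f g => ?_
    · exact isClosed_eq (by fun_prop) (by fun_prop)
    rw [← ofCc_mul, ← ofCc_star, ← ofCc_star, ← ofCc_star, ← ofCc_mul, star_mul]
  star_add a b := by
    refine induction_on₂ a b ?_ fun f g => ?_
    · exact isClosed_eq (by fun_prop) (by fun_prop)
    rw [← ofCc_add, ← ofCc_star, ← ofCc_star, ← ofCc_star, ← ofCc_add, star_add]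
  norm_mul_self_le a := by
    refine induction_on a ?_ fun f => ?_
    · exact isClosed_le (by fun_prop) (by fun_prop)
    rw [← ofCc_star, ← ofCc_mul, norm_ofCc, norm_ofCc]; exact Cc.norm_star_mul_self f
  smul_assoc c a b := by
    change (c • a) * b = c • (a * b)
    refine induction_on₂ a b ?_ fun f g => ?_
    · exact isClosed_eq ((continuous_fst.const_smul c).mul continuous_snd)
        ((continuous_fst.mul continuous_snd).const_smul c)
    rw [← ofCc_smul, ← ofCc_mul, ← ofCc_mul, ← ofCc_smul, smul_mul_assoc]
  smul_comm c a b := by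
    change c • (a * b) = a * (c • b)
    refine induction_on₂ a b ?_ fun f g => ?_
    · exact isClosed_eq ((continuous_fst.mul continuous_snd).const_smul c)
        (continuous_fst.mul (continuous_snd.const_smul c))
    rw [← ofCc_smul, ← ofCc_mul, ← ofCc_mul, ← ofCc_smul, mul_smul_comm]
  star_smul c a := by
    refine induction_on a ?_ fun f => ?_
    · exact isClosed_eq (continuous_star.comp (continuous_const_smul c))
        (continuous_star.const_smul (star c))
    rw [← ofCc_smul, ← ofCc_star, ← ofCc_star, ← ofCc_smul, star_smul]

section Lift

variable {H : Type v} [NormedAddCommGroup H] [InnerProductSpace ℂ H] [CompleteSpace H]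
  (π : 𝒢.Cc →⋆ₙₐ[ℂ] (H →L[ℂ] H))

theorem uniformContinuous_rep : UniformContinuous π :=
  AddMonoidHomClass.uniformContinuous_of_bound π 1 fun f => by
    rw [one_mul]; exact norm_rep_le_norm π f

/-- The extension by continuity to `C*(G)` of a representation of `C_c(G)`. -/
noncomputable def liftFun : 𝒢.CStar → (H →L[ℂ] H) := Completion.extension π

theorem continuous_liftFun : Continuous (liftFun π) := Completion.continuous_extension

theorem liftFun_ofCc (f : 𝒢.Cc) : liftFun π (ofCc f) = π f :=
  Completion.extension_coe (uniformContinuous_rep π) f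

/-- The representation of `C*(G)` extending a representation of `C_c(G)`. -/
noncomputable def lift : 𝒢.CStar →⋆ₙₐ[ℂ] (H →L[ℂ] H) where
  toFun := liftFun π
  map_zero' := by rw [← ofCc_zero, liftFun_ofCc, map_zero]
  map_add' a b := by
    have := continuous_liftFun π
    refine induction_on₂ a b ?_ fun f g => ?_
    · exact isClosed_eq (by fun_prop) (by fun_prop)
    rw [← ofCc_add, liftFun_ofCc, liftFun_ofCc, liftFun_ofCc, map_add]
  map_mul' a b := by
    have := continuous_liftFun π
    refine induction_on₂ a b ?_ fun f g => ?_
    · exact isClosed_eq (by fun_prop) (by fun_prop)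
    rw [← ofCc_mul, liftFun_ofCc, liftFun_ofCc, liftFun_ofCc, map_mul]
  map_smul' c a := by
    have h := continuous_liftFun π
    change liftFun π (c • a) = c • liftFun π a
    refine induction_on a ?_ fun f => ?_
    · exact isClosed_eq (h.comp (continuous_const_smul c)) (h.const_smul c)
    rw [← ofCc_smul, liftFun_ofCc, liftFun_ofCc, map_smul]
  map_star' a := by
    have := continuous_liftFun π
    refine induction_on a ?_ fun f => ?_
    · exact isClosed_eq (by fun_prop) (by fun_prop)
    rw [← ofCc_star, liftFun_ofCc, liftFun_ofCc, map_star]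

theorem lift_ofCc (f : 𝒢.Cc) : lift π (ofCc f) = π f := liftFun_ofCc π f

end Lift

end CStar

end CStar

variable (𝒢) in
/-- The set `Char(G)` of pairs `(x, χ)`, where `x` is a unit and `χ` is a character of the isotropy
group at `x`. -/
structure Char where
  pt : X
  chi : 𝒢.Isotropy pt →* Circle

section IndSpace

variable (p : 𝒢.Char)

/-- The element `g⁻¹ g'` of the isotropy group, for `g, g' ∈ G_x` with the same range. -/
def ratio {x : X} {g g' : G} (hg : 𝒢.src g = x) (hg' : 𝒢.src g' = x)
    (h : 𝒢.rng g = 𝒢.rng g') : 𝒢.Isotropy x :=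
  ⟨𝒢.mul (𝒢.inv g) g', by
    have e : 𝒢.src (𝒢.inv g) = 𝒢.rng g' := by rw [𝒢.src_inv, h]
    rw [𝒢.src_mul _ _ e, 𝒢.rng_mul _ _ e, 𝒢.rng_inv]; exact ⟨hg', hg⟩⟩

theorem mul_ratio {x : X} {g g' : G} (hg : 𝒢.src g = x) (hg' : 𝒢.src g' = x)
    (h : 𝒢.rng g = 𝒢.rng g') : 𝒢.mul g (ratio hg hg' h).1 = g' := 𝒢.mul_inv_cancel_left g g' h

theorem exists_isotropy {x : X} {g g' : G} (hg : 𝒢.src g = x) (hg' : 𝒢.src g' = x)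
    (h : 𝒢.rng g = 𝒢.rng g') : ∃ k : 𝒢.Isotropy x, g' = 𝒢.mul g k.1 :=
  ⟨ratio hg hg' h, (mul_ratio hg hg' h).symm⟩

variable (𝒢) in
/-- The relation on `G_x` of being in the same right orbit of the isotropy group at `x`. -/
def cosetSetoid (x : X) : Setoid {g : G // 𝒢.src g = x} where
  r g g' := ∃ h : 𝒢.Isotropy x, g'.1 = 𝒢.mul g.1 h.1
  iseqv := by
    have key : ∀ g g' : {g : G // 𝒢.src g = x},
        (∃ h : 𝒢.Isotropy x, g'.1 = 𝒢.mul g.1 h.1) ↔ 𝒢.rng g.1 = 𝒢.rng g'.1 := fun g g' =>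
      ⟨fun ⟨h, hh⟩ => by rw [hh, 𝒢.rng_mul _ _ (by rw [g.2, h.2.2])],
        fun h => exists_isotropy g.2 g'.2 h⟩
    exact ⟨fun g => (key _ _).2 rfl, fun h => (key _ _).2 ((key _ _).1 h).symm,
      fun h h' => (key _ _).2 (((key _ _).1 h).trans ((key _ _).1 h'))⟩

variable (𝒢) in
/-- The coset space `G_x / G_x^x`. -/
def Cosets (x : X) : Type v := Quotient (𝒢.cosetSetoid x)

variable {x : X}

/-- A representative in `G_x` of a coset. -/
noncomputable def Cosets.rep (q : 𝒢.Cosets x) : G := (Quotient.out q).1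

theorem Cosets.src_rep (q : 𝒢.Cosets x) : 𝒢.src q.rep = x := (Quotient.out q).2

theorem Cosets.mul_rep_one (q : 𝒢.Cosets x) : 𝒢.mul q.rep (1 : 𝒢.Isotropy x).1 = q.rep := by
  have := 𝒢.mul_unit q.rep
  rw [q.src_rep] at this
  exact this

/-- The coset of an element of `G_x`. -/
def Cosets.mk (g : G) (hg : 𝒢.src g = x) : 𝒢.Cosets x :=
  Quotient.mk (𝒢.cosetSetoid x) ⟨g, hg⟩

theorem Cosets.rng_rep_mk (g : G) (hg : 𝒢.src g = x) :
    𝒢.rng (Cosets.mk (𝒢 := 𝒢) g hg).rep = 𝒢.rng g := by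
  obtain ⟨h, hh⟩ : ∃ h : 𝒢.Isotropy x, g = 𝒢.mul (Cosets.mk g hg).rep h.1 :=
    Quotient.exact (Quotient.out_eq (Cosets.mk (𝒢 := 𝒢) g hg))
  conv_rhs => rw [hh]
  rw [𝒢.rng_mul _ _ (by rw [Cosets.src_rep, h.2.2])]

theorem Cosets.ext_rng {q q' : 𝒢.Cosets x} (h : 𝒢.rng q.rep = 𝒢.rng q'.rep) : q = q' := by
  rw [← Quotient.out_eq q, ← Quotient.out_eq q']
  exact Quotient.sound (exists_isotropy q.src_rep q'.src_rep h)

/-- The space of the representation induced by a character `χ` of the isotropy group at `x`: the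
functions `ξ` on `G_x` (extended by `0` to all of `G`) such that `ξ(gh) = conj (χ(h)) ξ(g)` for all
`h` in the isotropy group, and `∑ |ξ(g)|² < ∞`, the sum being over the cosets of that group. -/
def indSubmodule (p : 𝒢.Char) : Submodule ℂ (G → ℂ) where
  carrier := {ξ | (∀ g, 𝒢.src g ≠ p.pt → ξ g = 0) ∧
    (∀ (g : G) (h : 𝒢.Isotropy p.pt), 𝒢.src g = p.pt →
      ξ (𝒢.mul g h.1) = conj (p.chi h : ℂ) * ξ g) ∧
    Summable fun q : 𝒢.Cosets p.pt => ‖ξ q.rep‖ ^ 2}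
  add_mem' := by
    rintro ξ η ⟨h1, h2, h3⟩ ⟨k1, k2, k3⟩
    refine ⟨fun g hg => by simp [h1 g hg, k1 g hg], fun g h hg => ?_, ?_⟩
    · simp only [Pi.add_apply, h2 g h hg, k2 g h hg, mul_add]
    · refine Summable.of_nonneg_of_le (fun _ => by positivity) (fun q => ?_)
        ((h3.add k3).mul_left 2)
      have := norm_add_le (ξ q.rep) (η q.rep)
      simp only [Pi.add_apply]
      nlinarith [norm_nonneg (ξ q.rep + η q.rep), sq_nonneg (‖ξ q.rep‖ - ‖η q.rep‖),
        norm_nonneg (ξ q.rep), norm_nonneg (η q.rep)]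
  zero_mem' := ⟨fun _ _ => rfl, fun _ _ _ => by simp, by simp⟩
  smul_mem' := by
    rintro c ξ ⟨h1, h2, h3⟩
    refine ⟨fun g hg => by simp [h1 g hg], fun g h hg => ?_, ?_⟩
    · simp only [Pi.smul_apply, h2 g h hg, smul_eq_mul]; ring
    · simpa [mul_pow] using h3.mul_left (‖c‖ ^ 2)

variable (𝒢) in
/-- The space of the representation induced by `χ`, a Hilbert space with the inner product
`∑ conj (ξ(g)) η(g)`, the sum being over the cosets of the isotropy group at `x` in `G_x`. -/
def IndSpace (p : 𝒢.Char) : Type v := indSubmodule p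

variable {p : 𝒢.Char}

namespace IndSpace

instance : AddCommGroup (𝒢.IndSpace p) := inferInstanceAs (AddCommGroup (indSubmodule p))

instance : Module ℂ (𝒢.IndSpace p) := inferInstanceAs (Module ℂ (indSubmodule p))

instance : FunLike (𝒢.IndSpace p) G ℂ :=
  ⟨fun ξ => (show indSubmodule p from ξ).1, fun _ _ h => Subtype.ext h⟩

/-- Build an element of the space of the induced representation. -/
def mk (ξ : G → ℂ) (h : ξ ∈ indSubmodule p) : 𝒢.IndSpace p := (⟨ξ, h⟩ : indSubmodule p)

@[simp] theorem mk_apply (ξ : G → ℂ) (h : ξ ∈ indSubmodule p) (g : G) : mk ξ h g = ξ g := rfl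

theorem mem (ξ : 𝒢.IndSpace p) : ⇑ξ ∈ indSubmodule p := (show indSubmodule p from ξ).2

theorem ext {ξ η : 𝒢.IndSpace p} (h : ∀ g, ξ g = η g) : ξ = η := DFunLike.ext ξ η h

theorem add_apply (ξ η : 𝒢.IndSpace p) (g : G) : (ξ + η) g = ξ g + η g := rfl
theorem smul_apply (c : ℂ) (ξ : 𝒢.IndSpace p) (g : G) : (c • ξ) g = c * ξ g := rfl
theorem zero_apply (g : G) : (0 : 𝒢.IndSpace p) g = 0 := rfl

theorem eq_zero (ξ : 𝒢.IndSpace p) {g : G} (hg : 𝒢.src g ≠ p.pt) : ξ g = 0 := ξ.mem.1 g hg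

theorem equivariant (ξ : 𝒢.IndSpace p) {g : G} (hg : 𝒢.src g = p.pt) (h : 𝒢.Isotropy p.pt) :
    ξ (𝒢.mul g h.1) = conj (p.chi h : ℂ) * ξ g := ξ.mem.2.1 g h hg

theorem inner_eq (ξ η : 𝒢.IndSpace p) {g g' : G} (hg : 𝒢.src g = p.pt) (hg' : 𝒢.src g' = p.pt)
    (h : 𝒢.rng g = 𝒢.rng g') : ⟪ξ g, η g⟫_ℂ = ⟪ξ g', η g'⟫_ℂ := by
  obtain ⟨k, rfl⟩ := exists_isotropy hg hg' h
  rw [ξ.equivariant hg, η.equivariant hg]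
  have hk : (p.chi k : ℂ) * conj (p.chi k : ℂ) = 1 := by
    rw [Complex.mul_conj, Complex.normSq_eq_norm_sq, Circle.norm_coe]; simp
  simp only [RCLike.inner_apply, map_mul, Complex.conj_conj]
  linear_combination (-(conj (ξ g)) * η g) * hk

theorem norm_eq (ξ : 𝒢.IndSpace p) {g g' : G} (hg : 𝒢.src g = p.pt) (hg' : 𝒢.src g' = p.pt)
    (h : 𝒢.rng g = 𝒢.rng g') : ‖ξ g‖ = ‖ξ g'‖ := by
  obtain ⟨k, rfl⟩ := exists_isotropy hg hg' h
  rw [ξ.equivariant hg, norm_mul, RCLike.norm_conj, Circle.norm_coe, one_mul]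

theorem summable (ξ : 𝒢.IndSpace p) : Summable fun q : 𝒢.Cosets p.pt => ‖ξ q.rep‖ ^ 2 := ξ.mem.2.2

/-- Restriction to representatives of cosets. -/
noncomputable def toLp : 𝒢.IndSpace p →ₗ[ℂ] lp (fun _ : 𝒢.Cosets p.pt => ℂ) 2 where
  toFun ξ := ⟨fun q => ξ q.rep, memℓp_gen (by simpa using ξ.summable)⟩
  map_add' _ _ := rfl
  map_smul' _ _ := rfl

theorem toLp_apply (ξ : 𝒢.IndSpace p) (q : 𝒢.Cosets p.pt) : toLp ξ q = ξ q.rep := rfl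

theorem toLp_injective : Function.Injective (toLp : 𝒢.IndSpace p →ₗ[ℂ] _) := by
  rw [← LinearMap.ker_eq_bot, LinearMap.ker_eq_bot']
  intro ξ hξ
  refine ext fun g => ?_
  rw [zero_apply]
  by_cases hg : 𝒢.src g = p.pt
  · rw [← norm_eq_zero, ξ.norm_eq hg (Cosets.src_rep (Cosets.mk g hg)) (Cosets.rng_rep_mk g hg).symm,
      ← toLp_apply, hξ]; simp
  · exact ξ.eq_zero hg

open Classical in
theorem toLp_surjective : Function.Surjective (toLp : 𝒢.IndSpace p →ₗ[ℂ] _) := by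
  intro a
  let F : G → ℂ := fun g => if hg : 𝒢.src g = p.pt then
      conj (p.chi (ratio (Cosets.src_rep _) hg (Cosets.rng_rep_mk g hg)) : ℂ) *
        a (Cosets.mk g hg) else 0
  have hval : ∀ (g : G) (hg : 𝒢.src g = p.pt) (k : 𝒢.Isotropy p.pt) (q : 𝒢.Cosets p.pt),
      𝒢.mul q.rep k.1 = g → F g = conj (p.chi k : ℂ) * a q := by
    intro g hg k q hk
    have e : 𝒢.src q.rep = 𝒢.rng k.1 := by rw [q.src_rep, k.2.2]
    obtain rfl : Cosets.mk g hg = q := Cosets.ext_rng (by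
      rw [Cosets.rng_rep_mk, ← hk, 𝒢.rng_mul _ _ e])
    have hr : ratio (Cosets.src_rep _) hg (Cosets.rng_rep_mk g hg) = k := by
      refine Subtype.ext ?_
      have h1 := 𝒢.inv_mul_cancel_left _ _ e
      rw [hk] at h1
      exact h1
    exact (dif_pos hg).trans (congrArg (fun k => conj (p.chi k : ℂ) * a (Cosets.mk g hg)) hr)
  have hF : ∀ q : 𝒢.Cosets p.pt, F q.rep = a q := by
    intro q
    rw [hval q.rep q.src_rep 1 q q.mul_rep_one, map_one]
    simp
  refine ⟨mk F ⟨fun g hg => dif_neg hg, fun g h hg => ?_, ?_⟩, ?_⟩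
  · have e : 𝒢.src g = 𝒢.rng h.1 := by rw [hg, h.2.2]
    have hg' : 𝒢.src (𝒢.mul g h.1) = p.pt := by rw [𝒢.src_mul _ _ e, h.2.1]
    obtain ⟨k, hk⟩ := exists_isotropy (Cosets.src_rep (Cosets.mk g hg)) hg (Cosets.rng_rep_mk g hg)
    have e' : 𝒢.src (Cosets.mk g hg).rep = 𝒢.rng k.1 := by rw [Cosets.src_rep, k.2.2]
    rw [hval g hg k (Cosets.mk g hg) hk.symm, hval _ hg' (k * h) (Cosets.mk g hg) (by
      rw [isotropy_mul_val, ← 𝒢.mul_assoc _ _ _ e' (by rw [k.2.1, h.2.2]), ← hk]), map_mul,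
      Circle.coe_mul, map_mul]
    ring
  · have := (memℓp_gen_iff (p := 2) (by simp)).1 a.2
    simpa [hF] using this
  · ext q
    exact hF q

noncomputable instance : NormedAddCommGroup (𝒢.IndSpace p) :=
  NormedAddCommGroup.induced _ _ toLp toLp_injective

theorem norm_toLp (ξ : 𝒢.IndSpace p) : ‖toLp ξ‖ = ‖ξ‖ := rfl

noncomputable instance : InnerProductSpace ℂ (𝒢.IndSpace p) where
  norm_smul_le c ξ := by
    rw [← norm_toLp, ← norm_toLp, map_smul, norm_smul]
  inner ξ η := ∑' q : 𝒢.Cosets p.pt, ⟪ξ q.rep, η q.rep⟫_ℂ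
  norm_sq_eq_re_inner ξ := InnerProductSpace.norm_sq_eq_re_inner (𝕜 := ℂ) (toLp ξ)
  conj_inner_symm ξ η := InnerProductSpace.conj_inner_symm (𝕜 := ℂ) (toLp ξ) (toLp η)
  add_left ξ η ζ := InnerProductSpace.add_left (𝕜 := ℂ) (toLp ξ) (toLp η) (toLp ζ)
  smul_left ξ η c := InnerProductSpace.smul_left (𝕜 := ℂ) (toLp ξ) (toLp η) c

theorem inner_def (ξ η : 𝒢.IndSpace p) :
    ⟪ξ, η⟫_ℂ = ∑' q : 𝒢.Cosets p.pt, ⟪ξ q.rep, η q.rep⟫_ℂ := rfl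

theorem norm_sq_def (ξ : 𝒢.IndSpace p) : ‖ξ‖ ^ 2 = ∑' q : 𝒢.Cosets p.pt, ‖ξ q.rep‖ ^ 2 := by
  have := lp.norm_rpow_eq_tsum (p := 2) (by simp) (toLp ξ)
  simpa [toLp_apply, norm_toLp] using this

/-- `toLp` as an isometric isomorphism. -/
noncomputable def toLpIso : 𝒢.IndSpace p ≃ₗᵢ[ℂ] lp (fun _ : 𝒢.Cosets p.pt => ℂ) 2 where
  __ := LinearEquiv.ofBijective toLp ⟨toLp_injective, toLp_surjective⟩
  norm_map' _ := rfl

instance : CompleteSpace (𝒢.IndSpace p) :=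
  (completeSpace_congr (e := (toLpIso (p := p)).toEquiv) (toLpIso (p := p)).isometry.isUniformEmbedding).2
    inferInstance

end IndSpace
end IndSpace

section IndRep

variable [T2Space G] [LocallyCompactSpace G] {p : 𝒢.Char}

/-- For `f` supported in a bisection, `f * ξ` is square summable with the obvious bound. -/
theorem conv_mem_of_onBisection {f : 𝒢.Cc} (hf : f.OnBisection) {C : ℝ} (hC : 0 ≤ C)
    (hfC : ∀ g, ‖f g‖ ≤ C) (ξ : 𝒢.IndSpace p) :
    Summable (fun q : 𝒢.Cosets p.pt => ‖𝒢.conv f ξ q.rep‖ ^ 2) ∧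
      ∑' q : 𝒢.Cosets p.pt, ‖𝒢.conv f ξ q.rep‖ ^ 2 ≤ (C * ‖ξ‖) ^ 2 := by
  obtain ⟨W, hWo, hWb, hfW⟩ := hf
  have hsW : Function.support f ⊆ W := (subset_tsupport f).trans hfW
  let D : Set (𝒢.Cosets p.pt) := {q | ∃ w ∈ W, 𝒢.rng w = 𝒢.rng q.rep}
  choose w hwW hwr using fun d : D => d.2
  have hsrc : ∀ d : D, 𝒢.src (𝒢.mul (𝒢.inv (w d)) d.1.rep) = p.pt := fun d => by
    rw [𝒢.src_mul _ _ (by rw [𝒢.src_inv, hwr]), Cosets.src_rep]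
  have hrng : ∀ d : D, 𝒢.rng (𝒢.mul (𝒢.inv (w d)) d.1.rep) = 𝒢.src (w d) := fun d => by
    rw [𝒢.rng_mul _ _ (by rw [𝒢.src_inv, hwr]), 𝒢.rng_inv]
  let τ : D → 𝒢.Cosets p.pt := fun d => Cosets.mk _ (hsrc d)
  have hτ : Function.Injective τ := fun d d' h => by
    have h1 := congrArg (fun q => 𝒢.rng (Cosets.rep q)) h
    simp only [τ, Cosets.rng_rep_mk, hrng] at h1
    refine Subtype.ext (Cosets.ext_rng ?_)
    rw [← hwr, ← hwr, hWb.1 (hwW d) (hwW d') h1]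
  have hle : ∀ d : D, ‖𝒢.conv f ξ d.1.rep‖ ^ 2 ≤ C ^ 2 * ‖ξ (τ d).rep‖ ^ 2 := fun d => by
    rw [conv_eq_of_mem hWb.2 hsW _ (hwW d) (hwr d), norm_mul, mul_pow,
      ξ.norm_eq (hsrc d) (Cosets.src_rep (τ d)) (Cosets.rng_rep_mk _ (hsrc d)).symm]
    gcongr
    exact hfC _
  have h0 : ∀ q ∉ D, ‖𝒢.conv f ξ q.rep‖ ^ 2 = 0 := fun q hq => by
    rw [conv_eq_zero fun k hk => ?_]; · simp
    by_contra h
    exact hq ⟨k, hsW h, hk⟩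
  have hsum : Summable fun d : D => ‖𝒢.conv f ξ d.1.rep‖ ^ 2 :=
    Summable.of_nonneg_of_le (fun _ => by positivity) hle
      ((ξ.summable.comp_injective hτ).mul_left (C ^ 2))
  have h0' : ∀ q ∉ range (Subtype.val : D → _), ‖𝒢.conv f ξ q.rep‖ ^ 2 = 0 := fun q hq =>
    h0 q (by simpa using hq)
  refine ⟨(Subtype.val_injective.summable_iff h0').1 hsum, ?_⟩
  have h1 : ∑' q : 𝒢.Cosets p.pt, ‖𝒢.conv f ξ q.rep‖ ^ 2 =
      ∑' d : D, ‖𝒢.conv f ξ d.1.rep‖ ^ 2 :=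
    (Subtype.val_injective.tsum_eq (f := fun q : 𝒢.Cosets p.pt => ‖𝒢.conv f ξ q.rep‖ ^ 2)
      fun q hq => by_contra fun h => hq (h0' q h)).symm
  rw [h1, mul_pow, IndSpace.norm_sq_def, ← tsum_mul_left]
  refine (hsum.tsum_le_tsum hle ((ξ.summable.comp_injective hτ).mul_left (C ^ 2))).trans ?_
  exact tsum_comp_le_tsum_of_inj (ξ.summable.mul_left (C ^ 2)) (fun _ => by positivity) hτ

theorem conv_mem (f : 𝒢.Cc) (ξ : 𝒢.IndSpace p) : 𝒢.conv f ξ ∈ indSubmodule p := by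
  induction f using Cc.induction with
  | hzero => rw [conv_zero_left]; exact Submodule.zero_mem _
  | hadd f g hf hg => rw [conv_add_left]; exact Submodule.add_mem _ hf hg
  | hb f hf =>
    obtain ⟨C, hC, hfC⟩ := f.exists_bound
    refine ⟨fun g hg => ?_, fun g h hg => ?_, (conv_mem_of_onBisection hf hC hfC ξ).1⟩
    · refine finsum_mem_eq_zero_of_forall_eq_zero fun k hk => ?_
      have hk' : 𝒢.rng k = 𝒢.rng g := hk
      rw [ξ.eq_zero, mul_zero]
      rwa [𝒢.src_mul _ _ (by rw [𝒢.src_inv, hk'])]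
    · have e : 𝒢.src g = 𝒢.rng h.1 := by rw [hg, h.2.2]
      rw [conv, conv, 𝒢.rng_mul _ _ e, ← smul_eq_mul, smul_finsum]
      simp_rw [smul_finsum]
      refine finsum_mem_congr rfl fun k hk => ?_
      have hk' : 𝒢.src (𝒢.inv k) = 𝒢.rng g := by rw [𝒢.src_inv]; exact hk
      rw [← 𝒢.mul_assoc _ _ _ hk' e, ξ.equivariant (by rw [𝒢.src_mul _ _ hk', hg]), smul_eq_mul]
      ring

/-- The induced action of `C_c(G)`:  `(π(f)ξ)(g) = ∑ f(h) ξ(h⁻¹ g)`, the sum being over all `h`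
with `r(h) = r(g)`. -/
noncomputable def indLin (p : 𝒢.Char) (f : 𝒢.Cc) : 𝒢.IndSpace p →ₗ[ℂ] 𝒢.IndSpace p where
  toFun ξ := IndSpace.mk (𝒢.conv f ξ) (conv_mem f ξ)
  map_add' ξ η := IndSpace.ext fun g => congrFun (conv_add_right f ξ η) g
  map_smul' c ξ := IndSpace.ext fun g => congrFun (conv_smul_right c f ξ) g

theorem indLin_apply (f : 𝒢.Cc) (ξ : 𝒢.IndSpace p) (g : G) :
    indLin p f ξ g = 𝒢.conv f ξ g := rfl

theorem exists_bound_indLin (f : 𝒢.Cc) : ∃ C : ℝ, ∀ ξ, ‖indLin p f ξ‖ ≤ C * ‖ξ‖ := by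
  induction f using Cc.induction with
  | hzero =>
    refine ⟨0, fun ξ => ?_⟩
    have : indLin p 0 ξ = 0 := IndSpace.ext fun g => congrFun (conv_zero_left _) g
    rw [this]; simp
  | hadd f g hf hg =>
    obtain ⟨a, ha⟩ := hf
    obtain ⟨b, hb⟩ := hg
    refine ⟨a + b, fun ξ => ?_⟩
    have : indLin p (f + g) ξ = indLin p f ξ + indLin p g ξ :=
      IndSpace.ext fun x => congrFun (conv_add_left f g _) x
    rw [this, add_mul]
    exact (norm_add_le _ _).trans (add_le_add (ha ξ) (hb ξ))
  | hb f hf =>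
    obtain ⟨C, hC, hfC⟩ := f.exists_bound
    refine ⟨C, fun ξ => le_of_sq_le_sq ?_ (by positivity)⟩
    rw [IndSpace.norm_sq_def]
    exact (conv_mem_of_onBisection hf hC hfC ξ).2

theorem inner_indLin (f : 𝒢.Cc) (ξ η : 𝒢.IndSpace p) :
    ⟪indLin p f ξ, η⟫_ℂ = ⟪ξ, indLin p (star f) η⟫_ℂ := by
  induction f using Cc.induction with
  | hzero =>
    have : ∀ ξ, indLin p 0 ξ = 0 := fun ξ => IndSpace.ext fun g => congrFun (conv_zero_left _) g
    rw [star_zero, this, this, inner_zero_left, inner_zero_right]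
  | hadd f g hf hg =>
    have : ∀ (f g : 𝒢.Cc) ξ, indLin p (f + g) ξ = indLin p f ξ + indLin p g ξ := fun f g ξ =>
      IndSpace.ext fun x => congrFun (conv_add_left f g _) x
    rw [star_add, this, this, inner_add_left, inner_add_right, hf, hg]
  | hb f hf =>
    obtain ⟨W, hWo, hWb, hfW⟩ := hf
    have hsW : Function.support f ⊆ W := (subset_tsupport f).trans hfW
    let D : Set (𝒢.Cosets p.pt) := {q | ∃ w ∈ W, 𝒢.rng w = 𝒢.rng q.rep}
    choose w hwW hwr using fun d : D => d.2
    have hcomp : ∀ d : D, 𝒢.src (𝒢.inv (w d)) = 𝒢.rng d.1.rep := fun d => by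
      rw [𝒢.src_inv, hwr]
    have hsrc : ∀ d : D, 𝒢.src (𝒢.mul (𝒢.inv (w d)) d.1.rep) = p.pt := fun d => by
      rw [𝒢.src_mul _ _ (hcomp d), Cosets.src_rep]
    have hrng : ∀ d : D, 𝒢.rng (𝒢.mul (𝒢.inv (w d)) d.1.rep) = 𝒢.src (w d) := fun d => by
      rw [𝒢.rng_mul _ _ (hcomp d), 𝒢.rng_inv]
    let τ : D → 𝒢.Cosets p.pt := fun d => Cosets.mk _ (hsrc d)
    have hτ : Function.Injective τ := fun d d' h => by
      have h1 := congrArg (fun q => 𝒢.rng (Cosets.rep q)) h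
      simp only [τ, Cosets.rng_rep_mk, hrng] at h1
      refine Subtype.ext (Cosets.ext_rng ?_)
      rw [← hwr, ← hwr, hWb.1 (hwW d) (hwW d') h1]
    have hstar : ∀ k, (star f) k ≠ 0 → 𝒢.inv k ∈ W := fun k hk => hsW fun h0 => hk (by
      rw [Cc.star_apply, h0, map_zero])
    have hinj : InjOn 𝒢.rng (𝒢.inv ⁻¹' W) := fun a ha b hb hab => by
      have := hWb.1 ha hb (by rw [𝒢.src_inv, 𝒢.src_inv, hab])
      rw [← 𝒢.inv_inv a, this, 𝒢.inv_inv]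
    rw [IndSpace.inner_def, IndSpace.inner_def]
    rw [← Subtype.val_injective.tsum_eq (g := (Subtype.val : D → _))
        (f := fun q : 𝒢.Cosets p.pt => ⟪indLin p f ξ q.rep, η q.rep⟫_ℂ) ?_,
      ← hτ.tsum_eq (f := fun q : 𝒢.Cosets p.pt => ⟪ξ q.rep, indLin p (star f) η q.rep⟫_ℂ) ?_]
    · refine tsum_congr fun d => ?_
      rw [IndSpace.inner_eq ξ _ (Cosets.src_rep (τ d)) (hsrc d) (Cosets.rng_rep_mk _ (hsrc d)),
        indLin_apply, indLin_apply, conv_eq_of_mem hWb.2 hsW _ (hwW d) (hwr d),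
        conv_eq_of_mem hinj (fun k hk => hstar k hk) _ (w := 𝒢.inv (w d))
          (by rw [mem_preimage, 𝒢.inv_inv]; exact hwW d) (by rw [𝒢.rng_inv, hrng]),
        𝒢.inv_inv, 𝒢.mul_inv_cancel_left _ _ (hwr d), Cc.star_apply, 𝒢.inv_inv]
      simp only [RCLike.inner_apply, map_mul]
      ring
    · intro q hq
      by_contra h
      refine hq ?_
      simp only
      rw [indLin_apply, conv_eq_zero fun k hk => ?_, inner_zero_right]
      by_contra hk0
      have hsrck : 𝒢.src (𝒢.inv k) = 𝒢.rng q.rep := by rw [𝒢.src_inv, hk]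
      have hs : 𝒢.src (𝒢.mul (𝒢.inv k) q.rep) = p.pt := by
        rw [𝒢.src_mul _ _ hsrck, Cosets.src_rep]
      have hd : 𝒢.rng (𝒢.inv k) = 𝒢.rng (Cosets.mk (𝒢 := 𝒢) _ hs).rep := by
        rw [Cosets.rng_rep_mk, 𝒢.rng_mul _ _ hsrck]
      let d : D := ⟨Cosets.mk _ hs, 𝒢.inv k, hstar k hk0, hd⟩
      have hwd : w d = 𝒢.inv k := hWb.2 (hwW d) (hstar k hk0) ((hwr d).trans hd.symm)
      refine h ⟨d, Cosets.ext_rng ?_⟩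
      simp only [τ]
      rw [Cosets.rng_rep_mk, hrng, hwd, hsrck]
    · intro q hq
      by_contra h
      refine hq ?_
      simp only
      rw [indLin_apply, conv_eq_zero fun k hk => ?_, inner_zero_left]
      by_contra hk0
      exact h ⟨⟨q, k, hsW hk0, hk⟩, rfl⟩

/-- The representation of `C_c(G)` induced by the character `χ` of the isotropy group at `x`. -/
noncomputable def indCc (p : 𝒢.Char) : 𝒢.Cc →⋆ₙₐ[ℂ] (𝒢.IndSpace p →L[ℂ] 𝒢.IndSpace p) where
  toFun f := LinearMap.mkContinuousOfExistsBound (indLin p f) (exists_bound_indLin f)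
  map_zero' := ContinuousLinearMap.ext fun ξ => IndSpace.ext fun g =>
    congrFun (conv_zero_left _) g
  map_add' f f' := ContinuousLinearMap.ext fun ξ => IndSpace.ext fun g =>
    congrFun (conv_add_left f f' _) g
  map_smul' c f := ContinuousLinearMap.ext fun ξ => IndSpace.ext fun g =>
    congrFun (conv_smul_left c f _) g
  map_mul' f f' := ContinuousLinearMap.ext fun ξ => IndSpace.ext fun g =>
    congrFun (conv_assoc f f' _) g
  map_star' f := by
    rw [ContinuousLinearMap.star_eq_adjoint, ContinuousLinearMap.eq_adjoint_iff]
    intro ξ η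
    have := inner_indLin (star f) ξ η
    rw [star_star] at this
    exact this

theorem indCc_apply (f : 𝒢.Cc) (ξ : 𝒢.IndSpace p) (g : G) :
    indCc p f ξ g = ∑ᶠ h ∈ 𝒢.rng ⁻¹' {𝒢.rng g}, f h * ξ (𝒢.mul (𝒢.inv h) g) := rfl

/-- The induced representation `π` of `C*(G)` attached to `(x, χ)`. -/
noncomputable def indRep (p : 𝒢.Char) : 𝒢.CStar →⋆ₙₐ[ℂ] (𝒢.IndSpace p →L[ℂ] 𝒢.IndSpace p) :=
  CStar.lift (indCc p)

theorem indRep_ofCc (f : 𝒢.Cc) : indRep p (CStar.ofCc f) = indCc p f := CStar.lift_ofCc _ f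

end IndRep

end EtaleGroupoid

section PrimitiveIdeals

variable {A : Type v} [NonUnitalCStarAlgebra A]

/-- A nonzero representation on a Hilbert space without nontrivial closed invariant subspaces. -/
def IsIrreducibleRep {H : Type v} [NormedAddCommGroup H] [InnerProductSpace ℂ H] [CompleteSpace H]
    (π : A →⋆ₙₐ[ℂ] (H →L[ℂ] H)) : Prop :=
  (∃ a, π a ≠ 0) ∧ ∀ K : Submodule ℂ H, IsClosed (K : Set H) → (∀ a, ∀ ξ ∈ K, π a ξ ∈ K) →
    K = ⊥ ∨ K = ⊤

/-- A primitive ideal is the kernel of an irreducible representation. -/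
def IsPrimitiveIdeal (I : TwoSidedIdeal A) : Prop :=
  ∃ (H : Type v) (_ : NormedAddCommGroup H) (_ : InnerProductSpace ℂ H) (_ : CompleteSpace H)
    (π : A →⋆ₙₐ[ℂ] (H →L[ℂ] H)), IsIrreducibleRep π ∧ TwoSidedIdeal.ker π = I

variable (A) in
/-- The set of primitive ideals of a C*-algebra. -/
def PrimSpec : Type v := {I : TwoSidedIdeal A // IsPrimitiveIdeal I}

/-- The hull of an ideal. -/
def hull (J : TwoSidedIdeal A) : Set (PrimSpec A) := {I | J ≤ I.1}

theorem continuous_rep {H : Type v} [NormedAddCommGroup H] [InnerProductSpace ℂ H]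
    [CompleteSpace H] (π : A →⋆ₙₐ[ℂ] (H →L[ℂ] H)) : Continuous π :=
  AddMonoidHomClass.continuous_of_bound π 1 fun a => by
    rw [one_mul]; exact NonUnitalStarAlgHom.norm_apply_le π a

theorem PrimSpec.isClosed (I : PrimSpec A) : IsClosed (I.1 : Set A) := by
  obtain ⟨I, H, _, _, _, π, hπ, rfl⟩ := I
  have : ((TwoSidedIdeal.ker π : TwoSidedIdeal A) : Set A) = π ⁻¹' {0} := by
    ext a; simp [TwoSidedIdeal.mem_ker]
  rw [this]
  exact isClosed_singleton.preimage (continuous_rep π)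

theorem PrimSpec.ne_top (I : PrimSpec A) : ¬ (⊤ : TwoSidedIdeal A) ≤ I.1 := by
  obtain ⟨I, H, _, _, _, π, ⟨⟨a, ha⟩, -⟩, rfl⟩ := I
  intro h
  exact ha ((TwoSidedIdeal.mem_ker _).1 (h trivial))

theorem PrimSpec.le_or_le (I : PrimSpec A) {J J' : TwoSidedIdeal A} (h : J ⊓ J' ≤ I.1) :
    J ≤ I.1 ∨ J' ≤ I.1 := by
  revert h
  obtain ⟨I, H, _, _, _, π, ⟨-, hπ⟩, rfl⟩ := I
  intro h
  by_contra! hc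
  simp only [TwoSidedIdeal.le_iff, not_subset, SetLike.mem_coe, TwoSidedIdeal.mem_ker] at hc
  obtain ⟨⟨a, haJ, ha⟩, ⟨b, hbJ, hb⟩⟩ := hc
  -- the vectors killed by all `π(c)`, `c ∈ J`
  let K : Submodule ℂ H :=
    { carrier := {ξ | ∀ c ∈ J, π c ξ = 0}
      add_mem' := fun {ξ η} hξ hη c hc => by rw [map_add, hξ c hc, hη c hc, add_zero]
      zero_mem' := fun c _ => map_zero _
      smul_mem' := fun z ξ hξ c hc => by rw [map_smul, hξ c hc, smul_zero] }
  have hKc : IsClosed (K : Set H) := by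
    have : (K : Set H) = ⋂ c ∈ J, (fun ξ => π c ξ) ⁻¹' {0} := by
      ext ξ; simp [K]
    rw [this]
    exact isClosed_biInter fun c _ => isClosed_singleton.preimage (π c).continuous
  have hKi : ∀ d, ∀ ξ ∈ K, π d ξ ∈ K := fun d ξ hξ c hc => by
    have := hξ (c * d) (TwoSidedIdeal.mul_mem_right J c d hc)
    rwa [map_mul] at this
  rcases hπ K hKc hKi with hK | hK
  · refine hb (ContinuousLinearMap.ext fun ξ => ?_)
    have : π b ξ ∈ K := fun c hc => by
      have hcb : c * b ∈ TwoSidedIdeal.ker π := h ((TwoSidedIdeal.mem_inf A).2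
        ⟨TwoSidedIdeal.mul_mem_right J c b hc, TwoSidedIdeal.mul_mem_left J' c b hbJ⟩)
      rw [TwoSidedIdeal.mem_ker, map_mul] at hcb
      exact DFunLike.congr_fun hcb ξ
    rw [hK, Submodule.mem_bot] at this
    simpa using this
  · refine ha (ContinuousLinearMap.ext fun ξ => ?_)
    have : ξ ∈ K := by rw [hK]; trivial
    exact this a haJ

/-- The Jacobson topology: the closed sets are the hulls of closed two-sided ideals. -/
instance : TopologicalSpace (PrimSpec A) :=
  TopologicalSpace.ofClosed {C | ∃ J : TwoSidedIdeal A, IsClosed (J : Set A) ∧ C = hull J}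
    ⟨⊤, isClosed_univ, (eq_empty_of_forall_notMem fun I => I.ne_top).symm⟩
    (by
      intro S hS
      let J₀ : TwoSidedIdeal A := sInf {J | ∃ I : PrimSpec A, I ∈ ⋂₀ S ∧ J = I.1}
      refine ⟨J₀, ?_, ?_⟩
      · have : (J₀ : Set A) = ⋂ I ∈ ⋂₀ S, ((I : PrimSpec A).1 : Set A) := by
          ext a
          simp only [J₀, SetLike.mem_coe, TwoSidedIdeal.mem_sInf, mem_iInter]
          exact ⟨fun h I hI => h _ ⟨I, hI, rfl⟩, fun h J ⟨I, hI, e⟩ => e ▸ h I hI⟩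
        rw [this]
        exact isClosed_biInter fun I _ => I.isClosed
      · refine Subset.antisymm (fun I hI => ?_) fun I hI C hC => ?_
        · change J₀ ≤ I.1
          exact sInf_le ⟨I, hI, rfl⟩
        obtain ⟨J, -, rfl⟩ := hS hC
        refine (show J ≤ J₀ from le_sInf ?_).trans hI
        rintro _ ⟨I', hI', rfl⟩
        exact hI' _ hC)
    (by
      rintro _ ⟨J, hJ, rfl⟩ _ ⟨J', hJ', rfl⟩
      refine ⟨J ⊓ J', ?_, ?_⟩
      · have : ((J ⊓ J' : TwoSidedIdeal A) : Set A) = (J : Set A) ∩ (J' : Set A) := by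
          ext a; exact TwoSidedIdeal.mem_inf A
        rw [this]
        exact hJ.inter hJ'
      · ext I
        refine ⟨fun h => ?_, I.le_or_le⟩
        change J ⊓ J' ≤ I.1
        rcases h with h | h
        · exact inf_le_left.trans h
        · exact inf_le_right.trans h)

theorem PrimSpec.isClosed_iff (C : Set (PrimSpec A)) :
    IsClosed C ↔ ∃ J : TwoSidedIdeal A, IsClosed (J : Set A) ∧ C = hull J :=
  isOpen_compl_iff.symm.trans (by
    change Cᶜᶜ ∈ {C | ∃ J : TwoSidedIdeal A, IsClosed (J : Set A) ∧ C = hull J} ↔ _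
    rw [compl_compl]; rfl)

end PrimitiveIdeals

/-- Amenability of a discrete group: existence of a left-invariant mean on `ℓ^∞(Γ)`. -/
def IsAmenable (Γ : Type*) [Group Γ] : Prop :=
  ∃ m : lp (fun _ : Γ => ℝ) ⊤ →ₗ[ℝ] ℝ,
    (∀ f, (∀ t, 0 ≤ f t) → 0 ≤ m f) ∧
    (∀ f, (∀ t, f t = 1) → m f = 1) ∧
    ∀ (s : Γ) (f f' : lp (fun _ : Γ => ℝ) ⊤), (∀ t, f' t = f (s * t)) → m f' = m f

namespace EtaleGroupoid
variable {X : Type u} {G : Type v} [TopologicalSpace X] [TopologicalSpace G]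
variable {𝒢 : EtaleGroupoid X G}

section Ind

variable [T2Space G] [LocallyCompactSpace G] {p : 𝒢.Char}

theorem exists_unit_nhd (x : X) : ∃ W : Set G, IsOpen W ∧ 𝒢.unit x ∈ W ∧ W ⊆ range 𝒢.unit := by
  obtain ⟨W, hWo, hxW, hWb⟩ := 𝒢.exists_bisection (𝒢.unit x)
  refine ⟨W ∩ (fun g => 𝒢.unit (𝒢.src g)) ⁻¹' W,
    hWo.inter (hWo.preimage (𝒢.continuous_unit.comp 𝒢.continuous_src)), ⟨hxW, ?_⟩, ?_⟩
  · rw [mem_preimage, 𝒢.src_unit]; exact hxW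
  · rintro g ⟨h1, h2⟩
    exact ⟨𝒢.src g, hWb.1 h2 h1 (𝒢.src_unit _)⟩

theorem exists_bump {W : Set G} (hW : IsOpen W) {g : G} (hg : g ∈ W) :
    ∃ f : 𝒢.Cc, f g = 1 ∧ Function.support f ⊆ W := by
  obtain ⟨φ, h1, h0, hc, -⟩ := exists_continuous_one_zero_of_isCompact (isCompact_singleton (x := g))
    hW.isClosed_compl (by rwa [disjoint_compl_right_iff_subset, singleton_subset_iff])
  refine ⟨Cc.mk (fun g => (φ g : ℂ)) (Complex.continuous_ofReal.comp φ.continuous)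
    (hc.comp_left (g := fun r : ℝ => (r : ℂ)) Complex.ofReal_zero), ?_, fun k hk => ?_⟩
  · have := h1 (mem_singleton g)
    simp [this]
  · by_contra hkW
    have := h0 hkW
    exact hk (by simp [this])

theorem conv_of_support_unit {f : G → ℂ} (hf : Function.support f ⊆ range 𝒢.unit) (F : G → ℂ)
    (g : G) : 𝒢.conv f F g = f (𝒢.unit (𝒢.rng g)) * F g := by
  rw [conv_eq_of_mem (W := range 𝒢.unit) ?_ hf F ⟨𝒢.rng g, rfl⟩ (𝒢.rng_unit _), 𝒢.inv_unit,
    𝒢.unit_mul]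
  rintro _ ⟨x, rfl⟩ _ ⟨y, rfl⟩ hxy
  rw [𝒢.rng_unit, 𝒢.rng_unit] at hxy
  rw [hxy]

open Classical in
/-- The basis vector of the space of the induced representation attached to a coset. -/
noncomputable def delta (q : 𝒢.Cosets p.pt) : 𝒢.IndSpace p :=
  IndSpace.toLpIso.symm (lp.single 2 q (1 : ℂ))

theorem inner_delta (q : 𝒢.Cosets p.pt) (ξ : 𝒢.IndSpace p) : ⟪delta q, ξ⟫_ℂ = ξ q.rep := by
  classical
  rw [← IndSpace.toLpIso.inner_map_map, delta, LinearIsometryEquiv.apply_symm_apply]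
  refine (lp.inner_single_left (𝕜 := ℂ) (G := fun _ : 𝒢.Cosets p.pt => ℂ) q (1 : ℂ)
    (IndSpace.toLpIso ξ)).trans ?_
  simp only [RCLike.inner_apply, map_one, mul_one]
  rfl

theorem delta_rep (q q' : 𝒢.Cosets p.pt) (h : q' ≠ q) : delta q q'.rep = 0 := by
  classical
  have : IndSpace.toLpIso (delta q) q' = 0 := by
    rw [delta, LinearIsometryEquiv.apply_symm_apply]
    exact lp.single_apply_ne (E := fun _ : 𝒢.Cosets p.pt => ℂ) 2 q (1 : ℂ) h
  exact this

theorem delta_rep_self (q : 𝒢.Cosets p.pt) : delta q q.rep = 1 := by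
  classical
  have : IndSpace.toLpIso (delta q) q = 1 := by
    rw [delta, LinearIsometryEquiv.apply_symm_apply]
    exact lp.single_apply_self (E := fun _ : 𝒢.Cosets p.pt => ℂ) 2 q (1 : ℂ)
  exact this

theorem IndSpace.ext_rep {ξ η : 𝒢.IndSpace p} (h : ∀ q : 𝒢.Cosets p.pt, ξ q.rep = η q.rep) :
    ξ = η := IndSpace.toLp_injective (Subtype.ext (funext h))

/-- The representations induced by characters are irreducible. -/
theorem isIrreducibleRep_indRep (p : 𝒢.Char) : IsIrreducibleRep (indRep p) := by
  constructor
  · obtain ⟨W, hWo, hxW, hWu⟩ := 𝒢.exists_unit_nhd p.pt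
    obtain ⟨f, hf1, hfW⟩ := exists_bump (𝒢 := 𝒢) hWo hxW
    refine ⟨CStar.ofCc f, fun h0 => ?_⟩
    let q : 𝒢.Cosets p.pt := Cosets.mk (𝒢.unit p.pt) (𝒢.src_unit _)
    have h1 : indRep p (CStar.ofCc f) (delta q) q.rep = 0 := by rw [h0]; rfl
    rw [indRep_ofCc] at h1
    change 𝒢.conv f (delta q) q.rep = 0 at h1
    rw [conv_of_support_unit (hfW.trans hWu), Cosets.rng_rep_mk, 𝒢.rng_unit, hf1,
      delta_rep_self] at h1
    simp at h1
  · intro K hKc hKi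
    have : CompleteSpace K := hKc.completeSpace_coe
    have hK : ∀ (f : 𝒢.Cc), ∀ ξ ∈ K, indCc p f ξ ∈ K := fun f ξ hξ => by
      rw [← indRep_ofCc]; exact hKi _ ξ hξ
    have hK' : ∀ (f : 𝒢.Cc), ∀ ξ ∈ Kᗮ, indCc p f ξ ∈ Kᗮ := fun f ξ hξ => by
      rw [Submodule.mem_orthogonal] at hξ ⊢
      intro η hη
      have := hξ _ (hK (star f) η hη)
      rwa [map_star, ContinuousLinearMap.star_eq_adjoint,
        ContinuousLinearMap.adjoint_inner_left] at this
    -- each basis vector lies in `K` or in its orthogonal complement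
    have hdich : ∀ q : 𝒢.Cosets p.pt, delta q ∈ K ∨ delta q ∈ Kᗮ := by
      intro q
      obtain ⟨a, haK, b, hbK, hab⟩ := K.exists_add_mem_mem_orthogonal (delta q)
      have ha : a = (a q.rep) • delta q := by
        refine IndSpace.ext_rep fun q' => ?_
        rw [IndSpace.smul_apply]
        by_cases hq : q' = q
        · rw [hq, delta_rep_self, mul_one]
        · rw [delta_rep q q' hq, mul_zero]
          have hne : 𝒢.unit (𝒢.rng q.rep) ≠ 𝒢.unit (𝒢.rng q'.rep) := fun h =>
            hq (Cosets.ext_rng (𝒢.unit_injective h).symm)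
          obtain ⟨W, hWo, hxW, hWu⟩ := 𝒢.exists_unit_nhd (𝒢.rng q.rep)
          obtain ⟨f, hf1, hfW⟩ := exists_bump (𝒢 := 𝒢)
            (hWo.inter (isClosed_singleton (x := 𝒢.unit (𝒢.rng q'.rep))).isOpen_compl)
            ⟨hxW, hne⟩
          have hfu : Function.support f ⊆ range 𝒢.unit := hfW.trans (inter_subset_left.trans hWu)
          have hf0 : f (𝒢.unit (𝒢.rng q'.rep)) = 0 := by
            by_contra h; exact (hfW h).2 rfl
          have hfd : indCc p f (delta q) = delta q := IndSpace.ext_rep fun q'' => by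
            change 𝒢.conv f (delta q) q''.rep = _
            rw [conv_of_support_unit hfu]
            by_cases hq'' : q'' = q
            · rw [hq'', hf1, one_mul]
            · rw [delta_rep q q'' hq'', mul_zero]
          have hsub : indCc p f a - a = b - indCc p f b := by
            have h1 := hfd
            rw [hab, map_add] at h1
            rw [sub_eq_sub_iff_add_eq_add, h1]; abel
          have hz : indCc p f a - a = 0 := by
            have h1 : indCc p f a - a ∈ K := K.sub_mem (hK f a haK) haK
            have h2 : indCc p f a - a ∈ Kᗮ := hsub ▸ Kᗮ.sub_mem hbK (hK' f b hbK)
            exact (Submodule.mem_bot ℂ).1 (K.inf_orthogonal_eq_bot ▸ ⟨h1, h2⟩)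
          have h3 : indCc p f a q'.rep = a q'.rep := by rw [sub_eq_zero.1 hz]
          rw [← h3]
          change 𝒢.conv f a q'.rep = 0
          rw [conv_of_support_unit hfu, hf0, zero_mul]
      by_cases h0 : a q.rep = 0
      · right
        rw [h0, zero_smul] at ha
        rw [hab, ha, zero_add]; exact hbK
      · left
        have : delta q = (a q.rep)⁻¹ • a := by
          conv_rhs => rw [ha]
          rw [smul_smul, IndSpace.smul_apply, delta_rep_self, mul_one, inv_mul_cancel₀ h0, one_smul]
        rw [this]; exact K.smul_mem _ haK
    -- by transitivity, the same alternative holds for all of them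
    have htrans : ∀ q q' : 𝒢.Cosets p.pt, delta q ∈ K → delta q' ∈ K := by
      intro q q' hq
      refine (hdich q').resolve_right fun hq' => ?_
      have e : 𝒢.src q'.rep = 𝒢.rng (𝒢.inv q.rep) := by
        rw [𝒢.rng_inv, Cosets.src_rep, Cosets.src_rep]
      obtain ⟨W, hWo, hgW, hWb⟩ := 𝒢.exists_bisection (𝒢.mul q'.rep (𝒢.inv q.rep))
      obtain ⟨f, hf1, hfW⟩ := exists_bump (𝒢 := 𝒢) hWo hgW
      have h1 := Submodule.inner_left_of_mem_orthogonal (hK f _ hq) hq'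
      rw [inner_delta] at h1
      change 𝒢.conv f (delta q) q'.rep = 0 at h1
      rw [conv_eq_of_mem hWb.2 hfW _ hgW (𝒢.rng_mul _ _ e), hf1, one_mul, 𝒢.inv_mul_rev _ _ e,
        𝒢.inv_inv, 𝒢.mul_assoc _ _ _ (by rw [𝒢.rng_inv, Cosets.src_rep, Cosets.src_rep])
          (by rw [𝒢.src_inv]), 𝒢.inv_mul, Cosets.src_rep] at h1
      have h2 := q.mul_rep_one
      rw [isotropy_one_val] at h2
      rw [h2, delta_rep_self] at h1
      exact one_ne_zero h1
    by_cases h : ∃ q : 𝒢.Cosets p.pt, delta q ∈ K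
    · right
      obtain ⟨q, hq⟩ := h
      rw [← Submodule.orthogonal_eq_bot_iff, Submodule.eq_bot_iff]
      intro ξ hξ
      refine IndSpace.ext_rep fun q' => ?_
      rw [← inner_delta]
      exact Submodule.inner_right_of_mem_orthogonal (htrans q q' hq) hξ
    · left
      push Not at h
      rw [Submodule.eq_bot_iff]
      intro ξ hξ
      refine IndSpace.ext_rep fun q' => ?_
      rw [← inner_delta]
      exact Submodule.inner_left_of_mem_orthogonal hξ ((hdich q').resolve_left (h q'))

/-- The map `Ind : Char(G) → Prim C*(G)`, sending `(x, χ)` to the kernel of the induced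
representation. -/
noncomputable def Ind (p : 𝒢.Char) : PrimSpec 𝒢.CStar :=
  ⟨TwoSidedIdeal.ker (indRep p), 𝒢.IndSpace p, inferInstance, inferInstance, inferInstance,
    indRep p, isIrreducibleRep_indRep p, rfl⟩

end Ind

namespace Char

/-- The set `O(U, K, V)` of all `(x, χ)` with `x ∈ U` and `χ(K ∩ G_x^x) ⊆ V`. -/
def basicSet (U : Set X) (K : Set G) (V : Set Circle) : Set 𝒢.Char :=
  {p | p.pt ∈ U ∧ ∀ h : 𝒢.Isotropy p.pt, h.1 ∈ K → p.chi h ∈ V}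

/-- The topology on `Char(G)` generated by the sets `O(U, K, V)`, where `U` is open, `K` is a
compact subset of the isotropy bundle, and `V` is open. -/
instance : TopologicalSpace 𝒢.Char :=
  TopologicalSpace.generateFrom {O | ∃ (U : Set X) (K : Set G) (V : Set Circle), IsOpen U ∧
    IsCompact K ∧ K ⊆ {g | 𝒢.src g = 𝒢.rng g} ∧ IsOpen V ∧ O = basicSet U K V}

variable (𝒢) in
/-- The homomorphism `h ↦ g⁻¹ h g` from the isotropy group at `r(g)` to the one at `s(g)`. -/
def conjIsotropy {x : X} (g : G) (hg : 𝒢.src g = x) :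
    𝒢.Isotropy (𝒢.rng g) →* 𝒢.Isotropy x where
  toFun h := ⟨𝒢.mul (𝒢.inv g) (𝒢.mul h.1 g), by
    have e : 𝒢.src h.1 = 𝒢.rng g := h.2.1
    have e' : 𝒢.src (𝒢.inv g) = 𝒢.rng (𝒢.mul h.1 g) := by
      rw [𝒢.src_inv, 𝒢.rng_mul _ _ e, h.2.2]
    rw [𝒢.src_mul _ _ e', 𝒢.rng_mul _ _ e', 𝒢.src_mul _ _ e, 𝒢.rng_inv]
    exact ⟨hg, hg⟩⟩
  map_one' := by
    refine Subtype.ext ?_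
    change 𝒢.mul (𝒢.inv g) (𝒢.mul (𝒢.unit (𝒢.rng g)) g) = 𝒢.unit x
    rw [𝒢.unit_mul, 𝒢.inv_mul, hg]
  map_mul' h k := by
    refine Subtype.ext ?_
    have eh : 𝒢.src h.1 = 𝒢.rng g := h.2.1
    have eh' : 𝒢.rng h.1 = 𝒢.rng g := h.2.2
    have ek : 𝒢.src k.1 = 𝒢.rng g := k.2.1
    have ek' : 𝒢.rng k.1 = 𝒢.rng g := k.2.2
    have e1 : 𝒢.src (𝒢.inv g) = 𝒢.rng (𝒢.mul k.1 g) := by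
      rw [𝒢.src_inv, 𝒢.rng_mul _ _ ek, ek']
    have e2 : 𝒢.src (𝒢.inv g) = 𝒢.rng (𝒢.mul h.1 g) := by
      rw [𝒢.src_inv, 𝒢.rng_mul _ _ eh, eh']
    change 𝒢.mul (𝒢.inv g) (𝒢.mul (𝒢.mul h.1 k.1) g) =
      𝒢.mul (𝒢.mul (𝒢.inv g) (𝒢.mul h.1 g)) (𝒢.mul (𝒢.inv g) (𝒢.mul k.1 g))
    rw [𝒢.mul_assoc (𝒢.inv g) _ _ e2 (by
        rw [𝒢.src_mul _ _ eh, 𝒢.rng_mul _ _ e1, 𝒢.rng_inv]),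
      𝒢.mul_assoc h.1 g _ eh (by rw [𝒢.rng_mul _ _ e1, 𝒢.rng_inv]),
      𝒢.mul_inv_cancel_left g _ (by rw [𝒢.rng_mul _ _ ek, ek']),
      𝒢.mul_assoc h.1 k.1 g (by rw [eh, ek']) ek]

/-- The action `g (x, χ) = (r(g), χ(g⁻¹ · g))` for `g ∈ G_x`. -/
noncomputable def act (g : G) (p : 𝒢.Char) (hg : 𝒢.src g = p.pt) : 𝒢.Char where
  pt := 𝒢.rng g
  chi := p.chi.comp (conjIsotropy 𝒢 g hg)

/-- The `G`-orbit of a point of `Char(G)`. -/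
def orbit (p : 𝒢.Char) : Set 𝒢.Char := {q | ∃ (g : G) (hg : 𝒢.src g = p.pt), q = act g p hg}

/-- `G`-invariant subsets of `Char(G)`. -/
def IsInvariant (A : Set 𝒢.Char) : Prop :=
  ∀ p ∈ A, ∀ (g : G) (hg : 𝒢.src g = p.pt), act g p hg ∈ A

/-- The orbit equivalence relation on a subset of `Char(G)`: two points are equivalent if they have
the same orbit. -/
def orbitSetoid (A : Set 𝒢.Char) : Setoid A := Setoid.ker fun p : A => orbit p.1

/-- The orbit space `G \ A`, with the quotient topology. -/
abbrev OrbitSpace (A : Set 𝒢.Char) : Type _ := Quotient (orbitSetoid A)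

/-- The quasi-orbit space: the `T₀`-ization of the orbit space `G \ A`. -/
abbrev QuasiOrbitSpace (A : Set 𝒢.Char) : Type _ := SeparationQuotient (OrbitSpace A)

/-- The quasi-orbit of a point. -/
def quasiOrbit {A : Set 𝒢.Char} (p : A) : QuasiOrbitSpace A :=
  SeparationQuotient.mk (Quotient.mk (orbitSetoid A) p)

variable (𝒢) in
/-- The set `Char_a(G)` of pairs `(x, χ)` such that the isotropy group at `x` is amenable. -/
def amenableSet : Set 𝒢.Char := {p | IsAmenable (𝒢.Isotropy p.pt)}

end Char

end EtaleGroupoid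

/-! Everything rests on one equivalence, `ind_mem_closure_iff`: if the isotropy group Γ at `p = (x,
χ)` is amenable, then `Ind p` is in the Jacobson closure of `Ind '' S` exactly when `p` is in the
closure of the union of the orbits through `S`. The Jacobson closure is described by inclusion of
kernels, so this compares weak containment of induced representations with the topology of the space
of characters.

From orbits to ideals (`indRep_eq_zero_of_mem_closure`). Each point q = (y, η) defines the
functional f ↦ ∑ f(h) η(h) over its isotropy group, and the functionals of all points of an orbit
are vector functionals of the same induced representation. Let points of the orbits converge to `p`
along an ultrafilter. Their functionals converge, but isotropy may jump: the limit sees only the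
subgroup H of Γ formed by limits of isotropy elements, so it is f ↦ ∑ f(γ) χ(γ) over γ ∈ H
(`tendsto_charFunctional`). Amenability repairs this. It provides almost invariant unit vectors in
ℓ²(Γ/H); lifting such a vector, twisted by the conjugate of χ, to an element b of C_c(G), the
compression f ↦ b* f b turns the limit functional into one close to the functional of `p`
(`exists_compression`). Hence that functional kills the common kernel of the representations from
`S`, and irreducibility does the rest.

From ideals to orbits (`mem_closure_of_ker_le`); amenability plays no role here. Bump functions at
finitely many isotropy elements γ, weighted by conj χ(γ), together with one at the unit x, add up to
an element of the largest conceivable norm in the representation of `p`. Inclusion of kernels forces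
domination of norms (`norm_le_of_forall_norm_le`), so some `s ∈ S` has a vector on which all
summands almost agree, and which they almost fix. If the orbit of `s` missed a neighbourhood of `p`,
then at each coset one of the summands would move the vector by a definite proportion, a
contradiction.

The rest is formal. The equivalence makes `Ind` continuous and open from A onto its image and
identifies its fibres. Since the primitive ideal space is T₀, the image and the quasi-orbit space
are two quotients of A with the same fibres. -/

/-! ### Norm inequalities read off from kernels. -/

section NormLemma

/-- A self-adjoint element of a C*-algebra has norm at most `c` if and only if the functional
calculus of the positive part of `|t| - c` vanishes. -/
theorem IsSelfAdjoint.norm_le_iff_cfcₙ_eq_zero {B : Type*} [NonUnitalCStarAlgebra B] {b : B}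
    (hb : IsSelfAdjoint b) {c : ℝ} (hc : 0 ≤ c) :
    ‖b‖ ≤ c ↔ cfcₙ (fun t : ℝ => max (|t| - c) 0) b = 0 := by
  have hf : Continuous fun t : ℝ => max (|t| - c) 0 := by fun_prop
  have h1 : ‖b‖ ≤ c ↔ ∀ t ∈ quasispectrum ℝ b, |t| ≤ c := by
    have := norm_cfcₙ_le_iff (𝕜 := ℝ) (fun t : ℝ => t) b c
    rw [cfcₙ_id' ℝ b] at this
    simpa using this
  -- The function vanishes at 0 because `0 ≤ c`, as the non-unital functional calculus demands; its
  -- value at `b` is zero exactly when it vanishes on the quasispectrum.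
  have h2 : cfcₙ (fun t : ℝ => max (|t| - c) 0) b = 0 ↔
      (quasispectrum ℝ b).EqOn (fun t : ℝ => max (|t| - c) 0) (fun _ => 0) := by
    rw [← cfcₙ_eq_cfcₙ_iff_eqOn (R := ℝ) (a := b) (f := fun t : ℝ => max (|t| - c) 0)
      (g := fun _ => 0) hb hf.continuousOn (by simp [hc]) continuousOn_const rfl, cfcₙ_const_zero]
  rw [h1, h2]
  refine forall₂_congr fun t _ => ?_
  simp

/-- The C*-identity reduces to the self-adjoint element `star a * a` and the bound `c * c`, and
functional calculus commutes with *-homomorphisms. The point is that the element tested depends on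
`a` and `c` only, not on `σ`, so a norm bound becomes a condition on the kernel. -/
theorem norm_map_le_iff_cfcₙ_mem_ker {A E : Type*} [NonUnitalCStarAlgebra A]
    [NonUnitalCStarAlgebra E] (σ : A →⋆ₙₐ[ℂ] E) {a : A} {c : ℝ} (hc : 0 ≤ c) :
    ‖σ a‖ ≤ c ↔ σ (cfcₙ (fun t : ℝ => max (|t| - c * c) 0) (star a * a)) = 0 := by
  have hf : Continuous fun t : ℝ => max (|t| - c * c) 0 := by fun_prop
  have hcc : 0 ≤ c * c := mul_nonneg hc hc
  have hsa : IsSelfAdjoint (star a * a) := .star_mul_self a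
  have hsa' : IsSelfAdjoint (σ (star a * a)) := hsa.map σ
  have hσ : Continuous σ := AddMonoidHomClass.continuous_of_bound σ 1 fun a => by
    rw [one_mul]; exact NonUnitalStarAlgHom.norm_apply_le σ a
  have h1 := NonUnitalStarAlgHomClass.map_cfcₙ (R := ℝ) (S := ℂ) σ
    (fun t : ℝ => max (|t| - c * c) 0) (star a * a) hf.continuousOn (by simp [hcc]) hσ hsa hsa'
  rw [h1, ← hsa'.norm_le_iff_cfcₙ_eq_zero hcc, map_mul, map_star, CStarRing.norm_star_mul_self]
  exact (mul_self_le_mul_self_iff (norm_nonneg _) hc)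

/-- If the common kernel of a family of representations is contained in the kernel of another one,
then the norms of the family dominate. -/
theorem norm_le_of_forall_norm_le {A B ι : Type*} {D : ι → Type*} [NonUnitalCStarAlgebra A]
    [NonUnitalCStarAlgebra B] [∀ i, NonUnitalCStarAlgebra (D i)] (π : A →⋆ₙₐ[ℂ] B)
    (ρ : ∀ i, A →⋆ₙₐ[ℂ] D i) (hker : ∀ a, (∀ i, ρ i a = 0) → π a = 0) {a : A} {c : ℝ}
    (hc : 0 ≤ c) (h : ∀ i, ‖ρ i a‖ ≤ c) : ‖π a‖ ≤ c := by
  rw [norm_map_le_iff_cfcₙ_mem_ker π hc]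
  exact hker _ fun i => (norm_map_le_iff_cfcₙ_mem_ker (ρ i) hc).1 (h i)

end NormLemma

/-! ### Almost invariant vectors on homogeneous spaces of amenable groups. -/

section Amenable

variable {Γ : Type*} [Group Γ]

/-- Bounded functions cannot all be moved up by translations of an amenable group. -/
theorem IsAmenable.exists_sum_sub_lt (hΓ : IsAmenable Γ) (F : Finset Γ) (φ : Γ → Γ → ℝ)
    (hφ : ∀ s, ∃ C, ∀ t, |φ s t| ≤ C) {c : ℝ} (hc : 0 < c) :
    ∃ t, ∑ s ∈ F, (φ s (s * t) - φ s t) < c := by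
  obtain ⟨m, hpos, hone, hinv⟩ := hΓ
  by_contra! H
  have hmem : ∀ g : Γ → ℝ, (∃ C, ∀ t, |g t| ≤ C) → Memℓp g ⊤ := fun g ⟨C, hC⟩ =>
    memℓp_infty ⟨C, by rintro _ ⟨t, rfl⟩; exact hC t⟩
  let a : Γ → lp (fun _ : Γ => ℝ) ⊤ := fun s => ⟨φ s, hmem _ (hφ s)⟩
  let b : Γ → lp (fun _ : Γ => ℝ) ⊤ := fun s => ⟨fun t => φ s (s * t), hmem _ <| by
    obtain ⟨C, hC⟩ := hφ s
    exact ⟨C, fun t => hC _⟩⟩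
  let e : lp (fun _ : Γ => ℝ) ⊤ := ⟨fun _ => 1, hmem _ ⟨1, by simp⟩⟩
  -- Invariance of the mean cancels all the differences, whereas positivity and normalization would
  -- make the mean of their sum at least `c`.
  have h1 : m (∑ s ∈ F, (b s - a s)) = 0 := by
    rw [map_sum]
    refine Finset.sum_eq_zero fun s _ => ?_
    rw [map_sub, hinv s (a s) (b s) fun t => rfl, sub_self]
  have h2 : 0 ≤ m (∑ s ∈ F, (b s - a s) - c • e) := by
    refine hpos _ fun t => ?_
    have : (∑ s ∈ F, (b s - a s) - c • e : lp (fun _ : Γ => ℝ) ⊤) t =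
        ∑ s ∈ F, (φ s (s * t) - φ s t) - c := by
      rw [lp.coeFn_sub, Pi.sub_apply, lp.coeFn_sum, Finset.sum_apply]
      exact congrArg₂ (· - ·) rfl (mul_one c)
    rw [this]
    exact sub_nonneg.2 (H t)
  rw [map_sub, h1, map_smul, hone e fun _ => rfl, smul_eq_mul] at h2
  linarith

/-- Almost invariant finitely supported probability measures on a homogeneous space of an amenable
group. -/
theorem IsAmenable.exists_almost_invariant (hΓ : IsAmenable Γ) (H : Subgroup Γ) (F : Finset Γ)
    {ε : ℝ} (hε : 0 < ε) :
    ∃ μ : (Γ ⧸ H) →₀ ℝ, (∀ q, 0 ≤ μ q) ∧ ∑ q ∈ μ.support, μ q = 1 ∧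
      ∀ s ∈ F, ∀ B : Finset (Γ ⧸ H), ∑ q ∈ B, |μ (s⁻¹ • q) - μ q| < ε := by
  classical
  have : Fact ((1 : ENNReal) ≤ 1) := ⟨le_rfl⟩
  let δ : Γ ⧸ H → lp (fun _ : Γ ⧸ H => ℝ) 1 := fun q => lp.single 1 q (1 : ℝ)
  let v : Γ ⧸ H → (F → lp (fun _ : Γ ⧸ H => ℝ) 1) := fun q s => δ (s.1 • q) - δ q
  -- Day's convexity argument: `T` records the differences of the translates s·μ and μ for `s ∈ F`,
  -- with values in a finite power of ℓ¹(Γ/H). It suffices that 0 is in the norm closure of the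
  -- image of the probability measures `P`.
  let T : ((Γ ⧸ H) →₀ ℝ) →ₗ[ℝ] (F → lp (fun _ : Γ ⧸ H => ℝ) 1) := Finsupp.linearCombination ℝ v
  let P : Set ((Γ ⧸ H) →₀ ℝ) := {μ | (∀ q, 0 ≤ μ q) ∧ μ.linearCombination ℝ (fun _ => (1 : ℝ)) = 1}
  have hP : Convex ℝ P := by
    rintro μ ⟨h1, h2⟩ ν ⟨k1, k2⟩ a b ha hb hab
    refine ⟨fun q => ?_, ?_⟩
    · simp only [Finsupp.add_apply, Finsupp.smul_apply, smul_eq_mul]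
      have := h1 q; have := k1 q; positivity
    · rw [map_add, map_smul, map_smul, h2, k2]; simpa using hab
  have hT : ∀ μ (s : F) q, T μ s q = μ (s.1⁻¹ • q) - μ q := by
    intro μ s q
    induction μ using Finsupp.induction_linear with
    | zero => simp
    | add f g hf hg =>
      rw [map_add, Pi.add_apply, lp.coeFn_add, Pi.add_apply, hf, hg, Finsupp.add_apply,
        Finsupp.add_apply]; ring
    | single q' a =>
      have h1 : T (Finsupp.single q' a) s q =
          a * ((Pi.single (s.1 • q') 1 : Γ ⧸ H → ℝ) q - (Pi.single q' 1 : Γ ⧸ H → ℝ) q) := by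
        simp only [T, Finsupp.linearCombination_single]; rfl
      simp only [h1, Pi.single_apply, Finsupp.single_apply, eq_inv_smul_iff, @eq_comm _ q]
      split_ifs <;> simp
  have h0 : (0 : F → lp (fun _ : Γ ⧸ H => ℝ) 1) ∈ closure (T '' P) := by
    by_contra hn
    obtain ⟨f, u, hf0, hfu⟩ := geometric_hahn_banach_point_closed
      (hP.linear_image T).closure isClosed_closure hn
    rw [map_zero] at hf0
    -- The separating functional, evaluated at point masses and pulled back along t ↦ tH, gives
    -- bounded functions on the group. Their total displacement at each `t` is the value of `f` at
    -- the image under `T` of a point mass, hence bounded below by a positive constant: this is what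
    -- amenability excludes.
    let φ : Γ → Γ → ℝ := fun s t =>
      if hs : s ∈ F then f (Pi.single ⟨s, hs⟩ (δ (t : Γ ⧸ H))) else 0
    obtain ⟨t, ht⟩ := hΓ.exists_sum_sub_lt F φ (fun s => ⟨‖f‖, fun t => by
      by_cases hs : s ∈ F
      · simp only [φ, dif_pos hs]
        refine (f.le_opNorm _).trans ?_
        rw [Pi.norm_single, lp.norm_single zero_lt_one]; simp
      · simp only [φ, dif_neg hs, abs_zero]; exact norm_nonneg f⟩) hf0
    have h1 := hfu (T (Finsupp.single (t : Γ ⧸ H) 1)) (subset_closure ⟨_, ⟨fun q => by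
      rw [Finsupp.single_apply]; split_ifs <;> simp, by simp⟩, rfl⟩)
    have h2 : f (T (Finsupp.single (t : Γ ⧸ H) 1)) = ∑ s ∈ F, (φ s (s * t) - φ s t) := by
      rw [← Finset.sum_coe_sort F]
      have : T (Finsupp.single (t : Γ ⧸ H) 1) = ∑ s : F, Pi.single s (v t s) := by
        rw [Finset.univ_sum_single]; simp [T]
      rw [this, map_sum]
      refine Finset.sum_congr rfl fun s _ => ?_
      simp only [φ, dif_pos s.2, v, Pi.single_sub, map_sub]
      rfl
    linarith
  obtain ⟨_, ⟨μ, hμ, rfl⟩, hlt⟩ := Metric.mem_closure_iff.1 h0 ε hε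
  rw [dist_comm, dist_zero_right] at hlt
  refine ⟨μ, hμ.1, ?_, fun s hs B => ?_⟩
  · have := hμ.2
    simpa [Finsupp.linearCombination_apply, Finsupp.sum] using this
  · have h1 := (norm_le_pi_norm (T μ) ⟨s, hs⟩).trans_lt hlt
    have h2 := lp.sum_rpow_le_norm_rpow (p := 1) (by simp) (T μ ⟨s, hs⟩) B
    simp only [ENNReal.toReal_one, Real.rpow_one, Real.norm_eq_abs, hT] at h2
    exact h2.trans_lt h1

/-- Almost invariant finitely supported unit vectors in `ℓ²` of a homogeneous space of an amenable
group. -/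
theorem IsAmenable.exists_almost_invariant_vector (hΓ : IsAmenable Γ) (H : Subgroup Γ)
    (F : Finset Γ) {ε : ℝ} (hε : 0 < ε) :
    ∃ (T : Finset (Γ ⧸ H)) (κ : Γ ⧸ H → ℝ), ∑ q ∈ T, κ q ^ 2 = 1 ∧
      ∀ s ∈ F, |(∑ q ∈ T, ∑ q' ∈ T, open Classical in if s • q' = q then κ q * κ q' else 0) - 1|
        < ε := by
  classical
  -- Inverses are taken because the measure is compared below at `s • q` rather than at `s⁻¹ • q`.
  -- The vector is the pointwise square root of μ.
  obtain ⟨μ, h0, h1, hμ⟩ := hΓ.exists_almost_invariant H (F.image fun s => s⁻¹) hε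
  let κ : Γ ⧸ H → ℝ := fun q => √(μ q)
  have hκ : ∀ q, κ q ^ 2 = μ q := fun q => Real.sq_sqrt (h0 q)
  have hκ0 : ∀ q, q ∉ μ.support → κ q = 0 := fun q hq => by
    simp [κ, Finsupp.notMem_support_iff.1 hq]
  refine ⟨μ.support, κ, by simp_rw [hκ]; exact h1, fun s hs => ?_⟩
  -- A finite set carrying both μ and its translate, so that both have full mass on it.
  let B : Finset (Γ ⧸ H) := μ.support ∪ μ.support.image (s⁻¹ • ·)
  have hB : ∑ q ∈ B, |μ (s • q) - μ q| < ε := by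
    simpa using hμ s⁻¹ (Finset.mem_image_of_mem _ hs) B
  have hB1 : ∑ q ∈ B, κ q ^ 2 = 1 := by
    simp_rw [hκ]
    rw [← h1]
    exact (Finset.sum_subset Finset.subset_union_left fun q _ hq =>
      Finsupp.notMem_support_iff.1 hq).symm
  have hB2 : ∑ q ∈ B, κ (s • q) ^ 2 = 1 := by
    simp_rw [hκ]
    rw [← h1, ← Finset.sum_image (s := B) (g := (s • ·)) (f := fun q => μ q)
      (MulAction.injective s).injOn]
    refine (Finset.sum_subset (fun q hq => ?_) fun q _ hq =>
      Finsupp.notMem_support_iff.1 hq).symm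
    refine Finset.mem_image.2 ⟨s⁻¹ • q, ?_, smul_inv_smul _ _⟩
    exact Finset.mem_union_right _ (Finset.mem_image_of_mem _ hq)
  have h3 : (∑ q ∈ μ.support, ∑ q' ∈ μ.support, if s • q' = q then κ q * κ q' else 0) =
      ∑ q ∈ B, κ (s • q) * κ q := by
    rw [Finset.sum_comm, Finset.sum_subset Finset.subset_union_left (s₂ := B)]
    · refine Finset.sum_congr rfl fun q' _ => ?_
      rw [Finset.sum_ite_eq]
      split_ifs with h
      · rfl
      · rw [hκ0 _ h, zero_mul]
    · intro q' _ hq'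
      refine Finset.sum_eq_zero fun q _ => ?_
      rw [hκ0 q' hq', mul_zero, ite_self]
  -- From (√a - √b)² ≤ |a - b|. The squared distance of the two unit vectors is also 2 minus twice
  -- their inner product, so the latter is close to 1.
  have h4 : ∑ q ∈ B, (κ (s • q) - κ q) ^ 2 ≤ ∑ q ∈ B, |μ (s • q) - μ q| := by
    refine Finset.sum_le_sum fun q _ => ?_
    have ha : 0 ≤ κ (s • q) := Real.sqrt_nonneg _
    have hb : 0 ≤ κ q := Real.sqrt_nonneg _
    rw [← hκ, ← hκ, sq_sub_sq, abs_mul, abs_of_nonneg (add_nonneg ha hb), ← sq_abs, sq]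
    refine mul_le_mul_of_nonneg_right ?_ (abs_nonneg _)
    rw [abs_le]
    constructor <;> linarith
  have h5 : ∑ q ∈ B, (κ (s • q) - κ q) ^ 2 = 2 - 2 * ∑ q ∈ B, κ (s • q) * κ q := by
    simp_rw [sub_sq]
    rw [Finset.sum_add_distrib, Finset.sum_sub_distrib, hB1, hB2, Finset.mul_sum]
    simp_rw [mul_assoc]
    ring
  have h6 : 0 ≤ ∑ q ∈ B, (κ (s • q) - κ q) ^ 2 := Finset.sum_nonneg fun _ _ => sq_nonneg _
  rw [h3, abs_lt]
  constructor <;> linarith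

end Amenable

/-! ### Bisections and the action on characters. -/

namespace EtaleGroupoid
variable {X : Type u} {G : Type v} [TopologicalSpace X] [TopologicalSpace G]
variable {𝒢 : EtaleGroupoid X G}

section Bisections

variable (𝒢) in
/-- A chosen open bisection containing `g`. -/
def bis (g : G) : Set G := (𝒢.exists_bisection g).choose

theorem isOpen_bis (g : G) : IsOpen (𝒢.bis g) := (𝒢.exists_bisection g).choose_spec.1

theorem mem_bis (g : G) : g ∈ 𝒢.bis g := (𝒢.exists_bisection g).choose_spec.2.1

theorem isBisection_bis (g : G) : 𝒢.IsBisection (𝒢.bis g) :=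
  (𝒢.exists_bisection g).choose_spec.2.2

/-- Near `r(g)`, the elements of a bisection containing `g` are close to `g`. -/
theorem eventually_mem_of_mem_bisection {W O : Set G} {g : G} (hWo : IsOpen W)
    (hW : InjOn 𝒢.rng W) (hg : g ∈ W) (hO : O ∈ 𝓝 g) :
    ∀ᶠ y in 𝓝 (𝒢.rng g), ∀ h ∈ W, 𝒢.rng h = y → h ∈ O := by
  have h1 : 𝒢.rng '' (W ∩ interior O) ∈ 𝓝 (𝒢.rng g) :=
    (𝒢.isLocalHomeomorph_rng.isOpenMap _ (hWo.inter isOpen_interior)).mem_nhds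
      ⟨g, ⟨hg, mem_interior_iff_mem_nhds.2 hO⟩, rfl⟩
  filter_upwards [h1]
  rintro _ ⟨k, ⟨hkW, hkO⟩, rfl⟩ h hh hhk
  rw [hW hh hkW hhk]
  exact interior_subset hkO

/-- Bump functions supported in an open set. -/
theorem exists_bump_tsupport [T2Space G] [LocallyCompactSpace G] {W : Set G} (hW : IsOpen W)
    {g : G} (hg : g ∈ W) :
    ∃ φ : G → ℝ, ∃ f : 𝒢.Cc, (∀ k, f k = φ k) ∧ (∀ k, 0 ≤ φ k ∧ φ k ≤ 1) ∧ φ g = 1 ∧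
      tsupport f ⊆ W := by
  obtain ⟨V, hVo, hgV, hVW, hVc⟩ := exists_open_between_and_isCompact_closure
    (isCompact_singleton (x := g)) hW (singleton_subset_iff.2 hg)
  obtain ⟨φ, h1, h0, hc, h01⟩ := exists_continuous_one_zero_of_isCompact
    (isCompact_singleton (x := g)) hVo.isClosed_compl
    (by rwa [disjoint_compl_right_iff_subset])
  refine ⟨φ, Cc.mk (fun g => (φ g : ℂ)) (Complex.continuous_ofReal.comp φ.continuous)
    (hc.comp_left (g := fun r : ℝ => (r : ℂ)) Complex.ofReal_zero), fun k => rfl,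
    fun k => h01 k, h1 (mem_singleton g), (closure_mono fun k hk => ?_).trans hVW⟩
  by_contra hkV
  have := h0 hkV
  exact hk (by simp [this])

end Bisections

namespace Char

/-- Isotropy groups at equal but not syntactically identical units are different types; comparing
characters through the underlying arrows avoids transport. -/
theorem ext_val {p q : 𝒢.Char} (h : p.pt = q.pt)
    (hc : ∀ (a : 𝒢.Isotropy p.pt) (b : 𝒢.Isotropy q.pt), a.1 = b.1 → p.chi a = q.chi b) :
    p = q := by
  obtain ⟨x, χ⟩ := p
  obtain ⟨y, η⟩ := q
  obtain rfl : x = y := h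
  congr 1
  exact MonoidHom.ext fun a => hc a a rfl

theorem act_unit (p : 𝒢.Char) : act (𝒢.unit p.pt) p (𝒢.src_unit _) = p := by
  refine ext_val (𝒢.rng_unit _) fun a b hab => ?_
  refine congrArg p.chi (Subtype.ext ?_)
  change 𝒢.mul (𝒢.inv (𝒢.unit p.pt)) (𝒢.mul a.1 (𝒢.unit p.pt)) = b.1
  have h1 := 𝒢.mul_unit b.1
  have h2 := 𝒢.unit_mul b.1
  rw [b.2.1] at h1
  rw [b.2.2] at h2
  rw [𝒢.inv_unit, hab, h1, h2]

theorem act_mul (p : 𝒢.Char) {g k : G} (hg : 𝒢.src g = p.pt) (hk : 𝒢.src k = 𝒢.rng g) :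
    act (𝒢.mul k g) p ((𝒢.src_mul _ _ hk).trans hg) = act k (act g p hg) hk := by
  refine ext_val (𝒢.rng_mul _ _ hk) fun a b hab => ?_
  refine congrArg p.chi (Subtype.ext ?_)
  change 𝒢.mul (𝒢.inv (𝒢.mul k g)) (𝒢.mul a.1 (𝒢.mul k g)) =
    𝒢.mul (𝒢.inv g) (𝒢.mul (𝒢.mul (𝒢.inv k) (𝒢.mul b.1 k)) g)
  have hb1 : 𝒢.src b.1 = 𝒢.rng k := b.2.1
  have hb2 : 𝒢.rng b.1 = 𝒢.rng k := b.2.2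
  have e1 : 𝒢.src (𝒢.inv k) = 𝒢.rng (𝒢.mul b.1 k) := by rw [𝒢.src_inv, 𝒢.rng_mul _ _ hb1, hb2]
  have e2 : 𝒢.src (𝒢.mul b.1 k) = 𝒢.rng g := by rw [𝒢.src_mul _ _ hb1, hk]
  rw [hab, 𝒢.inv_mul_rev _ _ hk, ← 𝒢.mul_assoc b.1 k g hb1 hk,
    𝒢.mul_assoc (𝒢.inv g) (𝒢.inv k) _ (by rw [𝒢.src_inv, 𝒢.rng_inv, hk])
      (by rw [e1, 𝒢.rng_mul (𝒢.mul b.1 k) _ e2]), 𝒢.mul_assoc (𝒢.inv k) _ g e1 e2]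

theorem act_mem_orbit (p : 𝒢.Char) (g : G) (hg : 𝒢.src g = p.pt) : act g p hg ∈ orbit p :=
  ⟨g, hg, rfl⟩

theorem mem_orbit_self (p : 𝒢.Char) : p ∈ orbit p := ⟨_, _, (act_unit p).symm⟩

theorem orbit_act_subset (p : 𝒢.Char) (g : G) (hg : 𝒢.src g = p.pt) :
    orbit (act g p hg) ⊆ orbit p := by
  rintro _ ⟨k, hk, rfl⟩
  exact ⟨_, _, (act_mul p hg hk).symm⟩

theorem act_inv_act (p : 𝒢.Char) (g : G) (hg : 𝒢.src g = p.pt) :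
    act (𝒢.inv g) (act g p hg) (𝒢.src_inv g) = p := by
  rw [← act_mul p hg (𝒢.src_inv g)]
  conv_rhs => rw [← act_unit p]
  have : 𝒢.mul (𝒢.inv g) g = 𝒢.unit p.pt := by rw [𝒢.inv_mul, hg]
  congr 1

theorem orbit_act (p : 𝒢.Char) (g : G) (hg : 𝒢.src g = p.pt) : orbit (act g p hg) = orbit p := by
  refine (orbit_act_subset p g hg).antisymm ?_
  conv_lhs => rw [← act_inv_act p g hg]
  exact orbit_act_subset _ _ _

theorem orbit_eq_of_mem {p q : 𝒢.Char} (h : q ∈ orbit p) : orbit q = orbit p := by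
  obtain ⟨g, hg, rfl⟩ := h
  exact orbit_act p g hg

end Char

/-! ### Functionals attached to characters. -/

section Functional

/-- The functional `f ↦ ∑ f(h) χ(h)` attached to a character `χ` of an isotropy group. -/
noncomputable def charFunctional (q : 𝒢.Char) (f : G → ℂ) : ℂ :=
  ∑ᶠ h : 𝒢.Isotropy q.pt, f h.1 * (q.chi h : ℂ)

theorem charFunctional_eq_of_mem {q : 𝒢.Char} {f : G → ℂ} {W : Set G} (hW : InjOn 𝒢.rng W)
    (hf : Function.support f ⊆ W) {w : 𝒢.Isotropy q.pt} (hw : w.1 ∈ W) :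
    charFunctional q f = f w.1 * (q.chi w : ℂ) := by
  refine finsum_eq_single _ _ fun h hh => ?_
  by_cases h0 : f h.1 = 0
  · rw [h0, zero_mul]
  · exact absurd (Subtype.ext (hW (hf h0) hw (h.2.2.trans w.2.2.symm))) hh

theorem charFunctional_eq_zero {q : 𝒢.Char} {f : G → ℂ} (hf : ∀ h : 𝒢.Isotropy q.pt, f h.1 = 0) :
    charFunctional q f = 0 := by
  rw [charFunctional, ← finsum_zero (α := 𝒢.Isotropy q.pt)]
  exact finsum_congr fun h => by rw [hf, zero_mul]

/-- Makes the sums over an isotropy group finite, so that `finsum` does not take its default value.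
-/
theorem finite_isotropy_support (f : 𝒢.Cc) (x : X) :
    {h : 𝒢.Isotropy x | f h.1 ≠ 0}.Finite :=
  Set.Finite.of_injOn (f := fun h : 𝒢.Isotropy x => h.1)
    (t := 𝒢.rng ⁻¹' {x} ∩ Function.support f)
    (fun h hh => ⟨h.2.2, hh⟩) Subtype.val_injective.injOn (finite_rng_support f x)

variable [T2Space G] [LocallyCompactSpace G]

/-- Evaluation at a point of `G_x`, as a vector of the space of an induced representation. -/
theorem exists_evaluation_vector (p : 𝒢.Char) {g : G} (hg : 𝒢.src g = p.pt) :
    ∃ ζ : 𝒢.IndSpace p, (∀ ξ : 𝒢.IndSpace p, ⟪ζ, ξ⟫_ℂ = ξ g) ∧ ζ g = 1 ∧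
      ∀ k, 𝒢.rng k ≠ 𝒢.rng g → ζ k = 0 := by
  -- The basis vector evaluates at the chosen representative of the coset of `g`; the phase χ(k)
  -- corrects this to evaluation at `g` itself.
  obtain ⟨k, hk⟩ := exists_isotropy (Cosets.src_rep (Cosets.mk (𝒢 := 𝒢) g hg)) hg
    (Cosets.rng_rep_mk g hg)
  have h1 : ∀ ξ : 𝒢.IndSpace p, ⟪(p.chi k : ℂ) • delta (Cosets.mk g hg), ξ⟫_ℂ = ξ g := by
    intro ξ
    rw [inner_smul_left, inner_delta]
    conv_rhs => rw [hk]
    rw [ξ.equivariant (Cosets.src_rep _)]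
  refine ⟨(p.chi k : ℂ) • delta (Cosets.mk g hg), h1, ?_, fun l hl => ?_⟩
  · rw [← h1, inner_smul_left, inner_smul_right, inner_delta, delta_rep_self, mul_one,
      mul_comm, Complex.mul_conj, Complex.normSq_eq_norm_sq, Circle.norm_coe]
    simp
  · rw [IndSpace.smul_apply]
    by_cases hs : 𝒢.src l = p.pt
    · have : delta (p := p) (Cosets.mk g hg) l = 0 := by
        rw [← norm_eq_zero, IndSpace.norm_eq _ hs (Cosets.src_rep (Cosets.mk l hs))
          (Cosets.rng_rep_mk l hs).symm, delta_rep, norm_zero]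
        intro h
        apply hl
        rw [← Cosets.rng_rep_mk (𝒢 := 𝒢) l hs, h, Cosets.rng_rep_mk]
      rw [this, mul_zero]
    · rw [IndSpace.eq_zero _ hs, mul_zero]

/-- Write h⁻¹g = g(g⁻¹h⁻¹g) and apply equivariance. This is where the action on characters enters:
at `g` the isotropy group of r(g) acts through the character of the moved point. -/
theorem IndSpace.apply_inv_mul {p : 𝒢.Char} (ξ : 𝒢.IndSpace p) {g : G} (hg : 𝒢.src g = p.pt)
    (h : 𝒢.Isotropy (𝒢.rng g)) :
    ξ (𝒢.mul (𝒢.inv h.1) g) = ((Char.act g p hg).chi h : ℂ) * ξ g := by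
  have e0 : 𝒢.src (𝒢.inv h.1) = 𝒢.rng g := by rw [𝒢.src_inv, h.2.2]
  have h1 : 𝒢.mul (𝒢.inv h.1) g = 𝒢.mul g (Char.conjIsotropy 𝒢 g hg h⁻¹).1 := by
    change _ = 𝒢.mul g (𝒢.mul (𝒢.inv g) (𝒢.mul (𝒢.inv h.1) g))
    rw [𝒢.mul_inv_cancel_left _ _ (by rw [𝒢.rng_mul _ _ e0, 𝒢.rng_inv, h.2.1])]
  rw [h1, ξ.equivariant hg, map_inv, map_inv, Circle.coe_inv_eq_conj, Complex.conj_conj]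
  rfl

/-- The functional attached to a point of an orbit is a vector functional of the induced
representation. -/
theorem inner_indCc_evaluation (p : 𝒢.Char) {g : G} (hg : 𝒢.src g = p.pt) {ζ : 𝒢.IndSpace p}
    (h1 : ∀ ξ : 𝒢.IndSpace p, ⟪ζ, ξ⟫_ℂ = ξ g) (h2 : ζ g = 1)
    (h3 : ∀ k, 𝒢.rng k ≠ 𝒢.rng g → ζ k = 0) (f : 𝒢.Cc) :
    ⟪ζ, indCc p f ζ⟫_ℂ = charFunctional (Char.act g p hg) f := by
  rw [h1, indCc_apply]
  -- The vector ζ lives on arrows with range r(g), and h⁻¹g has range s(h), so only isotropy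
  -- elements `h` contribute.
  have : ∑ᶠ h ∈ 𝒢.rng ⁻¹' {𝒢.rng g}, f h * ζ (𝒢.mul (𝒢.inv h) g) =
      ∑ᶠ h ∈ {h | 𝒢.src h = 𝒢.rng g ∧ 𝒢.rng h = 𝒢.rng g}, f h * ζ (𝒢.mul (𝒢.inv h) g) := by
    refine finsum_mem_inter_support_eq' _ _ _ fun h hh => ?_
    refine ⟨fun hr => ⟨?_, hr⟩, fun hr => hr.2⟩
    have hr' : 𝒢.rng h = 𝒢.rng g := hr
    by_contra hs
    refine hh ?_
    simp only
    rw [h3, mul_zero]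
    rwa [𝒢.rng_mul _ _ (by rw [𝒢.src_inv, hr']), 𝒢.rng_inv]
  rw [this, ← finsum_set_coe_eq_finsum_mem]
  refine finsum_congr fun h => ?_
  rw [ζ.apply_inv_mul hg h, h2, mul_one]

end Functional

end EtaleGroupoid

/-! ### Neighbourhoods in the space of characters. -/

namespace EtaleGroupoid
variable {X : Type u} {G : Type v} [TopologicalSpace X] [TopologicalSpace G]
variable {𝒢 : EtaleGroupoid X G}

namespace Char

theorem isOpen_basicSet {U : Set X} {K : Set G} {V : Set Circle} (hU : IsOpen U)
    (hK : IsCompact K) (hKi : K ⊆ {g | 𝒢.src g = 𝒢.rng g}) (hV : IsOpen V) :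
    IsOpen (basicSet U K V : Set 𝒢.Char) :=
  TopologicalSpace.isOpen_generateFrom_of_mem ⟨U, K, V, hU, hK, hKi, hV, rfl⟩

theorem continuous_pt : Continuous (pt : 𝒢.Char → X) := by
  refine ⟨fun U hU => ?_⟩
  have : (pt ⁻¹' U : Set 𝒢.Char) = basicSet U ∅ univ := by
    ext p; simp [basicSet]
  rw [this]
  exact isOpen_basicSet hU isCompact_empty (empty_subset _) isOpen_univ

/-- Only the base point of `q` matters. Over each unit a bisection has at most one element, and it
varies continuously; the claim is vacuous where that element is missing or is not isotropy. -/
theorem eventually_forall_mem {p : 𝒢.Char} {W O : Set G} (hWo : IsOpen W) (hW : InjOn 𝒢.rng W)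
    {γ : 𝒢.Isotropy p.pt} (hγ : γ.1 ∈ W) (hO : O ∈ 𝓝 γ.1) :
    ∀ᶠ q : 𝒢.Char in 𝓝 p, ∀ h : 𝒢.Isotropy q.pt, h.1 ∈ W → h.1 ∈ O := by
  have h1 := eventually_mem_of_mem_bisection hWo hW hγ hO
  rw [γ.2.2] at h1
  filter_upwards [(continuous_pt (𝒢 := 𝒢)).continuousAt.eventually h1] with q hq h hh
  exact hq _ hh h.2.2

variable [T2Space G] [LocallyCompactSpace G]

theorem isClosed_isotropy : IsClosed {g | 𝒢.src g = 𝒢.rng g} := by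
  have := t2Space_unitSpace 𝒢
  exact isClosed_eq 𝒢.continuous_src 𝒢.continuous_rng

/-- A compact neighbourhood of γ inside `W`, cut down to the isotropy bundle, gives a subbasic set
containing `p`, because `W` meets the isotropy group at x in γ alone. Nearby isotropy elements of
`W` fall into that compact set. -/
theorem eventually_dist_lt {p : 𝒢.Char} {W : Set G} (hWo : IsOpen W) (hW : InjOn 𝒢.rng W)
    {γ : 𝒢.Isotropy p.pt} (hγ : γ.1 ∈ W) {ε : ℝ} (hε : 0 < ε) :
    ∀ᶠ q : 𝒢.Char in 𝓝 p, ∀ h : 𝒢.Isotropy q.pt, h.1 ∈ W → dist (q.chi h) (p.chi γ) < ε := by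
  obtain ⟨L, hL, hLW, hLc⟩ := local_compact_nhds (hWo.mem_nhds hγ)
  have hO := isOpen_basicSet (𝒢 := 𝒢) isOpen_univ (hLc.inter_right isClosed_isotropy)
    inter_subset_right (Metric.isOpen_ball (x := p.chi γ) (ε := ε))
  have hp : p ∈ (basicSet univ (L ∩ {g | 𝒢.src g = 𝒢.rng g}) (Metric.ball (p.chi γ) ε) :
      Set 𝒢.Char) := by
    refine ⟨trivial, fun h hh => ?_⟩
    have : h = γ := Subtype.ext (hW (hLW hh.1) hγ (h.2.2.trans γ.2.2.symm))
    rw [this]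
    exact Metric.mem_ball_self hε
  filter_upwards [hO.mem_nhds hp, eventually_forall_mem hWo hW hγ hL] with q hq1 hq2 h hh
  exact hq1.2 h ⟨hq2 h hh, h.2.1.trans h.2.2.symm⟩

/-- Every neighbourhood of `(x, χ)` contains one described by finitely many elements of the isotropy
group. -/
theorem exists_of_mem_nhds {p : 𝒢.Char} {O : Set 𝒢.Char} (hO : O ∈ 𝓝 p) :
    ∃ U : Set X, IsOpen U ∧ p.pt ∈ U ∧ ∃ (F : Finset (𝒢.Isotropy p.pt)) (ε : ℝ), 0 < ε ∧
      ∀ q : 𝒢.Char, q.pt ∈ U → (∀ γ ∈ F, ∀ h : 𝒢.Isotropy q.pt, h.1 ∈ 𝒢.bis γ.1 →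
        dist (q.chi h) (p.chi γ) < ε) → q ∈ O := by
  classical
  have := t2Space_unitSpace 𝒢
  -- The sets admitting such a description form a filter, so it is enough to treat the generating
  -- sets of the topology.
  let 𝓕 : Filter 𝒢.Char :=
    { sets := {O | ∃ U : Set X, IsOpen U ∧ p.pt ∈ U ∧ ∃ (F : Finset (𝒢.Isotropy p.pt)) (ε : ℝ),
        0 < ε ∧ ∀ q : 𝒢.Char, q.pt ∈ U → (∀ γ ∈ F, ∀ h : 𝒢.Isotropy q.pt, h.1 ∈ 𝒢.bis γ.1 →
          dist (q.chi h) (p.chi γ) < ε) → q ∈ O}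
      univ_sets := ⟨univ, isOpen_univ, trivial, ∅, 1, one_pos, fun _ _ _ => trivial⟩
      sets_of_superset := by
        rintro O O' ⟨U, hU, hpU, F, ε, hε, h⟩ hOO'
        exact ⟨U, hU, hpU, F, ε, hε, fun q h1 h2 => hOO' (h q h1 h2)⟩
      inter_sets := by
        rintro O O' ⟨U, hU, hpU, F, ε, hε, h⟩ ⟨U', hU', hpU', F', ε', hε', h'⟩
        refine ⟨U ∩ U', hU.inter hU', ⟨hpU, hpU'⟩, F ∪ F', min ε ε', lt_min hε hε',
          fun q h1 h2 => ⟨h q h1.1 fun γ hγ k hk => ?_, h' q h1.2 fun γ hγ k hk => ?_⟩⟩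
        · exact (h2 γ (Finset.mem_union_left _ hγ) k hk).trans_le (min_le_left _ _)
        · exact (h2 γ (Finset.mem_union_right _ hγ) k hk).trans_le (min_le_right _ _) }
  suffices h : 𝓕 ≤ 𝓝 p from h hO
  rw [TopologicalSpace.nhds_generateFrom]
  refine le_iInf₂ ?_
  rintro O ⟨hpO, U, K, V, hU, hK, hKi, hV, rfl⟩
  obtain ⟨hpU, hpK⟩ : p ∈ (basicSet U K V : Set 𝒢.Char) := hpO
  rw [le_principal_iff]
  have hKx : IsCompact (K ∩ 𝒢.rng ⁻¹' {p.pt}) :=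
    hK.inter_right (isClosed_singleton.preimage 𝒢.continuous_rng)
  have hmem : ∀ g ∈ K ∩ 𝒢.rng ⁻¹' {p.pt}, 𝒢.src g = p.pt ∧ 𝒢.rng g = p.pt := fun g hg =>
    ⟨(hKi hg.1).trans hg.2, hg.2⟩
  obtain ⟨t, ht⟩ := hKx.elim_finite_subcover
    (fun γ : {γ : 𝒢.Isotropy p.pt // γ.1 ∈ K} => 𝒢.bis γ.1.1) (fun γ => isOpen_bis _)
    (fun g hg => mem_iUnion.2 ⟨⟨⟨g, hmem g hg⟩, hg.1⟩, mem_bis g⟩)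
  -- The finitely many bisections cover the part of `K` over x. What they leave over is compact and
  -- its range misses x, so shrinking the base makes them cover all of `K` there.
  have hcl : IsClosed (𝒢.rng '' (K \ ⋃ γ ∈ t, 𝒢.bis γ.1.1)) :=
    ((hK.diff (isOpen_biUnion fun γ _ => isOpen_bis _)).image 𝒢.continuous_rng).isClosed
  obtain ⟨ε, hε, hεV⟩ : ∃ ε > 0, ∀ γ ∈ t, Metric.ball (p.chi γ.1) ε ⊆ V := by
    have h1 : ∀ γ : {γ : 𝒢.Isotropy p.pt // γ.1 ∈ K}, ∀ᶠ ε in 𝓝[>] (0 : ℝ),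
        Metric.ball (p.chi γ.1) ε ⊆ V := by
      intro γ
      obtain ⟨δ, hδ, hδV⟩ := Metric.isOpen_iff.1 hV _ (hpK γ.1 γ.2)
      filter_upwards [Ioo_mem_nhdsGT hδ] with ε hε
      exact (Metric.ball_subset_ball hε.2.le).trans hδV
    have h2 := (eventually_all_finset t).2 fun γ _ => h1 γ
    obtain ⟨ε, h3, h4⟩ := (h2.and self_mem_nhdsWithin).exists
    exact ⟨ε, h4, h3⟩
  refine ⟨U ∩ (𝒢.rng '' (K \ ⋃ γ ∈ t, 𝒢.bis γ.1.1))ᶜ, hU.inter hcl.isOpen_compl, ⟨hpU, ?_⟩,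
    t.image Subtype.val, ε, hε, fun q hqU hq => ⟨hqU.1, fun h hh => ?_⟩⟩
  · rintro ⟨g, ⟨hgK, hg⟩, hgp⟩
    exact hg (ht ⟨hgK, hgp⟩)
  · have h1 : h.1 ∈ ⋃ γ ∈ t, 𝒢.bis γ.1.1 := by
      by_contra hn
      exact hqU.2 ⟨h.1, ⟨hh, hn⟩, h.2.2⟩
    obtain ⟨γ, hγt, hγ⟩ := mem_iUnion₂.1 h1
    exact hεV γ hγt (hq γ.1 (Finset.mem_image_of_mem _ hγt) h hγ)

end Char

/-! ### Limits of the functionals along an ultrafilter. -/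

section Limit

variable [T2Space G] [LocallyCompactSpace G]

/-- The elements of the isotropy group at `x` which are limits, along an ultrafilter converging to
`(x, χ)`, of elements of isotropy groups. -/
def limitIsotropy (𝒰 : Ultrafilter 𝒢.Char) {p : 𝒢.Char} (h𝒰 : ↑𝒰 ≤ 𝓝 p) :
    Subgroup (𝒢.Isotropy p.pt) where
  -- That `h` approaches γ need not be demanded: it follows from `Char.eventually_forall_mem`,
  -- because 𝒰 converges to `p`.
  carrier := {γ | ∀ᶠ q : 𝒢.Char in 𝒰, ∃ h : 𝒢.Isotropy q.pt, h.1 ∈ 𝒢.bis γ.1}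
  one_mem' := by
    have h1 : ∀ᶠ y in 𝓝 p.pt, 𝒢.unit y ∈ 𝒢.bis (𝒢.unit p.pt) :=
      𝒢.continuous_unit.continuousAt.eventually ((isOpen_bis _).mem_nhds (mem_bis _))
    filter_upwards [h𝒰 (Char.continuous_pt.continuousAt.eventually h1)] with q hq
    exact ⟨1, hq⟩
  inv_mem' := by
    intro γ hγ
    have h1 : 𝒢.inv ⁻¹' 𝒢.bis (𝒢.inv γ.1) ∈ 𝓝 γ.1 :=
      𝒢.continuous_inv.continuousAt.preimage_mem_nhds ((isOpen_bis _).mem_nhds (mem_bis _))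
    filter_upwards [hγ, h𝒰 (Char.eventually_forall_mem (isOpen_bis _) (isBisection_bis γ.1).2
      (mem_bis _) h1)] with q hq1 hq2
    obtain ⟨h, hh⟩ := hq1
    exact ⟨h⁻¹, hq2 h hh⟩
  mul_mem' := by
    intro γ γ' hγ hγ'
    have hm := 𝒢.continuousOn_mul (γ.1, γ'.1) (γ.2.1.trans γ'.2.2.symm)
    have h1 := hm.preimage_mem_nhdsWithin
      ((isOpen_bis _).mem_nhds (mem_bis (𝒢 := 𝒢) (𝒢.mul γ.1 γ'.1)))
    rw [mem_nhdsWithin_iff_exists_mem_nhds_inter] at h1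
    obtain ⟨O, hO, hOm⟩ := h1
    rw [nhds_prod_eq] at hO
    obtain ⟨O₁, hO₁, O₂, hO₂, hOO⟩ := mem_prod_iff.1 hO
    filter_upwards [hγ, hγ', h𝒰 (Char.eventually_forall_mem (isOpen_bis _)
      (isBisection_bis γ.1).2 (mem_bis _) hO₁), h𝒰 (Char.eventually_forall_mem (isOpen_bis _)
      (isBisection_bis γ'.1).2 (mem_bis _) hO₂)] with q ⟨h, hh⟩ ⟨h', hh'⟩ hq hq'
    have hmem : (h.1, h'.1) ∈ O ∩ {p : G × G | 𝒢.src p.1 = 𝒢.rng p.2} :=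
      ⟨hOO ⟨hq h hh, hq' h' hh'⟩, h.2.1.trans h'.2.2.symm⟩
    exact ⟨h * h', hOm hmem⟩

open Classical in
/-- The limit of the functionals attached to characters. -/
theorem tendsto_charFunctional (𝒰 : Ultrafilter 𝒢.Char) {p : 𝒢.Char} (h𝒰 : ↑𝒰 ≤ 𝓝 p)
    (f : 𝒢.Cc) : Tendsto (fun q : 𝒢.Char => charFunctional q f) 𝒰
      (𝓝 (∑ᶠ γ : 𝒢.Isotropy p.pt,
        if γ ∈ limitIsotropy 𝒰 h𝒰 then f γ.1 * (p.chi γ : ℂ) else 0)) := by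
  have := t2Space_unitSpace 𝒢
  have hfin : ∀ (f : 𝒢.Cc) (q : 𝒢.Char) (s : Subgroup (𝒢.Isotropy q.pt)),
      (Function.support fun γ : 𝒢.Isotropy q.pt =>
        if γ ∈ s then f γ.1 * (q.chi γ : ℂ) else 0).Finite := fun f q s =>
    (finite_isotropy_support f q.pt).subset fun γ hγ h0 => hγ (by simp [h0])
  have hfin' : ∀ (f : 𝒢.Cc) (q : 𝒢.Char),
      (Function.support fun γ : 𝒢.Isotropy q.pt => f γ.1 * (q.chi γ : ℂ)).Finite := fun f q =>
    (finite_isotropy_support f q.pt).subset fun γ hγ h0 => hγ (by simp [h0])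
  induction f using Cc.induction with
  | hzero => simp [charFunctional]
  | hadd f g hf hg =>
    convert hf.add hg using 2
    · simp only [charFunctional, Cc.add_apply, add_mul]
      exact finsum_add_distrib (hfin' f _) (hfin' g _)
    · refine Eq.trans (finsum_congr fun γ => ?_) (finsum_add_distrib
        (hfin f p (limitIsotropy 𝒰 h𝒰)) (hfin g p (limitIsotropy 𝒰 h𝒰)))
      split_ifs
      · rw [Cc.add_apply, add_mul]
      · rw [add_zero]
  | hb f hf =>
    obtain ⟨W, hWo, hWb, hfW⟩ := hf
    have hsW : Function.support f ⊆ W := (subset_tsupport f).trans hfW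
    by_cases hex : ∃ γ : 𝒢.Isotropy p.pt, γ.1 ∈ W
    · obtain ⟨γ, hγ⟩ := hex
      have hlim : (∑ᶠ γ : 𝒢.Isotropy p.pt,
          if γ ∈ limitIsotropy 𝒰 h𝒰 then f γ.1 * (p.chi γ : ℂ) else 0) =
          if γ ∈ limitIsotropy 𝒰 h𝒰 then f γ.1 * (p.chi γ : ℂ) else 0 := by
        refine finsum_eq_single _ _ fun h hh => ?_
        by_cases h0 : f h.1 = 0
        · rw [h0, zero_mul, ite_self]
        · exact absurd (Subtype.ext (hWb.2 (hsW h0) hγ (h.2.2.trans γ.2.2.symm))) hh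
      rw [hlim]
      split_ifs with hγH
      · refine Metric.tendsto_nhds.2 fun ε hε => ?_
        have hO : {g | dist (f g) (f γ.1) < ε / 2} ∈ 𝓝 γ.1 :=
          Metric.tendsto_nhds.1 f.continuous.continuousAt _ (half_pos hε)
        -- The bound for the change of the character is multiplied by ‖f(γ)‖ below; the summand 1
        -- covers f(γ) = 0.
        have hδ : 0 < ε / (2 * (‖f γ.1‖ + 1)) := by positivity
        filter_upwards [hγH, h𝒰 (Char.eventually_forall_mem (isOpen_bis _)
            (isBisection_bis γ.1).2 (mem_bis _) (hWo.mem_nhds hγ)),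
          h𝒰 (Char.eventually_forall_mem hWo hWb.2 hγ hO),
          h𝒰 (Char.eventually_dist_lt hWo hWb.2 hγ hδ)] with q ⟨h, hh⟩ h1 h2 h3
        have hhW := h1 h hh
        rw [charFunctional_eq_of_mem hWb.2 hsW hhW]
        have h4 : dist (f h.1) (f γ.1) < ε / 2 := h2 h hhW
        have h5 := h3 h hhW
        replace h5 : ‖(q.chi h : ℂ) - (p.chi γ : ℂ)‖ < ε / (2 * (‖f γ.1‖ + 1)) := by
          rw [← dist_eq_norm]; exact h5
        rw [dist_eq_norm] at h4 ⊢
        have h6 : f h.1 * (q.chi h : ℂ) - f γ.1 * (p.chi γ : ℂ) =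
            (f h.1 - f γ.1) * (q.chi h : ℂ) + f γ.1 * ((q.chi h : ℂ) - (p.chi γ : ℂ)) := by ring
        have h7 : ‖f γ.1‖ * (ε / (2 * (‖f γ.1‖ + 1))) ≤ ε / 2 := by
          rw [mul_div_assoc', div_le_div_iff₀ (by positivity) two_pos]
          nlinarith [norm_nonneg (f γ.1)]
        rw [h6]
        refine (norm_add_le _ _).trans_lt ?_
        rw [norm_mul, norm_mul, Circle.norm_coe, mul_one]
        have h8 := mul_le_mul_of_nonneg_left h5.le (norm_nonneg (f γ.1))
        linarith
      · refine tendsto_const_nhds.congr' ?_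
        -- An ultrafilter decides: if γ is not a limit of isotropy elements, then eventually there
        -- are none near γ at all, and the functionals vanish.
        have hγH' : ¬ ∀ᶠ q : 𝒢.Char in 𝒰, ∃ h : 𝒢.Isotropy q.pt, h.1 ∈ 𝒢.bis γ.1 := hγH
        rw [← Ultrafilter.eventually_not] at hγH'
        filter_upwards [hγH', h𝒰 (Char.eventually_forall_mem hWo hWb.2 hγ
          ((isOpen_bis (𝒢 := 𝒢) γ.1).mem_nhds (mem_bis γ.1)))] with q h1 h2
        refine (charFunctional_eq_zero fun h => ?_).symm
        by_contra h0
        exact h1 ⟨h, h2 h (hsW h0)⟩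
    · push Not at hex
      have h0 : ∀ γ : 𝒢.Isotropy p.pt, f γ.1 = 0 := fun γ => by
        by_contra h; exact hex γ (hsW h)
      have hlim : (∑ᶠ γ : 𝒢.Isotropy p.pt,
          if γ ∈ limitIsotropy 𝒰 h𝒰 then f γ.1 * (p.chi γ : ℂ) else 0) = 0 := by
        exact (finsum_congr fun γ => by rw [h0, zero_mul, ite_self]).trans finsum_zero
      rw [hlim]
      refine tendsto_const_nhds.congr' ?_
      -- If `W` has no isotropy over x, compactness of the support gives the same for the support of
      -- `f` over all nearby units.
      have hcl : IsClosed (𝒢.rng '' (tsupport f ∩ {g | 𝒢.src g = 𝒢.rng g})) :=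
        ((f.hasCompactSupport.isCompact.inter_right (Char.isClosed_isotropy (𝒢 := 𝒢))).image
          𝒢.continuous_rng).isClosed
      have hn : p.pt ∉ 𝒢.rng '' (tsupport f ∩ {g | 𝒢.src g = 𝒢.rng g}) := by
        rintro ⟨g, ⟨hg, hgi⟩, hgp⟩
        exact hex ⟨g, Eq.trans hgi hgp, hgp⟩ (hfW hg)
      filter_upwards [h𝒰 ((Char.continuous_pt (𝒢 := 𝒢)).continuousAt.eventually
        (hcl.isOpen_compl.mem_nhds hn))] with q hq
      refine (charFunctional_eq_zero fun h => ?_).symm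
      by_contra h0
      exact hq ⟨h.1, ⟨subset_tsupport _ h0, h.2.1.trans h.2.2.symm⟩, h.2.2⟩

end Limit

end EtaleGroupoid

/-! ### Compression of the limit functional. -/

namespace EtaleGroupoid
variable {X : Type u} {G : Type v} [TopologicalSpace X] [TopologicalSpace G]
variable {𝒢 : EtaleGroupoid X G} [T2Space G] [LocallyCompactSpace G]

section Convolution

theorem Cc.star_mul_apply_of_mem {f : 𝒢.Cc} {W : Set G} (hW : InjOn 𝒢.src W)
    (hf : Function.support f ⊆ W) (F : 𝒢.Cc) {w g : G} (hw : w ∈ W) (hwg : 𝒢.src w = 𝒢.rng g) :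
    (star f * F) g = conj (f w) * F (𝒢.mul w g) := by
  have hinj : InjOn 𝒢.rng (𝒢.inv ⁻¹' W) := fun a ha b hb hab => by
    have := hW ha hb (by rw [𝒢.src_inv, 𝒢.src_inv, hab])
    rw [← 𝒢.inv_inv a, this, 𝒢.inv_inv]
  rw [Cc.coe_mul, conv_eq_of_mem hinj (fun k hk => hf fun h0 => hk (by
      rw [Cc.star_apply, h0, map_zero])) _ (w := 𝒢.inv w)
      (by rw [mem_preimage, 𝒢.inv_inv]; exact hw) (by rw [𝒢.rng_inv, hwg]),
    𝒢.inv_inv, Cc.star_apply, 𝒢.inv_inv]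

/-- The adjoint of `Cc.star_mul_apply_of_mem`. -/
theorem Cc.mul_apply_of_mem {f : 𝒢.Cc} {W : Set G} (hW : InjOn 𝒢.src W)
    (hf : Function.support f ⊆ W) (F : 𝒢.Cc) {w g : G} (hw : w ∈ W) (hwg : 𝒢.src w = 𝒢.src g) :
    (F * f) g = F (𝒢.mul g (𝒢.inv w)) * f w := by
  have e : 𝒢.src w = 𝒢.rng (𝒢.inv g) := by rw [𝒢.rng_inv, hwg]
  rw [← star_star (F * f), star_mul, Cc.star_apply,
    Cc.star_mul_apply_of_mem hW hf _ hw e, Cc.star_apply, 𝒢.inv_mul_rev _ _ e, 𝒢.inv_inv, map_mul,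
    Complex.conj_conj, Complex.conj_conj, mul_comm]

theorem Cc.sum_apply {ι : Type*} (s : Finset ι) (f : ι → 𝒢.Cc) (g : G) :
    (∑ i ∈ s, f i) g = ∑ i ∈ s, f i g := by
  classical
  induction s using Finset.induction_on with
  | empty => simp
  | insert a s ha ih => rw [Finset.sum_insert ha, Finset.sum_insert ha, Cc.add_apply, ih]

variable {x : X} {ι : Type*} (T : Finset ι) (c : ι → ℂ) (t : ι → 𝒢.Isotropy x) (β : ι → 𝒢.Cc)

/-- At arrows of the isotropy group at x, multiplication by β_i or its adjoint behaves like
multiplication by a point mass at t_i or its inverse, since the bisection has just one arrow with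
source x. Products can thus be computed as in the group algebra. -/
theorem star_sum_mul_apply (hβ1 : ∀ i, β i (t i).1 = 1)
    (hβ : ∀ i, Function.support (β i) ⊆ 𝒢.bis (t i).1) (F : 𝒢.Cc) (h : 𝒢.Isotropy x) :
    (star (∑ i ∈ T, c i • β i) * F) h.1 = ∑ i ∈ T, conj (c i) * F (t i * h).1 := by
  rw [star_sum, Finset.sum_mul, Cc.sum_apply]
  refine Finset.sum_congr rfl fun i _ => ?_
  rw [star_smul, smul_mul_assoc, Cc.smul_apply, Cc.star_mul_apply_of_mem
    (isBisection_bis (t i).1).1 (hβ i) F (mem_bis _) ((t i).2.1.trans h.2.2.symm), hβ1, map_one,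
    one_mul]
  rfl

theorem mul_sum_apply (hβ1 : ∀ i, β i (t i).1 = 1)
    (hβ : ∀ i, Function.support (β i) ⊆ 𝒢.bis (t i).1) (F : 𝒢.Cc) (h : 𝒢.Isotropy x) :
    (F * ∑ i ∈ T, c i • β i) h.1 = ∑ i ∈ T, c i * F (h * (t i)⁻¹).1 := by
  rw [Finset.mul_sum, Cc.sum_apply]
  refine Finset.sum_congr rfl fun i _ => ?_
  rw [mul_smul_comm, Cc.smul_apply, Cc.mul_apply_of_mem
    (isBisection_bis (t i).1).1 (hβ i) F (mem_bis _) ((t i).2.1.trans h.2.1.symm), hβ1, mul_one]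
  rfl

end Convolution

section WeakContainment

variable {p : 𝒢.Char}

/-- The reason for the phases in the compressing element: they cancel against the character and
leave real coefficients times χ(u). -/
theorem conj_mul_chi (χ : 𝒢.Isotropy p.pt →* Circle) (a b : ℝ) (s t u : 𝒢.Isotropy p.pt) :
    conj ((a : ℂ) * conj (χ s : ℂ)) * ((b : ℂ) * conj (χ t : ℂ)) * (χ (s⁻¹ * u * t) : ℂ) =
      (a * b : ℝ) * (χ u : ℂ) := by
  have h : ∀ k, (χ k : ℂ) * conj (χ k : ℂ) = 1 := fun k => by
    rw [Complex.mul_conj, Complex.normSq_eq_norm_sq, Circle.norm_coe]; simp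
  have e : (χ (s⁻¹ * u * t) : ℂ) = conj (χ s : ℂ) * χ u * χ t := by
    rw [map_mul, map_mul, map_inv, Circle.coe_mul, Circle.coe_mul, Circle.coe_inv_eq_conj]
  rw [e, map_mul, Complex.conj_conj, Complex.conj_ofReal, Complex.ofReal_mul]
  linear_combination (a * b * χ u * (χ t * conj (χ t : ℂ)) : ℂ) * h s + (a * b * χ u : ℂ) * h t

open Classical in
/-- The value of the limit functional after compression by `b`. -/
theorem finsum_compression (H : Subgroup (𝒢.Isotropy p.pt)) (T : Finset (𝒢.Isotropy p.pt ⧸ H))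
    (κ : 𝒢.Isotropy p.pt ⧸ H → ℝ) (β : 𝒢.Isotropy p.pt ⧸ H → 𝒢.Cc)
    (hβ1 : ∀ q, β q q.out.1 = 1) (hβ : ∀ q, Function.support (β q) ⊆ 𝒢.bis q.out.1) (f : 𝒢.Cc) :
    (∑ᶠ γ : 𝒢.Isotropy p.pt, if γ ∈ H then
      (star (∑ q ∈ T, ((κ q : ℂ) * conj (p.chi q.out : ℂ)) • β q) *
        (f * ∑ q ∈ T, ((κ q : ℂ) * conj (p.chi q.out : ℂ)) • β q)) γ.1 * (p.chi γ : ℂ) else 0) =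
      ∑ᶠ u : 𝒢.Isotropy p.pt, f u.1 * (p.chi u : ℂ) *
        ((∑ q ∈ T, ∑ q' ∈ T, if u • q' = q then κ q * κ q' else 0 : ℝ) : ℂ) := by
  have hsupp : ∀ (P : 𝒢.Isotropy p.pt → Prop) (e : 𝒢.Isotropy p.pt → ℂ)
      (σ : 𝒢.Isotropy p.pt ≃ 𝒢.Isotropy p.pt), (Function.support fun γ : 𝒢.Isotropy p.pt =>
        if P γ then f (σ γ).1 * e γ else 0).Finite := fun P e σ =>
    ((finite_isotropy_support f p.pt).preimage σ.injective.injOn).subset fun γ hγ h0 =>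
      hγ (by simp [h0])
  have h1 : ∀ γ : 𝒢.Isotropy p.pt, (if γ ∈ H then
      (star (∑ q ∈ T, ((κ q : ℂ) * conj (p.chi q.out : ℂ)) • β q) *
        (f * ∑ q ∈ T, ((κ q : ℂ) * conj (p.chi q.out : ℂ)) • β q)) γ.1 * (p.chi γ : ℂ) else 0) =
      ∑ z ∈ T ×ˢ T, if γ ∈ H then f (z.1.out * γ * z.2.out⁻¹).1 *
        (conj ((κ z.1 : ℂ) * conj (p.chi z.1.out : ℂ)) *
          ((κ z.2 : ℂ) * conj (p.chi z.2.out : ℂ)) * (p.chi γ : ℂ)) else 0 := by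
    intro γ
    split_ifs
    · rw [star_sum_mul_apply T _ (fun q => q.out) β hβ1 hβ, Finset.sum_product, Finset.sum_mul]
      refine Finset.sum_congr rfl fun q _ => ?_
      rw [mul_sum_apply T _ (fun q => q.out) β hβ1 hβ, Finset.mul_sum, Finset.sum_mul]
      refine Finset.sum_congr rfl fun q' _ => ?_
      ring
    · simp
  have h2 : ∀ u : 𝒢.Isotropy p.pt, f u.1 * (p.chi u : ℂ) *
        ((∑ q ∈ T, ∑ q' ∈ T, if u • q' = q then κ q * κ q' else 0 : ℝ) : ℂ) =
      ∑ z ∈ T ×ˢ T, if z.1.out⁻¹ * u * z.2.out ∈ H then f u.1 *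
        ((κ z.1 * κ z.2 : ℝ) * (p.chi u : ℂ)) else 0 := by
    intro u
    rw [Complex.ofReal_sum, Finset.sum_product, Finset.mul_sum]
    refine Finset.sum_congr rfl fun q _ => ?_
    rw [Complex.ofReal_sum, Finset.mul_sum]
    refine Finset.sum_congr rfl fun q' _ => ?_
    -- This converts the restriction to H into the action on cosets: under γ = s⁻¹ut with s, t the
    -- representatives of q, q', membership of γ in H says that u carries q' to q. The final sum is
    -- therefore a matrix coefficient of the action on ℓ²(Γ/H).
    have : u • q' = q ↔ q.out⁻¹ * u * q'.out ∈ H := by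
      rw [_root_.mul_assoc, ← QuotientGroup.eq, QuotientGroup.out_eq', ← smul_eq_mul, MulAction.Quotient.mk_smul_out,
        eq_comm]
    simp only [this]
    split_ifs
    · ring
    · simp
  refine (finsum_congr h1).trans (Eq.trans ?_ (finsum_congr h2).symm)
  refine (finsum_sum_comm (T ×ˢ T) _ fun z _ => hsupp (· ∈ H) _
    ((Equiv.mulLeft z.1.out).trans (Equiv.mulRight z.2.out⁻¹))).trans (Eq.trans ?_
    (finsum_sum_comm (T ×ˢ T) _ fun z _ => hsupp (fun u => z.1.out⁻¹ * u * z.2.out ∈ H) _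
      (Equiv.refl _)).symm)
  refine Finset.sum_congr rfl fun z _ => ?_
  rw [← finsum_comp_equiv ((Equiv.mulLeft z.1.out⁻¹).trans (Equiv.mulRight z.2.out))]
  refine finsum_congr fun u => ?_
  simp only [Equiv.trans_apply, Equiv.coe_mulLeft, Equiv.coe_mulRight, conj_mul_chi]
  have : z.1.out * (z.1.out⁻¹ * u * z.2.out) * z.2.out⁻¹ = u := by group
  rw [this]
  rfl

-- Different representatives lie in different cosets of H, so on H only the diagonal terms at the
-- identity survive. Hence a unit vector κ gives a compressing element that is normalized in the
-- limit.
open Classical in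
theorem finsum_star_mul_self (H : Subgroup (𝒢.Isotropy p.pt)) (T : Finset (𝒢.Isotropy p.pt ⧸ H))
    (κ : 𝒢.Isotropy p.pt ⧸ H → ℝ) (β : 𝒢.Isotropy p.pt ⧸ H → 𝒢.Cc)
    (hβ1 : ∀ q, β q q.out.1 = 1) (hβ : ∀ q, Function.support (β q) ⊆ 𝒢.bis q.out.1) :
    (∑ᶠ γ : 𝒢.Isotropy p.pt, if γ ∈ H then
      (star (∑ q ∈ T, ((κ q : ℂ) * conj (p.chi q.out : ℂ)) • β q) *
        (∑ q ∈ T, ((κ q : ℂ) * conj (p.chi q.out : ℂ)) • β q)) γ.1 * (p.chi γ : ℂ) else 0) =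
      ((∑ q ∈ T, κ q ^ 2 : ℝ) : ℂ) := by
  have hβ' : ∀ q (u : 𝒢.Isotropy p.pt), β q u.1 = if u = q.out then 1 else 0 := by
    intro q u
    split_ifs with h
    · rw [h, hβ1]
    · by_contra h0
      exact h (Subtype.ext ((isBisection_bis q.out.1).2 (hβ q h0) (mem_bis _)
        (u.2.2.trans q.out.2.2.symm)))
  have h1 : ∀ γ : 𝒢.Isotropy p.pt, (if γ ∈ H then
      (star (∑ q ∈ T, ((κ q : ℂ) * conj (p.chi q.out : ℂ)) • β q) *
        (∑ q ∈ T, ((κ q : ℂ) * conj (p.chi q.out : ℂ)) • β q)) γ.1 * (p.chi γ : ℂ) else 0) =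
      if γ = 1 then ((∑ q ∈ T, κ q ^ 2 : ℝ) : ℂ) else 0 := by
    intro γ
    by_cases hγ : γ ∈ H
    · rw [if_pos hγ, star_sum_mul_apply T _ (fun q => q.out) β hβ1 hβ]
      have h2 : ∀ q q' : 𝒢.Isotropy p.pt ⧸ H, (q.out * γ = q'.out) ↔ (γ = 1 ∧ q' = q) := by
        intro q q'
        constructor
        · intro h
          have : q' = q := by
            rw [← QuotientGroup.out_eq' q, ← QuotientGroup.out_eq' q', ← h]
            exact (QuotientGroup.eq.2 (by simpa using hγ)).symm
          subst this
          exact ⟨by simpa using h, rfl⟩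
        · rintro ⟨rfl, rfl⟩
          rw [mul_one]
      split_ifs with h
      · subst h
        rw [Finset.sum_mul, Complex.ofReal_sum]
        refine Finset.sum_congr rfl fun q hq => ?_
        rw [Cc.sum_apply, Finset.sum_eq_single_of_mem q hq fun q' _ hne => by
          rw [Cc.smul_apply, hβ', if_neg, mul_zero]
          rw [h2]
          exact fun h => hne h.2]
        rw [Cc.smul_apply, hβ', if_pos (mul_one _), mul_one]
        have := conj_mul_chi p.chi (κ q) (κ q) q.out q.out 1
        rw [mul_one, inv_mul_cancel] at this
        rw [this, sq, map_one]
        simp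
      · refine mul_eq_zero_of_left (Finset.sum_eq_zero fun q hq => ?_) _
        rw [Cc.sum_apply, Finset.sum_eq_zero, mul_zero]
        intro q' _
        rw [Cc.smul_apply, hβ', if_neg, mul_zero]
        rw [h2]
        exact fun h' => h h'.1
    · rw [if_neg hγ, if_neg]
      rintro rfl
      exact hγ H.one_mem
  rw [finsum_congr h1, finsum_eq_single _ 1 fun γ hγ => if_neg hγ, if_pos rfl]

end WeakContainment

end EtaleGroupoid

/-! ### From convergence of orbits to inclusion of kernels. -/

namespace EtaleGroupoid
variable {X : Type u} {G : Type v} [TopologicalSpace X] [TopologicalSpace G]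
variable {𝒢 : EtaleGroupoid X G} [T2Space G] [LocallyCompactSpace G]

section WeakContainment

variable {p : 𝒢.Char}

/-- The union of the orbits of the points of a set. -/
def Char.orbits (S : Set 𝒢.Char) : Set 𝒢.Char := {q | ∃ s ∈ S, q ∈ orbit s}

/-- An element of the kernel of an induced representation is small under the functionals attached
to the points of the orbit, in the sense that approximating elements are. -/
theorem norm_charFunctional_le {s q : 𝒢.Char} (hq : q ∈ Char.orbit s) {a : 𝒢.CStar}
    (ha : indRep s a = 0) {f : 𝒢.Cc} {ε : ℝ} (hf : ‖a - CStar.ofCc f‖ ≤ ε) (b : 𝒢.Cc) :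
    ‖charFunctional q (star b * (f * b) : 𝒢.Cc)‖ ≤ ε * ‖charFunctional q (star b * b : 𝒢.Cc)‖ := by
  obtain ⟨g, hg, rfl⟩ := hq
  obtain ⟨ζ, h1, h2, h3⟩ := exists_evaluation_vector s hg
  rw [← inner_indCc_evaluation s hg h1 h2 h3, ← inner_indCc_evaluation s hg h1 h2 h3, map_mul,
    map_mul, map_mul, map_star, ContinuousLinearMap.star_eq_adjoint,
    mul_apply_eq_comp, mul_apply_eq_comp,
    mul_apply_eq_comp, ContinuousLinearMap.adjoint_inner_right,
    ContinuousLinearMap.adjoint_inner_right]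
  set η := indCc s b ζ
  -- The representation kills `a`, so it sees `f` only through the small difference of `f` and `a`.
  have h4 : ‖indCc s f‖ ≤ ε := by
    have : indCc s f = - indRep s (a - CStar.ofCc f) := by
      rw [map_sub, ha, indRep_ofCc, zero_sub, neg_neg]
    rw [this, norm_neg]
    exact (NonUnitalStarAlgHom.norm_apply_le _ _).trans hf
  rw [inner_self_eq_norm_sq_to_K, norm_pow]
  simp only [Complex.coe_algebraMap, Complex.norm_real, norm_norm]
  calc ‖⟪η, indCc s f η⟫_ℂ‖ ≤ ‖η‖ * ‖indCc s f η‖ := norm_inner_le_norm _ _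
    _ ≤ ‖η‖ * (ε * ‖η‖) := by
      gcongr
      exact ((indCc s f).le_opNorm η).trans (by gcongr)
    _ = ε * ‖η‖ ^ 2 := by ring

/-- The functional attached to a character is a state given by a unit vector of the induced
representation. -/
theorem exists_cyclic_vector (p : 𝒢.Char) :
    ∃ ζ : 𝒢.IndSpace p, ‖ζ‖ = 1 ∧ ∀ f : 𝒢.Cc, ⟪ζ, indCc p f ζ⟫_ℂ = charFunctional p f := by
  obtain ⟨ζ, h1, h2, h3⟩ := exists_evaluation_vector p (𝒢.src_unit p.pt)
  refine ⟨ζ, ?_, fun f => ?_⟩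
  · have := inner_self_eq_norm_sq_to_K (𝕜 := ℂ) ζ
    rw [h1, h2] at this
    have h4 : ‖ζ‖ ^ 2 = 1 := by
      have := congrArg norm this
      simpa using this.symm
    nlinarith [norm_nonneg ζ]
  · rw [inner_indCc_evaluation p (𝒢.src_unit p.pt) h1 h2 h3, Char.act_unit]

/-- Compression by suitable elements of the limit of functionals along an ultrafilter converging to
`(x, χ)` is close to the functional attached to `(x, χ)`, if the isotropy group is amenable. -/
theorem exists_compression (hp : IsAmenable (𝒢.Isotropy p.pt)) (𝒰 : Ultrafilter 𝒢.Char)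
    (h𝒰 : ↑𝒰 ≤ 𝓝 p) (f : 𝒢.Cc) {ε : ℝ} (hε : 0 < ε) :
    ∃ (b : 𝒢.Cc) (z : ℂ), ‖z - charFunctional p f‖ ≤ ε ∧
      Tendsto (fun q : 𝒢.Char => charFunctional q (star b * (f * b) : 𝒢.Cc)) 𝒰 (𝓝 z) ∧
      Tendsto (fun q : 𝒢.Char => charFunctional q (star b * b : 𝒢.Cc)) 𝒰 (𝓝 1) := by
  classical
  set F := (finite_isotropy_support f p.pt).toFinset with hF
  obtain ⟨C, hC, hfC⟩ := f.exists_bound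
  -- Compression multiplies the term at u by a coefficient near 1. There are at most `F.card`
  -- nonzero terms, each of size at most `C`; the summand 1 keeps the denominator positive.
  obtain ⟨T, κ, hκ1, hκ⟩ := hp.exists_almost_invariant_vector (limitIsotropy 𝒰 h𝒰) F
    (ε := ε / (F.card * C + 1)) (by positivity)
  choose φ β hφ h01 hβ1 hβ using fun q : 𝒢.Isotropy p.pt ⧸ limitIsotropy 𝒰 h𝒰 =>
    exists_bump_tsupport (𝒢 := 𝒢) (isOpen_bis (𝒢 := 𝒢) q.out.1) (mem_bis q.out.1)
  have hβ1' : ∀ q, β q q.out.1 = 1 := fun q => by rw [hφ, hβ1]; simp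
  have hβ' : ∀ q, Function.support (β q) ⊆ 𝒢.bis q.out.1 := fun q =>
    (subset_tsupport _).trans (hβ q)
  have t1 := tendsto_charFunctional 𝒰 h𝒰
    (star (∑ q ∈ T, ((κ q : ℂ) * conj (p.chi q.out : ℂ)) • β q) *
        (f * ∑ q ∈ T, ((κ q : ℂ) * conj (p.chi q.out : ℂ)) • β q))
  have t2 := tendsto_charFunctional 𝒰 h𝒰
    (star (∑ q ∈ T, ((κ q : ℂ) * conj (p.chi q.out : ℂ)) • β q) *
        (∑ q ∈ T, ((κ q : ℂ) * conj (p.chi q.out : ℂ)) • β q))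
  rw [finsum_compression _ T κ β hβ1' hβ'] at t1
  rw [finsum_star_mul_self _ T κ β hβ1' hβ', hκ1, Complex.ofReal_one] at t2
  refine ⟨_, _, ?_, t1, t2⟩
  have hsub : ∀ e : 𝒢.Isotropy p.pt → ℂ,
      (Function.support fun u : 𝒢.Isotropy p.pt => f u.1 * e u) ⊆ F := fun e u hu => by
    rw [hF, Set.Finite.coe_toFinset]
    exact left_ne_zero_of_mul hu
  have e1 : charFunctional p f = ∑ u ∈ F, f u.1 * (p.chi u : ℂ) :=
    finsum_eq_sum_of_support_subset _ (hsub _)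
  simp only [_root_.mul_assoc]
  rw [e1, finsum_eq_sum_of_support_subset _ (hsub _), ← Finset.sum_sub_distrib]
  refine (norm_sum_le_of_le (n := fun _ : 𝒢.Isotropy p.pt => C * (ε / (F.card * C + 1))) F
    fun u hu => ?_).trans ?_
  · rw [← mul_sub, norm_mul, ← mul_sub_one, norm_mul, Circle.norm_coe, one_mul]
    refine mul_le_mul (hfC _) ?_ (norm_nonneg _) hC
    have := (hκ u hu).le
    rwa [← Complex.ofReal_one, ← Complex.ofReal_sub, Complex.norm_real, Real.norm_eq_abs]
  · rw [Finset.sum_const, nsmul_eq_mul, ← _root_.mul_assoc, mul_div_assoc',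
      div_le_iff₀ (by positivity)]
    nlinarith

/-- If the isotropy group at `x` is amenable, then the kernel of the representation induced by
`(x, χ)` contains every element killed by the representations induced by a set of characters the
orbits of which accumulate at `(x, χ)`. -/
theorem indRep_eq_zero_of_mem_closure (hp : IsAmenable (𝒢.Isotropy p.pt)) {S : Set 𝒢.Char}
    (hpS : p ∈ closure (Char.orbits S)) {a : 𝒢.CStar} (ha : ∀ s ∈ S, indRep s a = 0) :
    indRep p a = 0 := by
  obtain ⟨𝒰, hS, h𝒰⟩ := mem_closure_iff_ultrafilter.1 hpS
  obtain ⟨ζ, hζ1, hζ⟩ := exists_cyclic_vector p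
  have key : ∀ a : 𝒢.CStar, (∀ s ∈ S, indRep s a = 0) → ⟪ζ, indRep p a ζ⟫_ℂ = 0 := by
    intro a ha
    rw [← norm_le_zero_iff]
    refine le_of_forall_pos_le_add fun ε hε => ?_
    rw [zero_add]
    obtain ⟨f, hf⟩ := (CStar.isDenseInducing_ofCc (𝒢 := 𝒢)).dense.exists_dist_lt a
      (show 0 < ε / 3 by positivity)
    rw [dist_eq_norm] at hf
    obtain ⟨b, z, hz, t1, t2⟩ := exists_compression hp 𝒰 h𝒰 f (show 0 < ε / 3 by positivity)
    -- Along the ultrafilter the compressed values are at most ε/3 times the functional at b*b, and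
    -- the latter tends to 1.
    have h1 : ‖z‖ ≤ ε / 3 := by
      have t3 := t2.norm.const_mul (ε / 3)
      rw [norm_one, mul_one] at t3
      refine le_of_tendsto_of_tendsto t1.norm t3 ?_
      filter_upwards [hS] with q hq
      obtain ⟨s, hs, hqs⟩ := hq
      exact norm_charFunctional_le hqs (ha s hs) hf.le b
    have h2 : ‖⟪ζ, indRep p (a - CStar.ofCc f) ζ⟫_ℂ‖ ≤ ε / 3 := by
      refine (norm_inner_le_norm _ _).trans ?_
      rw [hζ1, one_mul]
      refine ((indRep p (a - CStar.ofCc f)).le_opNorm ζ).trans ?_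
      rw [hζ1, mul_one]
      exact (NonUnitalStarAlgHom.norm_apply_le _ _).trans hf.le
    have h3 : ⟪ζ, indRep p a ζ⟫_ℂ = ⟪ζ, indRep p (a - CStar.ofCc f) ζ⟫_ℂ +
        (z - (z - charFunctional p f)) := by
      rw [map_sub, sub_apply, inner_sub_right, indRep_ofCc, hζ]
      ring
    rw [h3]
    refine (norm_add_le _ _).trans ?_
    have := norm_sub_le z (z - charFunctional p f)
    linarith
  -- The vectors annihilated by the common kernel. This closed invariant subspace contains the unit
  -- vector ζ, as one sees by applying `key` to `star c * c`; by irreducibility it is everything.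
  let K : Submodule ℂ (𝒢.IndSpace p) :=
    { carrier := {ξ | ∀ c, (∀ s ∈ S, indRep s c = 0) → indRep p c ξ = 0}
      add_mem' := fun {ξ η} hξ hη c hc => by rw [map_add, hξ c hc, hη c hc, add_zero]
      zero_mem' := fun c _ => map_zero _
      smul_mem' := fun z ξ hξ c hc => by rw [map_smul, hξ c hc, smul_zero] }
  have hKc : IsClosed (K : Set (𝒢.IndSpace p)) := by
    have : (K : Set (𝒢.IndSpace p)) =
        ⋂ (c : 𝒢.CStar) (_ : ∀ s ∈ S, indRep s c = 0), (fun ξ => indRep p c ξ) ⁻¹' {0} := by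
      ext ξ; simp [K]
    rw [this]
    exact isClosed_biInter fun c _ => isClosed_singleton.preimage (indRep p c).continuous
  have hKi : ∀ d, ∀ ξ ∈ K, indRep p d ξ ∈ K := fun d ξ hξ c hc => by
    have := hξ (c * d) fun s hs => by rw [map_mul, hc s hs, zero_mul]
    rwa [map_mul] at this
  have hζK : ζ ∈ K := fun c hc => by
    have := key (star c * c) fun s hs => by rw [map_mul, hc s hs, mul_zero]
    rw [map_mul, map_star, ContinuousLinearMap.star_eq_adjoint, mul_apply_eq_comp,
      ContinuousLinearMap.adjoint_inner_right] at this
    exact inner_self_eq_zero.1 this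
  rcases (isIrreducibleRep_indRep p).2 K hKc hKi with hK | hK
  · rw [hK, Submodule.mem_bot] at hζK
    rw [hζK, norm_zero] at hζ1
    exact absurd hζ1 zero_ne_one
  · refine ContinuousLinearMap.ext fun ξ => ?_
    have : ξ ∈ K := by rw [hK]; trivial
    exact this a ha

end WeakContainment

end EtaleGroupoid

/-! ### Almost maximal sums in a Hilbert space. -/

section Hilbert

variable {H : Type*} [NormedAddCommGroup H] [InnerProductSpace ℂ H]

/-- If a sum of vectors of the unit ball is almost as long as possible, they are close to each
other. -/
theorem norm_sub_sq_le_of_norm_add_sum {ι : Type*} (F : Finset ι) {v₀ : H} {v : ι → H} {δ : ℝ}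
    (hδ : δ ≤ 1) (h₀ : ‖v₀‖ ≤ 1) (h : ∀ i ∈ F, ‖v i‖ ≤ 1)
    (hs : F.card + 1 - δ ≤ ‖v₀ + ∑ i ∈ F, v i‖) :
    1 - δ ≤ ‖v₀‖ ∧ ∀ i ∈ F, ‖v i - v₀‖ ^ 2 ≤ 4 * δ := by
  classical
  constructor
  · have h1 := norm_add_le v₀ (∑ i ∈ F, v i)
    have h2 := norm_sum_le_of_le F h
    rw [Finset.sum_const, nsmul_eq_mul, mul_one] at h2
    linarith
  · intro i hi
    have h1 : ‖∑ j ∈ F.erase i, v j‖ ≤ F.card - 1 := by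
      have h2 := norm_sum_le_of_le (F.erase i) fun j hj => h j (Finset.mem_of_mem_erase hj)
      rw [Finset.sum_const, nsmul_eq_mul, mul_one, Finset.card_erase_of_mem hi,
        Nat.cast_pred (Finset.card_pos.2 ⟨i, hi⟩)] at h2
      exact h2
    -- Each of the other vectors contributes at most 1. The parallelogram law then bounds the
    -- squared distance by 4 - (2 - δ)² ≤ 4δ.
    have h3 : 2 - δ ≤ ‖v i + v₀‖ := by
      rw [← Finset.add_sum_erase F v hi, ← add_assoc, add_comm v₀] at hs
      have := norm_add_le (v i + v₀) (∑ j ∈ F.erase i, v j)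
      linarith
    have h4 := parallelogram_law_with_norm ℂ (v i) v₀
    have h5 : (2 - δ) ^ 2 ≤ ‖v i + v₀‖ ^ 2 := pow_le_pow_left₀ (by linarith) h3 2
    have h6 : ‖v i‖ ^ 2 ≤ 1 := pow_le_one₀ (norm_nonneg _) (h i hi)
    have h7 : ‖v₀‖ ^ 2 ≤ 1 := pow_le_one₀ (norm_nonneg _) h₀
    nlinarith [sq_nonneg δ]

end Hilbert

/-! ### From inclusion of kernels to convergence of orbits. -/

namespace EtaleGroupoid
variable {X : Type u} {G : Type v} [TopologicalSpace X] [TopologicalSpace G]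
variable {𝒢 : EtaleGroupoid X G} [T2Space G] [LocallyCompactSpace G]

section Separation

/-- A function on the units acts by multiplication, and (φ - 1)² + φ² ≤ 1 for 0 ≤ φ ≤ 1. So a vector
that loses little norm is almost fixed. -/
theorem IndSpace.norm_sub_indCc_sq_le {s : 𝒢.Char} {f : 𝒢.Cc} {φ : G → ℝ} (hφ : ∀ k, f k = φ k)
    (h01 : ∀ k, 0 ≤ φ k ∧ φ k ≤ 1) (hf : Function.support f ⊆ range 𝒢.unit) (ξ : 𝒢.IndSpace s) :
    ‖indCc s f ξ - ξ‖ ^ 2 ≤ ‖ξ‖ ^ 2 - ‖indCc s f ξ‖ ^ 2 := by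
  rw [le_sub_iff_add_le, norm_sq_def, norm_sq_def, norm_sq_def,
    ← (IndSpace.summable _).tsum_add (IndSpace.summable _)]
  refine ((IndSpace.summable _).add (IndSpace.summable _)).tsum_le_tsum (fun q => ?_)
    (IndSpace.summable _)
  have h1 : indCc s f ξ q.rep = φ (𝒢.unit (𝒢.rng q.rep)) * ξ q.rep := by
    change 𝒢.conv f ξ q.rep = _
    rw [conv_of_support_unit hf, hφ]
  have h2 : (indCc s f ξ - ξ) q.rep =
      ((φ (𝒢.unit (𝒢.rng q.rep)) - 1 : ℝ) : ℂ) * ξ q.rep := by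
    change indCc s f ξ q.rep - ξ q.rep = _
    rw [h1]; push_cast; ring
  obtain ⟨h3, h4⟩ := h01 (𝒢.unit (𝒢.rng q.rep))
  rw [h1, h2, norm_mul, norm_mul, Complex.norm_real, Complex.norm_real, mul_pow, mul_pow,
    Real.norm_eq_abs, Real.norm_eq_abs, sq_abs, sq_abs, ← add_mul]
  refine mul_le_of_le_one_left (sq_nonneg _) ?_
  nlinarith

/-- An estimate for the norm of a vector, if at each point one of finitely many other vectors is
not small. -/
theorem IndSpace.norm_sq_le_of_forall {s : 𝒢.Char} {ι : Type*} (F : Finset ι) {c : ℝ} (hc : 0 ≤ c)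
    {ξ η₀ : 𝒢.IndSpace s} {η : ι → 𝒢.IndSpace s}
    (h : ∀ q : 𝒢.Cosets s.pt, ‖ξ q.rep‖ ^ 2 ≤ ‖η₀ q.rep‖ ^ 2 ∨
      ∃ i ∈ F, ‖ξ q.rep‖ ^ 2 ≤ c * ‖η i q.rep‖ ^ 2) :
    ‖ξ‖ ^ 2 ≤ ‖η₀‖ ^ 2 + ∑ i ∈ F, c * ‖η i‖ ^ 2 := by
  simp only [norm_sq_def, ← tsum_mul_left]
  rw [← Summable.tsum_finsetSum fun i _ => (IndSpace.summable (η i)).mul_left c,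
    ← (IndSpace.summable _).tsum_add (summable_sum fun i _ => (IndSpace.summable _).mul_left c)]
  refine (IndSpace.summable _).tsum_le_tsum (fun q => ?_)
    ((IndSpace.summable _).add (summable_sum fun i _ => (IndSpace.summable _).mul_left c))
  have hpos : ∀ i ∈ F, 0 ≤ c * ‖η i q.rep‖ ^ 2 := fun i _ => by positivity
  rcases h q with h | ⟨i, hi, h⟩
  · exact h.trans (le_add_of_nonneg_right (Finset.sum_nonneg hpos))
  · exact h.trans ((Finset.single_le_sum hpos hi).trans (le_add_of_nonneg_left (sq_nonneg _)))

/-- If the common kernel of the representations induced by a set of characters is contained in the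
kernel of the one induced by `(x, χ)`, then the orbits of these characters accumulate at
`(x, χ)`. -/
theorem mem_closure_of_ker_le {p : 𝒢.Char} {S : Set 𝒢.Char}
    (hker : ∀ a, (∀ s ∈ S, indRep s a = 0) → indRep p a = 0) : p ∈ closure (Char.orbits S) := by
  classical
  rw [mem_closure_iff_nhds]
  intro O hO
  by_contra hne
  have hne' : ∀ s ∈ S, ∀ (g : G) (hg : 𝒢.src g = s.pt), Char.act g s hg ∉ O := fun s hs g hg hgO =>
    hne ⟨_, hgO, s, hs, g, hg, rfl⟩
  obtain ⟨U, hU, hpU, F, ε, hε, hFO⟩ := Char.exists_of_mem_nhds hO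
  choose φ f hφ h01 hφ1 hfW using fun γ : 𝒢.Isotropy p.pt =>
    exists_bump_tsupport (𝒢 := 𝒢) (isOpen_bis (𝒢 := 𝒢) γ.1) (mem_bis γ.1)
  have hfW' : ∀ γ, Function.support (f γ) ⊆ 𝒢.bis γ.1 := fun γ => (subset_tsupport _).trans (hfW γ)
  have hf1 : ∀ γ, f γ γ.1 = 1 := fun γ => by rw [hφ, hφ1]; simp
  have hnorm : ∀ γ k, ‖f γ k‖ ≤ 1 := fun γ k => by
    rw [hφ, Complex.norm_real, Real.norm_eq_abs, abs_of_nonneg (h01 γ k).1]; exact (h01 γ k).2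
  -- shrink `U` so that the bump functions are almost `1` over it
  have hev : ∀ᶠ y in 𝓝 p.pt, y ∈ U ∧ ∀ γ ∈ F, ∀ h ∈ 𝒢.bis γ.1, 𝒢.rng h = y → 1 - ε / 2 ≤ φ γ h := by
    refine (hU.eventually_mem hpU).and ((eventually_all_finset F).2 fun γ _ => ?_)
    have h1 : {k | 1 - ε / 2 ≤ φ γ k} ∈ 𝓝 γ.1 := by
      have hc : Continuous (φ γ) := by
        have : φ γ = fun k => (f γ k).re := funext fun k => by rw [hφ]; simp
        rw [this]
        exact Complex.continuous_re.comp (f γ).continuous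
      refine hc.continuousAt.preimage_mem_nhds (Ici_mem_nhds ?_)
      rw [hφ1]; linarith
    have := eventually_mem_of_mem_bisection (isOpen_bis (𝒢 := 𝒢) γ.1)
      (isBisection_bis γ.1).2 (mem_bis _) h1
    rwa [γ.2.2] at this
  obtain ⟨U', hU'U, hU', hpU'⟩ := eventually_nhds_iff.1 hev
  obtain ⟨W₀, hW₀, hpW₀, hW₀u⟩ := 𝒢.exists_unit_nhd p.pt
  obtain ⟨φ₀, f₀, hφ₀, h₀1, hφ₀1, hf₀W⟩ := exists_bump_tsupport (𝒢 := 𝒢)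
    (hW₀.inter (hU'.preimage 𝒢.continuous_rng)) (g := 𝒢.unit p.pt)
    ⟨hpW₀, by rw [mem_preimage, 𝒢.rng_unit]; exact hpU'⟩
  have hf₀u : Function.support f₀ ⊆ range 𝒢.unit :=
    ((subset_tsupport _).trans hf₀W).trans (inter_subset_left.trans hW₀u)
  have hunit : 𝒢.IsBisection (range 𝒢.unit) := by
    constructor
    · rintro _ ⟨x, rfl⟩ _ ⟨y, rfl⟩ hxy
      rw [𝒢.src_unit, 𝒢.src_unit] at hxy
      rw [hxy]
    · rintro _ ⟨x, rfl⟩ _ ⟨y, rfl⟩ hxy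
      rw [𝒢.rng_unit, 𝒢.rng_unit] at hxy
      rw [hxy]
  have hf₀b : f₀.OnBisection := ⟨W₀, hW₀, ⟨hunit.1.mono hW₀u, hunit.2.mono hW₀u⟩,
    hf₀W.trans inter_subset_left⟩
  have hnorm₀ : ∀ k, ‖f₀ k‖ ≤ 1 := fun k => by
    rw [hφ₀, Complex.norm_real, Real.norm_eq_abs, abs_of_nonneg (h₀1 k).1]; exact (h₀1 k).2
  -- the test element
  set a : 𝒢.Cc := f₀ + ∑ γ ∈ F, conj (p.chi γ : ℂ) • f γ with ha
  -- Chosen for the final contradiction: the estimates below give (1 - δ)² ≤ ‖ξ‖² ≤ 2δ + 48|F|δ/ε²,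
  -- and by the choice of δ the right side is 1 - 3δ < 1 - 2δ.
  set δ : ℝ := 1 / (5 + 48 * F.card / ε ^ 2) with hδ
  have hden : (0 : ℝ) ≤ 48 * F.card / ε ^ 2 := by positivity
  have hδ0 : 0 < δ := by positivity
  have hδ1 : δ ≤ 1 := by
    rw [hδ, div_le_one (by linarith)]; linarith
  -- On the vector state of `p` the weights conj χ(γ) make every summand contribute exactly 1.
  have hlow : (F.card : ℝ) + 1 ≤ ‖indRep p (CStar.ofCc a)‖ := by
    obtain ⟨ζ, hζ1, hζ⟩ := exists_cyclic_vector p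
    have h1 : ⟪ζ, indCc p a ζ⟫_ℂ = F.card + 1 := by
      have h2 : ∀ γ : 𝒢.Isotropy p.pt, conj (p.chi γ : ℂ) * charFunctional p (f γ) = 1 := by
        intro γ
        rw [charFunctional_eq_of_mem (isBisection_bis γ.1).2 (hfW' γ) (mem_bis γ.1), hf1, one_mul,
          mul_comm, Complex.mul_conj, Complex.normSq_eq_norm_sq, Circle.norm_coe]
        simp
      have h3 : charFunctional p f₀ = 1 := by
        rw [charFunctional_eq_of_mem hunit.2 hf₀u (w := 1) ⟨p.pt, rfl⟩, map_one]
        rw [isotropy_one_val, hφ₀, hφ₀1]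
        simp
      rw [ha, map_add, add_apply, inner_add_right, hζ, h3, map_sum, sum_apply, inner_sum]
      simp only [map_smul, smul_apply, inner_smul_right, hζ, h2]
      rw [Finset.sum_const, nsmul_eq_mul, mul_one, add_comm]
    have h2 : ‖⟪ζ, indCc p a ζ⟫_ℂ‖ ≤ ‖indCc p a‖ := by
      refine (norm_inner_le_norm _ _).trans ?_
      rw [hζ1, one_mul]
      refine ((indCc p a).le_opNorm ζ).trans ?_
      rw [hζ1, mul_one]
    rw [h1] at h2
    rw [indRep_ofCc]
    refine le_trans (le_of_eq ?_) h2
    have := Complex.norm_natCast (F.card + 1)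
    push_cast at this
    exact this.symm
  obtain ⟨s, hs, hsa⟩ : ∃ s ∈ S, (F.card : ℝ) + 1 - δ < ‖indRep s (CStar.ofCc a)‖ := by
    by_contra! h
    have := norm_le_of_forall_norm_le (indRep p) (fun s : S => indRep s.1)
      (fun b hb => hker b fun s hs => hb ⟨s, hs⟩) (a := CStar.ofCc a)
      (c := (F.card : ℝ) + 1 - δ) (by linarith [(Nat.cast_nonneg F.card : (0 : ℝ) ≤ _)])
      (fun s => h s.1 s.2)
    linarith
  rw [indRep_ofCc] at hsa
  obtain ⟨ξ, hξ1, hξ⟩ := ContinuousLinearMap.exists_lt_apply_of_lt_opNorm _ hsa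
  let v : 𝒢.Isotropy p.pt → 𝒢.IndSpace s := fun γ => conj (p.chi γ : ℂ) • indCc s (f γ) ξ
  have hv₀ : ‖indCc s f₀ ξ‖ ≤ 1 := by
    refine ((indCc s f₀).le_opNorm ξ).trans ?_
    exact mul_le_one₀ (norm_rep_le hf₀b zero_le_one hnorm₀ _) (norm_nonneg _) hξ1.le
  have hv : ∀ γ ∈ F, ‖v γ‖ ≤ 1 := fun γ _ => by
    rw [norm_smul, RCLike.norm_conj, Circle.norm_coe, one_mul]
    refine ((indCc s (f γ)).le_opNorm ξ).trans ?_
    exact mul_le_one₀ (norm_rep_le ⟨_, isOpen_bis _, isBisection_bis _, hfW γ⟩ zero_le_one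
      (hnorm γ) _) (norm_nonneg _) hξ1.le
  have hsum : indCc s a ξ = indCc s f₀ ξ + ∑ γ ∈ F, v γ := by
    rw [ha, map_add, add_apply, map_sum, sum_apply]
    simp only [map_smul, smul_apply, v]
  rw [hsum] at hξ
  obtain ⟨hA, hB⟩ := norm_sub_sq_le_of_norm_add_sum F hδ1 hv₀ hv hξ.le
  have hC := IndSpace.norm_sub_indCc_sq_le hφ₀ h₀1 hf₀u ξ
  have hξsq : ‖ξ‖ ^ 2 ≤ 1 := pow_le_one₀ (norm_nonneg _) hξ1.le
  have hAsq : (1 - δ) ^ 2 ≤ ‖indCc s f₀ ξ‖ ^ 2 := pow_le_pow_left₀ (by linarith) hA 2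
  -- Here 1 - (1 - δ)² ≤ 2δ. Combined with the bound 4δ for the distance of the summands, this gives
  -- 2(4δ + 2δ) = 12δ below.
  have hC' : ‖indCc s f₀ ξ - ξ‖ ^ 2 ≤ 2 * δ := by nlinarith [sq_nonneg δ]
  have hD : ∀ γ ∈ F, ‖v γ - ξ‖ ^ 2 ≤ 12 * δ := fun γ hγ => by
    have h1 := norm_add_le (v γ - indCc s f₀ ξ) (indCc s f₀ ξ - ξ)
    rw [sub_add_sub_cancel] at h1
    have h2 := pow_le_pow_left₀ (norm_nonneg _) h1 2
    have h3 := hB γ hγ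
    nlinarith [sq_nonneg (‖v γ - indCc s f₀ ξ‖ - ‖indCc s f₀ ξ - ξ‖)]
  -- Each coset gives a point of the orbit of `s`, which lies outside the neighbourhood. Either its
  -- unit is outside `U'`, and `f₀` kills ξ there, or its character is ε-far from χ at some γ ∈ F,
  -- and the γ-summand moves ξ there by at least the fraction ε/2; hence the constant 4/ε².
  have hmain := IndSpace.norm_sq_le_of_forall F (c := 4 / ε ^ 2) (by positivity) (ξ := ξ)
    (η₀ := indCc s f₀ ξ - ξ) (η := fun γ => v γ - ξ) fun q => by
      have hnot : ¬ (𝒢.rng q.rep ∈ U' ∧ ∀ γ ∈ F,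
          ∀ h : 𝒢.Isotropy (Char.act q.rep s q.src_rep).pt, h.1 ∈ 𝒢.bis γ.1 →
          dist ((Char.act q.rep s q.src_rep).chi h) (p.chi γ) < ε) := fun hn =>
        hne' s hs q.rep q.src_rep (hFO _ (hU'U _ hn.1).1 hn.2)
      by_cases hqU : 𝒢.rng q.rep ∈ U'
      · right
        have hnot' : ¬ ∀ γ ∈ F,
            ∀ h : 𝒢.Isotropy (Char.act q.rep s q.src_rep).pt, h.1 ∈ 𝒢.bis γ.1 →
            dist ((Char.act q.rep s q.src_rep).chi h) (p.chi γ) < ε := fun hn => hnot ⟨hqU, hn⟩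
        push Not at hnot'
        obtain ⟨γ, hγ, h, hh, hdist⟩ := hnot'
        refine ⟨γ, hγ, ?_⟩
        have hφh := (hU'U _ hqU).2 γ hγ h.1 hh h.2.2
        have hφh' := (h01 γ h.1).2
        set z : ℂ := ((Char.act q.rep s q.src_rep).chi h : ℂ) with hz
        have hz1 : ‖z‖ = 1 := Circle.norm_coe _
        have hdist' : ε ≤ ‖z - (p.chi γ : ℂ)‖ := by
          rw [← dist_eq_norm]; exact hdist
        have hval : (v γ - ξ) q.rep =
            conj (p.chi γ : ℂ) * ((φ γ h.1 : ℂ) * z - p.chi γ) * ξ q.rep := by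
          have h1 : indCc s (f γ) ξ q.rep = φ γ h.1 * (z * ξ q.rep) := by
            change 𝒢.conv (f γ) ξ q.rep = _
            rw [conv_eq_of_mem (isBisection_bis γ.1).2 (hfW' γ) _ hh h.2.2,
              ξ.apply_inv_mul q.src_rep h, hφ]
          have h2 : (p.chi γ : ℂ) * conj (p.chi γ : ℂ) = 1 := by
            rw [Complex.mul_conj, Complex.normSq_eq_norm_sq, Circle.norm_coe]; simp
          change conj (p.chi γ : ℂ) * indCc s (f γ) ξ q.rep - ξ q.rep = _
          rw [h1]
          linear_combination (ξ q.rep) * h2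
        -- Of the distance ε between the character values, at most ε/2 is lost because the bump
        -- function is only at least 1 - ε/2 over `U'`.
        have hlow : ε / 2 ≤ ‖(φ γ h.1 : ℂ) * z - p.chi γ‖ := by
          have h1 : z - (p.chi γ : ℂ) = ((φ γ h.1 : ℂ) * z - p.chi γ) + ((1 - φ γ h.1 : ℝ) : ℂ) * z := by
            push_cast; ring
          have h2 := norm_add_le ((φ γ h.1 : ℂ) * z - p.chi γ) (((1 - φ γ h.1 : ℝ) : ℂ) * z)
          rw [← h1, norm_mul, Complex.norm_real, hz1, Real.norm_eq_abs,
            abs_of_nonneg (by linarith)] at h2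
          linarith
        rw [hval, norm_mul, norm_mul, RCLike.norm_conj, Circle.norm_coe, one_mul, mul_pow,
          ← _root_.mul_assoc]
        refine le_mul_of_one_le_left (sq_nonneg _) ?_
        rw [div_mul_eq_mul_div, one_le_div (by positivity)]
        have := pow_le_pow_left₀ (by positivity) hlow 2
        linarith
      · left
        have h1 : indCc s f₀ ξ q.rep = 0 := by
          change 𝒢.conv f₀ ξ q.rep = 0
          rw [conv_of_support_unit hf₀u]
          have : f₀ (𝒢.unit (𝒢.rng q.rep)) = 0 := by
            by_contra h0
            have := (hf₀W (subset_tsupport _ h0)).2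
            rw [mem_preimage, 𝒢.rng_unit] at this
            exact hqU this
          rw [this, zero_mul]
        have h2 : (indCc s f₀ ξ - ξ) q.rep = - ξ q.rep := by
          change indCc s f₀ ξ q.rep - ξ q.rep = _
          rw [h1, zero_sub]
        rw [h2, norm_neg]
  have hE : ∑ γ ∈ F, 4 / ε ^ 2 * ‖v γ - ξ‖ ^ 2 ≤ F.card * (4 / ε ^ 2 * (12 * δ)) := by
    rw [← nsmul_eq_mul]
    exact Finset.sum_le_card_nsmul _ _ _ fun γ hγ => by gcongr; exact hD γ hγ
  have hξlow : (1 - δ) ^ 2 ≤ ‖ξ‖ ^ 2 := by nlinarith [sq_nonneg ‖indCc s f₀ ξ - ξ‖]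
  have hfin : δ * (5 + 48 * F.card / ε ^ 2) = 1 := by
    rw [hδ, one_div_mul_cancel (by linarith)]
  have hrw : (F.card : ℝ) * (4 / ε ^ 2 * (12 * δ)) = δ * (48 * F.card / ε ^ 2) := by ring
  rw [hrw] at hE
  nlinarith [sq_nonneg δ]

end Separation

end EtaleGroupoid

/-! ### Quotient maps and the Jacobson topology. -/

/-- Two quotient maps with the same fibres have homeomorphic targets. -/
theorem Topology.IsQuotientMap.exists_homeomorph {X Y Z : Type*} [TopologicalSpace X]
    [TopologicalSpace Y] [TopologicalSpace Z] {f : C(X, Y)} {g : C(X, Z)} (hf : IsQuotientMap f)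
    (hg : IsQuotientMap g) (h : ∀ a b, f a = f b ↔ g a = g b) : ∃ e : Y ≃ₜ Z, ∀ a, e (f a) = g a := by
  have hfg : Function.FactorsThrough g f := fun a b => (h a b).1
  have hgf : Function.FactorsThrough f g := fun a b => (h a b).2
  have h1 : ∀ a, hf.lift g hfg (f a) = g a := DFunLike.congr_fun (hf.lift_comp g hfg)
  have h2 : ∀ a, hg.lift f hgf (g a) = f a := DFunLike.congr_fun (hg.lift_comp f hgf)
  exact ⟨{  toFun := hf.lift g hfg
            invFun := hg.lift f hgf
            left_inv := hf.surjective.forall.2 fun a => by rw [h1, h2]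
            right_inv := hg.surjective.forall.2 fun a => by rw [h2, h1]
            continuous_toFun := (hf.lift g hfg).continuous
            continuous_invFun := (hg.lift f hgf).continuous }, h1⟩

section PrimSpec

variable {A : Type v} [NonUnitalCStarAlgebra A]

/-- The intersection of the ideals in `T` is closed, and its hull is the smallest closed set
containing `T`. -/
theorem PrimSpec.mem_closure_iff (I : PrimSpec A) (T : Set (PrimSpec A)) :
    I ∈ closure T ↔ ∀ a, (∀ J ∈ T, a ∈ J.1) → a ∈ I.1 := by
  constructor
  · intro h a ha
    let J₀ : TwoSidedIdeal A := sInf (Subtype.val '' T)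
    have hJ₀ : ∀ b, b ∈ J₀ ↔ ∀ J ∈ T, b ∈ J.1 := fun b => by
      simp only [J₀, TwoSidedIdeal.mem_sInf]
      exact forall_mem_image
    have hcl : IsClosed (J₀ : Set A) := by
      have : (J₀ : Set A) = ⋂ J ∈ T, ((J : PrimSpec A).1 : Set A) := by
        ext b
        simp only [SetLike.mem_coe, hJ₀, mem_iInter]
      rw [this]
      exact isClosed_biInter fun J _ => J.isClosed
    have hT : closure T ⊆ hull J₀ :=
      closure_minimal (fun J hJ b hb => (hJ₀ b).1 hb J hJ)
        ((PrimSpec.isClosed_iff _).2 ⟨J₀, hcl, rfl⟩)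
    exact hT h ((hJ₀ a).2 ha)
  · intro h C ⟨hC, hTC⟩
    obtain ⟨J, -, rfl⟩ := (PrimSpec.isClosed_iff _).1 hC
    exact fun a ha => h a fun I hI => hTC hI ha

/-- Specialization of points is inclusion of ideals, hence antisymmetric. This is what turns
statements on closures into equalities of induced ideals. -/
instance : T0Space (PrimSpec A) where
  t0 I J h := by
    have h1 := (PrimSpec.mem_closure_iff I {J}).1 h.specializes'.mem_closure
    have h2 := (PrimSpec.mem_closure_iff J {I}).1 h.specializes.mem_closure
    exact Subtype.ext (TwoSidedIdeal.ext fun a => ⟨fun ha => h2 a (by simpa using ha),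
      fun ha => h1 a (by simpa using ha)⟩)

end PrimSpec

/-! ### The topology of the space of induced primitive ideals. -/

namespace EtaleGroupoid
variable {X : Type u} {G : Type v} [TopologicalSpace X] [TopologicalSpace G]
variable {𝒢 : EtaleGroupoid X G} [T2Space G] [LocallyCompactSpace G]

section Topology

/-- The closure of a set of induced primitive ideals, in terms of orbits of characters. -/
theorem ind_mem_closure_iff {p : 𝒢.Char} (hp : IsAmenable (𝒢.Isotropy p.pt)) (S : Set 𝒢.Char) :
    Ind p ∈ closure (Ind '' S) ↔ p ∈ closure (Char.orbits S) := by
  rw [PrimSpec.mem_closure_iff]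
  have hmem : ∀ (q : 𝒢.Char) a, a ∈ (Ind q).1 ↔ indRep q a = 0 := fun q a =>
    TwoSidedIdeal.mem_ker _
  simp only [forall_mem_image, hmem]
  exact ⟨mem_closure_of_ker_le, fun h a ha => indRep_eq_zero_of_mem_closure hp h ha⟩

theorem ind_mem_closure_singleton_iff {p : 𝒢.Char} (hp : IsAmenable (𝒢.Isotropy p.pt))
    (q : 𝒢.Char) : Ind p ∈ closure {Ind q} ↔ p ∈ closure (Char.orbit q) := by
  have := ind_mem_closure_iff hp {q}
  rw [image_singleton] at this
  rw [this]
  simp [Char.orbits]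

theorem ind_eq_ind_iff {p q : 𝒢.Char} (hp : IsAmenable (𝒢.Isotropy p.pt))
    (hq : IsAmenable (𝒢.Isotropy q.pt)) :
    Ind p = Ind q ↔ p ∈ closure (Char.orbit q) ∧ q ∈ closure (Char.orbit p) := by
  rw [← ind_mem_closure_singleton_iff hp, ← ind_mem_closure_singleton_iff hq]
  refine ⟨fun h => by rw [h]; exact ⟨subset_closure rfl, subset_closure rfl⟩, fun h => ?_⟩
  exact (specializes_iff_mem_closure.2 h.2).antisymm (specializes_iff_mem_closure.2 h.1) |>.eq

theorem ind_eq_ind_of_mem_orbit {p q : 𝒢.Char} (hp : IsAmenable (𝒢.Isotropy p.pt))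
    (hq : IsAmenable (𝒢.Isotropy q.pt)) (h : q ∈ Char.orbit p) : Ind q = Ind p := by
  rw [ind_eq_ind_iff hq hp, Char.orbit_eq_of_mem h]
  exact ⟨subset_closure h, subset_closure (Char.mem_orbit_self p)⟩

/-- Invariance keeps the whole orbit of a point of `A` inside `A`, where isotropy is amenable and
the closure criterion applies; all points of the orbit induce the same ideal. -/
theorem closure_orbit_eq_iff {A : Set 𝒢.Char} (hA : A ⊆ Char.amenableSet 𝒢)
    (hinv : Char.IsInvariant A) (p q : A) :
    Ind p.1 = Ind q.1 ↔ closure (Char.orbit p.1) = closure (Char.orbit q.1) := by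
  constructor
  · have key : ∀ p q : A, Ind p.1 = Ind q.1 → Char.orbit p.1 ⊆ closure (Char.orbit q.1) := by
      rintro p q h _ ⟨g, hg, rfl⟩
      have hgA := hinv p.1 p.2 g hg
      rw [← ind_mem_closure_singleton_iff (hA hgA), ← h,
        ind_eq_ind_of_mem_orbit (hA p.2) (hA hgA) (Char.act_mem_orbit _ _ _)]
      exact subset_closure rfl
    intro h
    exact (closure_minimal (key p q h) isClosed_closure).antisymm
      (closure_minimal (key q p h.symm) isClosed_closure)
  · intro h
    rw [ind_eq_ind_iff (hA p.2) (hA q.2), ← h]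
    exact ⟨subset_closure (Char.mem_orbit_self _), h ▸ subset_closure (Char.mem_orbit_self _)⟩

theorem mem_closure_orbit_subtype_iff {A : Set 𝒢.Char}
    (hinv : Char.IsInvariant A) (p q : A) :
    p ∈ closure {a : A | a.1 ∈ Char.orbit q.1} ↔ p.1 ∈ closure (Char.orbit q.1) := by
  rw [closure_subtype]
  have : (Subtype.val '' {a : A | a.1 ∈ Char.orbit q.1} : Set 𝒢.Char) = Char.orbit q.1 := by
    refine (image_subset_iff.2 fun a ha => ha).antisymm ?_
    rintro _ ⟨g, hg, rfl⟩
    exact ⟨⟨_, hinv q.1 q.2 g hg⟩, ⟨g, hg, rfl⟩, rfl⟩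
  rw [this]

theorem closure_orbit_subtype_eq_iff {A : Set 𝒢.Char} (hA : A ⊆ Char.amenableSet 𝒢)
    (hinv : Char.IsInvariant A) (p q : A) :
    Ind p.1 = Ind q.1 ↔ closure {a : A | a.1 ∈ Char.orbit p.1} =
      closure {a : A | a.1 ∈ Char.orbit q.1} := by
  constructor
  · intro h
    ext r
    rw [mem_closure_orbit_subtype_iff hinv, mem_closure_orbit_subtype_iff hinv,
      ← ind_mem_closure_singleton_iff (hA r.2), ← ind_mem_closure_singleton_iff (hA r.2), h]
  · intro h
    rw [ind_eq_ind_iff (hA p.2) (hA q.2), ← mem_closure_orbit_subtype_iff hinv,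
      ← mem_closure_orbit_subtype_iff hinv, ← h]
    exact ⟨subset_closure (Char.mem_orbit_self _), h ▸ subset_closure (Char.mem_orbit_self _)⟩

/-- A limit of points of a set is also a limit of their orbits, so the criterion puts its ideal in
the closure of the ideals of that set. -/
theorem continuous_ind {A : Set 𝒢.Char} (hA : A ⊆ Char.amenableSet 𝒢) :
    Continuous fun p : A => Ind p.1 := by
  refine continuous_iff_isClosed.2 fun C hC => ?_
  rw [← closure_subset_iff_isClosed]
  intro p hp
  rw [closure_subtype] at hp
  have h1 : Ind p.1 ∈ closure (Ind '' (Subtype.val '' ((fun p : A => Ind p.1) ⁻¹' C))) :=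
    (ind_mem_closure_iff (hA p.2) _).2
      (closure_mono (t := Char.orbits (Subtype.val '' ((fun p : A => Ind p.1) ⁻¹' C)))
        (fun q hq => ⟨q, hq, Char.mem_orbit_self q⟩) hp)
  refine closure_minimal ?_ hC h1
  rintro _ ⟨_, ⟨q, hq, rfl⟩, rfl⟩
  exact hq

theorem isOpenMap_ind {A : Set 𝒢.Char} (hA : A ⊆ Char.amenableSet 𝒢)
    (hinv : Char.IsInvariant A) : IsOpenMap fun p : A => (⟨Ind p.1, mem_image_of_mem _ p.2⟩ :
    (Ind '' A : Set (PrimSpec 𝒢.CStar))) := by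
  intro U hU
  rw [← isClosed_compl_iff, ← closure_subset_iff_isClosed]
  rintro ⟨_, p, hpA, rfl⟩ hp ⟨q, hqU, hqp⟩
  obtain ⟨O, hO, rfl⟩ := isOpen_induced_iff.1 hU
  have hqp' : Ind q.1 = Ind p := congrArg Subtype.val hqp
  -- The points of `A` whose ideals avoid the image of the open set. If `Ind q`, with q in that open
  -- set, were in the closure of `Ind '' V`, an orbit through `V` would enter the open set, and
  -- `Ind` is constant on it.
  let V : Set 𝒢.Char := {v | v ∈ A ∧ ∀ u : A, u.1 ∈ O → Ind u.1 ≠ Ind v}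
  have h1 : Ind q.1 ∈ closure (Ind '' V) := by
    rw [hqp']
    rw [closure_subtype] at hp
    refine closure_mono ?_ hp
    rintro _ ⟨⟨_, v, hv, rfl⟩, hvU, rfl⟩
    exact ⟨v, ⟨hv, fun u huO huv => hvU ⟨u, huO, Subtype.ext huv⟩⟩, rfl⟩
  rw [ind_mem_closure_iff (hA q.2)] at h1
  obtain ⟨w, hwO, v, hv, hwv⟩ := mem_closure_iff.1 h1 O hO hqU
  have hwA : w ∈ A := by
    obtain ⟨g, hg, rfl⟩ := hwv
    exact hinv v hv.1 g hg
  exact hv.2 ⟨w, hwA⟩ hwO (ind_eq_ind_of_mem_orbit (hA hv.1) (hA hwA) hwv)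

/-- `Ind` descends to a continuous map from the orbit space to a T₀ space, so it cannot distinguish
inseparable points. Conversely, equal ideals mean equal orbit closures in `A`, and each orbit is a
single point of the orbit space. -/
theorem quasiOrbit_eq_iff {A : Set 𝒢.Char} (hA : A ⊆ Char.amenableSet 𝒢)
    (hinv : Char.IsInvariant A) (p q : A) :
    Char.quasiOrbit p = Char.quasiOrbit q ↔ Ind p.1 = Ind q.1 := by
  rw [Char.quasiOrbit, Char.quasiOrbit, SeparationQuotient.mk_eq_mk]
  constructor
  · intro h
    have hc : Continuous (Quotient.lift (s := Char.orbitSetoid A) (fun p : A => Ind p.1)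
        fun a b (hab : Char.orbit a.1 = Char.orbit b.1) => ind_eq_ind_of_mem_orbit (hA b.2) (hA a.2)
          (hab ▸ Char.mem_orbit_self a.1)) :=
      (continuous_ind hA).quotient_lift _
    exact (h.map hc).eq
  · have key : ∀ p q : A, Ind p.1 = Ind q.1 →
        (Quotient.mk (Char.orbitSetoid A) p) ⤳ (Quotient.mk (Char.orbitSetoid A) q) := by
      intro p q h
      rw [specializes_iff_mem_closure]
      have h1 : q ∈ closure {a : A | a.1 ∈ Char.orbit p.1} := by
        rw [closure_orbit_subtype_eq_iff hA hinv] at h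
        rw [h]
        exact subset_closure (Char.mem_orbit_self q.1)
      refine closure_mono ?_ (image_closure_subset_closure_image continuous_quotient_mk'
        (mem_image_of_mem (Quotient.mk (Char.orbitSetoid A)) h1))
      rintro _ ⟨a, ha, rfl⟩
      exact Quotient.sound (Char.orbit_eq_of_mem ha)
    intro h
    exact (key p q h).antisymm (key q p h.symm)

end Topology

end EtaleGroupoid

theorem mainTheorem2 {X : Type u} {G : Type v} [TopologicalSpace X] [TopologicalSpace G]
    [T2Space G] [LocallyCompactSpace G] (𝒢 : EtaleGroupoid X G)
    (A : Set 𝒢.Char) (hA : A ⊆ EtaleGroupoid.Char.amenableSet 𝒢)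
    (hinv : EtaleGroupoid.Char.IsInvariant A) :
    (∃ Φ : EtaleGroupoid.Char.QuasiOrbitSpace A ≃ₜ
        (EtaleGroupoid.Ind '' A : Set (PrimSpec 𝒢.CStar)),
      ∀ p : A, (Φ (EtaleGroupoid.Char.quasiOrbit p) : PrimSpec 𝒢.CStar) =
        EtaleGroupoid.Ind p.1) ∧
    IsOpenMap (fun p : A => (⟨EtaleGroupoid.Ind p.1, Set.mem_image_of_mem _ p.2⟩ :
      (EtaleGroupoid.Ind '' A : Set (PrimSpec 𝒢.CStar)))) ∧
    (∀ p q : A, EtaleGroupoid.Ind p.1 = EtaleGroupoid.Ind q.1 ↔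
      closure {a : A | a.1 ∈ EtaleGroupoid.Char.orbit p.1} =
        closure {a : A | a.1 ∈ EtaleGroupoid.Char.orbit q.1}) ∧
    (∀ p q : A, EtaleGroupoid.Ind p.1 = EtaleGroupoid.Ind q.1 ↔
      closure (EtaleGroupoid.Char.orbit p.1) = closure (EtaleGroupoid.Char.orbit q.1)) := by
  refine ⟨?_, EtaleGroupoid.isOpenMap_ind hA hinv,
    EtaleGroupoid.closure_orbit_subtype_eq_iff hA hinv, EtaleGroupoid.closure_orbit_eq_iff hA hinv⟩
  let F : C(A, (EtaleGroupoid.Ind '' A : Set (PrimSpec 𝒢.CStar))) :=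
    ⟨fun p => ⟨EtaleGroupoid.Ind p.1, Set.mem_image_of_mem _ p.2⟩,
      (EtaleGroupoid.continuous_ind hA).subtype_mk _⟩
  -- Openness makes `Ind` a quotient map onto its image, so no separate argument for continuity of
  -- the inverse is needed.
  have hF : IsQuotientMap F := (EtaleGroupoid.isOpenMap_ind hA hinv).isQuotientMap F.continuous
    (by rintro ⟨_, p, hp, rfl⟩; exact ⟨⟨p, hp⟩, rfl⟩)
  let Q : C(A, EtaleGroupoid.Char.QuasiOrbitSpace A) :=
    ⟨EtaleGroupoid.Char.quasiOrbit, SeparationQuotient.continuous_mk.comp continuous_quotient_mk'⟩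
  have hQ : IsQuotientMap Q := SeparationQuotient.isQuotientMap_mk.comp isQuotientMap_quotient_mk'
  have hFQ : ∀ p q : A, Q p = Q q ↔ F p = F q := fun p q =>
    (EtaleGroupoid.quasiOrbit_eq_iff hA hinv p q)
      |>.trans ⟨fun h => Subtype.ext h, fun h => congrArg Subtype.val h⟩
  obtain ⟨e, he⟩ := hQ.exists_homeomorph hF hFQ
  exact ⟨e, fun p => congrArg Subtype.val (he p)⟩
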